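/- Let $n\ge 0$ be an integer and $d=n+1$. Operads are symmetric operads in graded real vector spaces, in arities $N\ge 1$, with the usual Koszul signs. **The operad $\mathsf{Ger}_d$.** It is generated by a product $a_1\wedge a_2$ of degree $0$ and a bracket $\{a_1,a_2\}$ of degree $1-d$, subject to: $\wedge$ is graded commutative and associative; $\{a,b\}=(-1)^d(-1)^{ab}\{b,a\}$; $\{\{a,b\},c\}+(-1)^{a(b+c)}\{\{b,c\},a\}+(-1)^{c(a+b)}\{\{c,a\},b\}=0$; $\{a,b\wedge c\}=\{a,b\}\wedge c+(-1)^{b(a+1-d)}\,b\wedge\{a,c\}$. **The operad $\mathsf{Gra}_d$.** $\mathsf{Gra}_d(N)$ is spanned by the directed graphs (multiple edges and loops allowed) with vertices $1,\dots,N$ and finitely many ordered edges. A graph with $k$ edges has degree $k(1-d)$; flipping the direction of an edge multiplies a graph by $(-1)^d$, and exchanging two edges in the ordering multiplies it by $(-1)^{d+1}$. A permutation $\sigma$ relabels the vertex $v$ as $\sigma^{-1}(v)$. The composition $\gamma\circ_i\gamma'$ inserts $\gamma'$ at the $i$-th vertex of $\gamma$ and sums over all ways of reconnecting the ends of edges of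 $\gamma$ at that vertex to vertices of $\gamma'$, the edges of $\gamma$ preceding those of $\gamma'$. Let $\Gamma_\wedge\in\mathsf{Gra}_d(2)$ be the graph without edges and $\Gamma_{\{,\}}\in\mathsf{Gra}_d(2)$ the graph with one edge from $1$ to $2$. **Functions.** Let $\mathcal V$ be an NP-manifold of degree $n$ presented in Darboux coordinates: coordinates $x^\mu,p_\mu$ of degrees $0,n$; $\psi^{\alpha_i},\chi_{\alpha_i}$ of degrees $i,n-i$ for integers $1\le i<n/2$; and, if $n$ is even, $\xi^a$ of degree $n/2$ together with a constant invertible matrix $\kappa_{ab}=-(-1)^{n/2}\kappa_{ba}$ with inverse $\kappa^{ab}$ (each family finite, possibly empty). $C^\infty(\mathcal V)$ is the graded commutative algebra of functions that are smooth in the coordinates of degree $0$, ranging over an open subset $U$ of a Euclidean space, and polynomial in the others. With left derivatives, the Poisson bracket of degree $-n$ is, for $n$ odd, $$\{f,g\}_\omega=(-1)^f\tfrac{\partial f}{\partial x^\mu}\tfrac{\partial g}{\partial p_\mu}+\tfrac{\partial f}{\partial p_\mu}\tfrac{\partial g}{\partial x^\mu}+\sum_i\Big((-1)^{f(i+1)}\tfrac{\partial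 f}{\partial\psi^{\alpha_i}}\tfrac{\partial g}{\partial\chi_{\alpha_i}}+(-1)^{if}\tfrac{\partial f}{\partial\chi_{\alpha_i}}\tfrac{\partial g}{\partial\psi^{\alpha_i}}\Big)$$ and, for $n$ even, $$\{f,g\}_\omega=\tfrac{\partial f}{\partial x^\mu}\tfrac{\partial g}{\partial p_\mu}-\tfrac{\partial f}{\partial p_\mu}\tfrac{\partial g}{\partial x^\mu}+\sum_i\Big((-1)^{if}\tfrac{\partial f}{\partial\psi^{\alpha_i}}\tfrac{\partial g}{\partial\chi_{\alpha_i}}-(-1)^{i(f+1)}\tfrac{\partial f}{\partial\chi_{\alpha_i}}\tfrac{\partial g}{\partial\psi^{\alpha_i}}\Big)+(-1)^{fn/2}\tfrac{\partial f}{\partial\xi^a}\kappa^{ab}\tfrac{\partial g}{\partial\xi^b}.$$ For $1\le i,j\le N$ let $\Delta_{ij}$ be the operator on $C^\infty(\mathcal V)^{\otimes N}$ (an index in parentheses is the tensor factor acted on, with Koszul signs) $$\Delta_{ij}=\tfrac{\partial}{\partial x^\mu_{(i)}}\tfrac{\partial}{\partial p_\mu^{(j)}}+\tfrac{\partial}{\partial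 p_\mu^{(i)}}\tfrac{\partial}{\partial x^\mu_{(j)}}+\sum_k\Big(\tfrac{\partial}{\partial\psi^{\alpha_k}_{(i)}}\tfrac{\partial}{\partial\chi_{\alpha_k}^{(j)}}+\tfrac{\partial}{\partial\chi_{\alpha_k}^{(i)}}\tfrac{\partial}{\partial\psi^{\alpha_k}_{(j)}}\Big)\quad(d\text{ even}),$$ $$\Delta_{ij}=\tfrac{\partial}{\partial x^\mu_{(i)}}\tfrac{\partial}{\partial p_\mu^{(j)}}-\tfrac{\partial}{\partial p_\mu^{(i)}}\tfrac{\partial}{\partial x^\mu_{(j)}}+\sum_k\Big(\tfrac{\partial}{\partial\psi^{\alpha_k}_{(i)}}\tfrac{\partial}{\partial\chi_{\alpha_k}^{(j)}}-(-1)^k\tfrac{\partial}{\partial\chi_{\alpha_k}^{(i)}}\tfrac{\partial}{\partial\psi^{\alpha_k}_{(j)}}\Big)+\tfrac{\partial}{\partial\xi^a_{(i)}}\kappa^{ab}\tfrac{\partial}{\partial\xi^b_{(j)}}\quad(d\text{ odd}).$$ **Proposition.** $\mathsf{Ger}_d$, $\mathsf{Gra}_d$ and $\mathsf{End}_{C^\infty(\mathcal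 V)}$ are operads, and: 1. there is a unique morphism of operads $i_d:\mathsf{Ger}_d\to\mathsf{Gra}_d$ with $i_d(a_1\wedge a_2)=\Gamma_\wedge$ and $i_d(\{a_1,a_2\})=\Gamma_{\{,\}}$, and it is injective; 2. for every such $\mathcal V$, the formula $\mathsf{Rep}^{(d)}_N(\gamma)(f_1\otimes\cdots\otimes f_N)=\mu_N\big(\prod_{(i,j)}\Delta_{ij}(f_1\otimes\cdots\otimes f_N)\big)$, with the product over the ordered edges $(i,j)$ of the graph $\gamma$ and $\mu_N$ the multiplication of $N$ functions, defines a morphism of operads $\mathsf{Rep}^{(d)}:\mathsf{Gra}_d\to\mathsf{End}_{C^\infty(\mathcal V)}$, and $\mathsf{Rep}^{(d)}_2(\Gamma_\wedge)(f\otimes g)=f\cdot g$, $\mathsf{Rep}^{(d)}_2(\Gamma_{\{,\}})(f\otimes g)=\{f,g\}_\omega$; 3. for every such $\mathcal V$, the product and $\{\cdot,\cdot\}_\omega$ make $C^\infty(\mathcal V)$ a $\mathsf{Ger}_d$-algebra, i.e. there is a unique morphism of operads $\rho:\mathsf{Ger}_d\to\mathsf{End}_{C^\infty(\mathcal V)}$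 sending $a_1\wedge a_2$ to the product and $\{a_1,a_2\}$ to $\{\cdot,\cdot\}_\omega$; this structure is universal: $\rho$ factors as $\mathsf{Ger}_d\xrightarrow{\,i_d\,}\mathsf{Gra}_d\xrightarrow{\mathsf{Rep}^{(d)}}\mathsf{End}_{C^\infty(\mathcal V)}$. -/

import Mathlib

open scoped TensorProduct ContDiff

noncomputable section

namespace NPOperad

/-! ## Operads in graded vector spaces (partial compositions)

All vector spaces are over `ℝ`.  A graded vector space is a family indexed by `ℤ`.
Operads have arities `N ≥ 1`; the index `r : ℕ` stands for arity `N = r + 1`, so that the arity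
`M + N - 1` of a partial composition becomes `p + q`.  Inputs are labelled by `Fin (r + 1)`,
i.e. from `0` to `r`. -/

/-- The sign `(-1)^k`. -/
def sg (k : ℤ) : ℝ := if Even k then 1 else -1

/-- Position, after insertion of an operation of arity `q + 1` at input `i`, of the old input
`a ≠ i`: unchanged before `i`, shifted up by `q` after `i`. -/
def outer {p q l : ℕ} (hl : p + q = l) (i a : Fin (p + 1)) : Fin (l + 1) :=
  if a < i then ⟨a, by omega⟩ else ⟨a + q, by omega⟩

/-- Position, after insertion at input `i`, of the input `b` of the inserted operation. -/
def inner {p q l : ℕ} (hl : p + q = l) (i : Fin (p + 1)) (b : Fin (q + 1)) : Fin (l + 1) :=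
  ⟨i + b, by omega⟩

/-- Underlying data of an operad in graded vector spaces: `sp r k` is the space of operations of
arity `r + 1` and degree `k`, `act` the right action of the symmetric group, `comp hl hk i` the
partial composition `∘ᵢ` (of degree zero), `one` the identity operation. The laws are `IsOperad`. -/
structure OperadData where
  sp : ℕ → ℤ → Type
  [grp : ∀ r k, AddCommGroup (sp r k)]
  [mod : ∀ r k, Module ℝ (sp r k)]
  one : sp 0 0
  act : ∀ {r : ℕ} {k : ℤ}, Equiv.Perm (Fin (r + 1)) → sp r k →ₗ[ℝ] sp r k
  comp : ∀ {p q l : ℕ} {j k e : ℤ}, p + q = l → j + k = e → Fin (p + 1) →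
    (sp p j →ₗ[ℝ] sp q k →ₗ[ℝ] sp l e)

attribute [instance] OperadData.grp OperadData.mod

/-- `υ` is the permutation of the inputs of a composite induced by a permutation `σ` of the inputs
of the outer operation and a permutation `τ` of those of the inner one. -/
def IsBlockPerm {p q l : ℕ} (hl : p + q = l) (i : Fin (p + 1)) (σ : Equiv.Perm (Fin (p + 1)))
    (τ : Equiv.Perm (Fin (q + 1))) (υ : Equiv.Perm (Fin (l + 1))) : Prop :=
  (∀ a, a ≠ i → υ (outer hl i a) = outer hl (σ i) (σ a)) ∧
    ∀ b, υ (inner hl i b) = inner hl (σ i) (τ b)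

/-- The operad laws: right action, unit, sequential and parallel composition (the latter with its
Koszul sign), equivariance. -/
structure IsOperad (O : OperadData) : Prop where
  act_one : ∀ {r k} (x : O.sp r k), O.act 1 x = x
  act_mul : ∀ {r k} (σ τ : Equiv.Perm (Fin (r + 1))) (x : O.sp r k),
    O.act (σ * τ) x = O.act τ (O.act σ x)
  one_comp : ∀ {q k} (x : O.sp q k), O.comp (zero_add q) (zero_add k) 0 O.one x = x
  comp_one : ∀ {p k} (i : Fin (p + 1)) (x : O.sp p k),
    O.comp (add_zero p) (add_zero k) i x O.one = x
  seq : ∀ {p q r pq qr pqr : ℕ} {j k m jk km jkm : ℤ}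
    (h₁ : p + q = pq) (h₂ : pq + r = pqr) (h₃ : q + r = qr) (h₄ : p + qr = pqr)
    (g₁ : j + k = jk) (g₂ : jk + m = jkm) (g₃ : k + m = km) (g₄ : j + km = jkm)
    (i : Fin (p + 1)) (b : Fin (q + 1)) (x : O.sp p j) (y : O.sp q k) (z : O.sp r m),
    O.comp h₂ g₂ (inner h₁ i b) (O.comp h₁ g₁ i x y) z
      = O.comp h₄ g₄ i x (O.comp h₃ g₃ b y z)
  par : ∀ {p q r pq pr pqr : ℕ} {j k m jk jm jkm : ℤ}
    (h₁ : p + q = pq) (h₂ : pq + r = pqr) (h₃ : p + r = pr) (h₄ : pr + q = pqr)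
    (g₁ : j + k = jk) (g₂ : jk + m = jkm) (g₃ : j + m = jm) (g₄ : jm + k = jkm)
    (i a : Fin (p + 1)) (_ : i < a) (x : O.sp p j) (y : O.sp q k) (z : O.sp r m),
    O.comp h₂ g₂ (outer h₁ i a) (O.comp h₁ g₁ i x y) z
      = sg (k * m) • O.comp h₄ g₄ (outer h₃ a i) (O.comp h₃ g₃ a x z) y
  equivariant : ∀ {p q l : ℕ} {j k e : ℤ} (hl : p + q = l) (hk : j + k = e) (i : Fin (p + 1))
    (σ : Equiv.Perm (Fin (p + 1))) (τ : Equiv.Perm (Fin (q + 1))) (υ : Equiv.Perm (Fin (l + 1))),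
    IsBlockPerm hl i σ τ υ → ∀ (x : O.sp p j) (y : O.sp q k),
      O.comp hl hk i (O.act σ x) (O.act τ y) = O.act υ (O.comp hl hk (σ i) x y)

/-- Morphisms of operads (of degree zero). -/
@[ext]
structure OperadHom (P Q : OperadData) where
  map : ∀ {r : ℕ} {k : ℤ}, P.sp r k →ₗ[ℝ] Q.sp r k
  map_one : map P.one = Q.one
  map_act : ∀ {r k} (σ : Equiv.Perm (Fin (r + 1))) (x : P.sp r k),
    map (P.act σ x) = Q.act σ (map x)
  map_comp : ∀ {p q l : ℕ} {j k e : ℤ} (hl : p + q = l) (hk : j + k = e) (i : Fin (p + 1))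
    (x : P.sp p j) (y : P.sp q k),
    map (P.comp hl hk i x y) = Q.comp hl hk i (map x) (map y)

/-! ## The graph operad `Gra_d`

A multidigraph with `N` vertices `Fin N` and `k` directed edges numbered `1, …, k` is a word of
length `k` in the letters `(source, target) : Fin N × Fin N`; these words are a basis of the free
algebra on the directed edges.  Dividing by the relations below identifies a graph with the graph
obtained by flipping the direction of one edge, up to the sign `(-1)^d`, and with the graph obtained
by exchanging the numbers of two consecutive edges, up to the sign `(-1)^(d+1)`. As transpositions
of consecutive edges generate the symmetric group, this is the space of coinvariants of
`S_k ⋉ S_2^k` acting on graphs with `k` edges, twisted by `sgn_k` (`d` even) or by `sgn_2^{⊗k}`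
(`d` odd). -/

/-- Flip of one edge, and exchange of two consecutive edges. -/
inductive GraRel (d : ℤ) (N : ℕ) :
    FreeAlgebra ℝ (Fin N × Fin N) → FreeAlgebra ℝ (Fin N × Fin N) → Prop
  | flip (a b : Fin N) :
      GraRel d N (FreeAlgebra.ι ℝ (b, a)) (sg d • FreeAlgebra.ι ℝ (a, b))
  | swap (e e' : Fin N × Fin N) :
      GraRel d N (FreeAlgebra.ι ℝ e' * FreeAlgebra.ι ℝ e)
        (sg (d + 1) • (FreeAlgebra.ι ℝ e * FreeAlgebra.ι ℝ e'))

/-- Linear combinations of classes of graphs with `N` vertices; the product is the union of the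
edge sets, the edges of the first factor coming first. -/
abbrev GraAlg (d : ℤ) (N : ℕ) : Type := RingQuot (GraRel d N)

/-- The class of the graph with one directed edge. -/
def GraAlg.edge (d : ℤ) {N : ℕ} (e : Fin N × Fin N) : GraAlg d N :=
  RingQuot.mkAlgHom ℝ (GraRel d N) (FreeAlgebra.ι ℝ e)

/-- The class of the graph with the given ordered list of directed edges. -/
def GraAlg.graph (d : ℤ) {N : ℕ} (E : List (Fin N × Fin N)) : GraAlg d N :=
  (E.map (GraAlg.edge d)).prod

theorem GraAlg.edge_flip (d : ℤ) {N : ℕ} (a b : Fin N) :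
    GraAlg.edge d (b, a) = sg d • GraAlg.edge d (a, b) := by
  have h := RingQuot.mkAlgHom_rel ℝ (GraRel.flip (d := d) a b)
  rwa [map_smul] at h

theorem GraAlg.edge_swap (d : ℤ) {N : ℕ} (e e' : Fin N × Fin N) :
    GraAlg.edge d e' * GraAlg.edge d e = sg (d + 1) • (GraAlg.edge d e * GraAlg.edge d e') := by
  have h := RingQuot.mkAlgHom_rel ℝ (GraRel.swap (d := d) e e')
  rwa [map_smul, map_mul, map_mul] at h

/-- Algebra maps out of `GraAlg` from images of the edges. -/
def GraAlg.lift (d : ℤ) {N : ℕ} {B : Type} [Ring B] [Algebra ℝ B] (f : Fin N × Fin N → B)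
    (hflip : ∀ a b, f (b, a) = sg d • f (a, b))
    (hswap : ∀ e e', f e' * f e = sg (d + 1) • (f e * f e')) : GraAlg d N →ₐ[ℝ] B :=
  RingQuot.liftAlgHom ℝ ⟨FreeAlgebra.lift ℝ f, by
    rintro _ _ (⟨a, b⟩ | ⟨e, e'⟩)
    · simp only [map_smul, FreeAlgebra.lift_ι_apply, hflip a b]
    · simp only [map_smul, map_mul, FreeAlgebra.lift_ι_apply, hswap e e']⟩

@[simp]
theorem GraAlg.lift_edge (d : ℤ) {N : ℕ} {B : Type} [Ring B] [Algebra ℝ B]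
    (f : Fin N × Fin N → B) (hflip hswap) (e : Fin N × Fin N) :
    GraAlg.lift d f hflip hswap (GraAlg.edge d e) = f e := by
  simp [GraAlg.lift, GraAlg.edge]

/-- Replacing each vertex `v` by the sum over the vertices in `F v`: every end of every edge at
`v` is reconnected, independently, in all possible ways to the elements of `F v`. -/
def GraAlg.reconnect (d : ℤ) {N N' : ℕ} (F : Fin N → Finset (Fin N')) :
    GraAlg d N →ₐ[ℝ] GraAlg d N' :=
  GraAlg.lift d (fun e => ∑ x ∈ F e.1 ×ˢ F e.2, GraAlg.edge d x)
    (fun a b => by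
      rw [Finset.smul_sum, Finset.sum_product, Finset.sum_product_right]
      exact Finset.sum_congr rfl fun x _ => Finset.sum_congr rfl fun y _ => GraAlg.edge_flip d _ _)
    (fun e e' => by
      rw [Finset.sum_mul_sum, Finset.sum_mul_sum, Finset.sum_comm, Finset.smul_sum]
      refine Finset.sum_congr rfl fun x _ => ?_
      rw [Finset.smul_sum]
      exact Finset.sum_congr rfl fun y _ => GraAlg.edge_swap d _ _)

/-- The degree `k` component of `Gra_d(N)`: spanned by the graphs with `m` edges, where
`m (1 - d) = k`. -/
def graDeg (d : ℤ) (N : ℕ) (k : ℤ) : Submodule ℝ (GraAlg d N) :=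
  Submodule.span ℝ {x | ∃ E : List (Fin N × Fin N), (E.length : ℤ) * (1 - d) = k ∧
    GraAlg.graph d E = x}

theorem GraAlg.graph_mem (d : ℤ) {N : ℕ} (E : List (Fin N × Fin N)) :
    GraAlg.graph d E ∈ graDeg d N ((E.length : ℤ) * (1 - d)) :=
  Submodule.subset_span ⟨E, rfl, rfl⟩

theorem graDeg_mul (d : ℤ) {N : ℕ} {j k e : ℤ} (hk : j + k = e) {x y : GraAlg d N}
    (hx : x ∈ graDeg d N j) (hy : y ∈ graDeg d N k) : x * y ∈ graDeg d N e := by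
  have h := Submodule.mul_mem_mul hx hy
  rw [graDeg, graDeg, Submodule.span_mul_span] at h
  refine Submodule.span_mono ?_ h
  rintro _ ⟨_, ⟨E, rfl, rfl⟩, _, ⟨E', rfl, rfl⟩, rfl⟩
  exact ⟨E ++ E', by rw [← hk, List.length_append]; push_cast; ring, by simp [GraAlg.graph]⟩

theorem GraAlg.reconnect_graph_mem (d : ℤ) {N N' : ℕ} (F : Fin N → Finset (Fin N'))
    (E : List (Fin N × Fin N)) :
    GraAlg.reconnect d F (GraAlg.graph d E) ∈ graDeg d N' ((E.length : ℤ) * (1 - d)) := by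
  induction E with
  | nil =>
    have h := GraAlg.graph_mem d ([] : List (Fin N' × Fin N'))
    simpa [GraAlg.graph] using h
  | cons e E ih =>
    have h1 : GraAlg.reconnect d F (GraAlg.edge d e) ∈ graDeg d N' (1 - d) := by
      rw [GraAlg.reconnect, GraAlg.lift_edge]
      refine Submodule.sum_mem _ fun x _ => ?_
      have h := GraAlg.graph_mem d [x]
      simpa [GraAlg.graph] using h
    have h2 := graDeg_mul d (e := ((e :: E).length : ℤ) * (1 - d))
      (by rw [List.length_cons]; push_cast; ring) h1 ih
    rw [← map_mul] at h2
    simpa only [GraAlg.graph, List.map_cons, List.prod_cons] using h2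

theorem GraAlg.reconnect_mem (d : ℤ) {N N' : ℕ} (F : Fin N → Finset (Fin N')) {k : ℤ}
    {x : GraAlg d N} (hx : x ∈ graDeg d N k) : GraAlg.reconnect d F x ∈ graDeg d N' k := by
  have h : graDeg d N k ≤ (graDeg d N' k).comap (GraAlg.reconnect d F).toLinearMap := by
    refine Submodule.span_le.2 ?_
    rintro _ ⟨E, rfl, rfl⟩
    exact GraAlg.reconnect_graph_mem d F E
  exact h hx

/-- Relabelling of the vertices. -/
def GraAlg.relabel (d : ℤ) {N N' : ℕ} (g : Fin N → Fin N') : GraAlg d N →ₐ[ℝ] GraAlg d N' :=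
  GraAlg.reconnect d fun v => {g v}

/-- The vertices that can take the place of `a` when a graph is inserted at the vertex `i`. -/
def spread {p q l : ℕ} (hl : p + q = l) (i a : Fin (p + 1)) : Finset (Fin (l + 1)) :=
  if a = i then Finset.univ.image (inner hl i) else {outer hl i a}

/-- The graph operad. A permutation `σ` relabels the vertex `v` as `σ⁻¹ v`; `γ ∘ᵢ γ'` inserts `γ'`
in place of the vertex `i` of `γ` and sums over all ways of reconnecting the ends of edges of `γ` at
`i` to vertices of `γ'`, the edges of `γ` coming before those of `γ'`. -/
def Gra (d : ℤ) : OperadData where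
  sp r k := graDeg d (r + 1) k
  one := ⟨GraAlg.graph d [], by simpa using GraAlg.graph_mem d ([] : List (Fin 1 × Fin 1))⟩
  act σ := (GraAlg.relabel d ⇑σ⁻¹).toLinearMap.restrict fun _ hx => GraAlg.reconnect_mem d _ hx
  comp hl hk i := LinearMap.mk₂ ℝ
    (fun x y => ⟨GraAlg.reconnect d (spread hl i) x.1 * GraAlg.relabel d (inner hl i) y.1,
      graDeg_mul d hk (GraAlg.reconnect_mem d _ x.2) (GraAlg.reconnect_mem d _ y.2)⟩)
    (fun _ _ _ => Subtype.ext (by simp [add_mul]))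
    (fun _ _ _ => Subtype.ext (by simp))
    (fun _ _ _ => Subtype.ext (by simp [mul_add]))
    (fun _ _ _ => Subtype.ext (by simp))

/-- The element of `Gra_d` given by the graph with `r + 1` vertices and the ordered list `E` of
directed edges. -/
def Gra.graph (d : ℤ) (r : ℕ) (E : List (Fin (r + 1) × Fin (r + 1))) :
    (Gra d).sp r ((E.length : ℤ) * (1 - d)) :=
  ⟨GraAlg.graph d E, GraAlg.graph_mem d E⟩

/-- The graph with two vertices and no edge. -/
def Gra.gammaMult (d : ℤ) : (Gra d).sp 1 0 :=
  ⟨GraAlg.graph d [], by simpa using GraAlg.graph_mem d ([] : List (Fin 2 × Fin 2))⟩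

/-- The graph with two vertices and one edge, from the first vertex to the second. -/
def Gra.gammaBr (d : ℤ) : (Gra d).sp 1 (1 - d) :=
  ⟨GraAlg.graph d [(0, 1)], by simpa using GraAlg.graph_mem d [((0 : Fin 2), (1 : Fin 2))]⟩

/-! ## The operad `Ger_d`, by generators and relations -/

/-- Formal operadic composites of a product of degree `0` and a bracket of degree `1 - d`. -/
inductive GerTree (d : ℤ) : ℕ → ℤ → Type
  | one : GerTree d 0 0
  | mul : GerTree d 1 0
  | br : GerTree d 1 (1 - d)
  | act {r : ℕ} {k : ℤ} (σ : Equiv.Perm (Fin (r + 1))) (t : GerTree d r k) : GerTree d r k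
  | comp {p q l : ℕ} {j k e : ℤ} (hl : p + q = l) (hk : j + k = e) (i : Fin (p + 1))
      (s : GerTree d p j) (t : GerTree d q k) : GerTree d l e

/-- Linear combinations of formal composites. -/
abbrev GerFree (d : ℤ) (r : ℕ) (k : ℤ) : Type := GerTree d r k →₀ ℝ

namespace GerFree

/-- A formal composite as a linear combination. -/
def of {d : ℤ} {r : ℕ} {k : ℤ} (t : GerTree d r k) : GerFree d r k := Finsupp.single t 1

/-- Linear extension of the formal action. -/
def act {d : ℤ} {r : ℕ} {k : ℤ} (σ : Equiv.Perm (Fin (r + 1))) :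
    GerFree d r k →ₗ[ℝ] GerFree d r k :=
  Finsupp.linearCombination ℝ fun t => of (GerTree.act σ t)

/-- Bilinear extension of the formal composition. -/
def comp {d : ℤ} {p q l : ℕ} {j k e : ℤ} (hl : p + q = l) (hk : j + k = e) (i : Fin (p + 1)) :
    GerFree d p j →ₗ[ℝ] GerFree d q k →ₗ[ℝ] GerFree d l e :=
  Finsupp.linearCombination ℝ fun s =>
    Finsupp.linearCombination ℝ fun t => of (GerTree.comp hl hk i s t)

end GerFree

open GerFree in
/-- The linear combinations of formal composites which vanish in `Ger_d`: the smallest family of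
subspaces, stable under the action and under composition with anything, containing the operad laws
and the relations of a commutative associative product, of a bracket of degree `1 - d` which is
symmetric up to `(-1)^d` and satisfies the Jacobi identity, and of the Poisson identity. -/
inductive GerNull (d : ℤ) : ∀ {r : ℕ} {k : ℤ}, GerFree d r k → Prop
  | zero {r k} : GerNull d (0 : GerFree d r k)
  | add {r k} {x y : GerFree d r k} : GerNull d x → GerNull d y → GerNull d (x + y)
  | smul {r k} (c : ℝ) {x : GerFree d r k} : GerNull d x → GerNull d (c • x)
  | act {r k} (σ : Equiv.Perm (Fin (r + 1))) {x : GerFree d r k} :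
      GerNull d x → GerNull d (act σ x)
  | comp_left {p q l : ℕ} {j k e : ℤ} (hl : p + q = l) (hk : j + k = e) (i : Fin (p + 1))
      {x : GerFree d p j} (y : GerFree d q k) : GerNull d x → GerNull d (comp hl hk i x y)
  | comp_right {p q l : ℕ} {j k e : ℤ} (hl : p + q = l) (hk : j + k = e) (i : Fin (p + 1))
      (x : GerFree d p j) {y : GerFree d q k} : GerNull d y → GerNull d (comp hl hk i x y)
  -- operad laws
  | act_one {r k} (x : GerFree d r k) : GerNull d (act 1 x - x)
  | act_mul {r k} (σ τ : Equiv.Perm (Fin (r + 1))) (x : GerFree d r k) :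
      GerNull d (act (σ * τ) x - act τ (act σ x))
  | one_comp {q k} (x : GerFree d q k) :
      GerNull d (comp (zero_add q) (zero_add k) 0 (of GerTree.one) x - x)
  | comp_one {p k} (i : Fin (p + 1)) (x : GerFree d p k) :
      GerNull d (comp (add_zero p) (add_zero k) i x (of GerTree.one) - x)
  | seq {p q r pq qr pqr : ℕ} {j k m jk km jkm : ℤ}
      (h₁ : p + q = pq) (h₂ : pq + r = pqr) (h₃ : q + r = qr) (h₄ : p + qr = pqr)
      (g₁ : j + k = jk) (g₂ : jk + m = jkm) (g₃ : k + m = km) (g₄ : j + km = jkm)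
      (i : Fin (p + 1)) (b : Fin (q + 1))
      (x : GerFree d p j) (y : GerFree d q k) (z : GerFree d r m) :
      GerNull d (comp h₂ g₂ (inner h₁ i b) (comp h₁ g₁ i x y) z
        - comp h₄ g₄ i x (comp h₃ g₃ b y z))
  | par {p q r pq pr pqr : ℕ} {j k m jk jm jkm : ℤ}
      (h₁ : p + q = pq) (h₂ : pq + r = pqr) (h₃ : p + r = pr) (h₄ : pr + q = pqr)
      (g₁ : j + k = jk) (g₂ : jk + m = jkm) (g₃ : j + m = jm) (g₄ : jm + k = jkm)
      (i a : Fin (p + 1)) (h : i < a)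
      (x : GerFree d p j) (y : GerFree d q k) (z : GerFree d r m) :
      GerNull d (comp h₂ g₂ (outer h₁ i a) (comp h₁ g₁ i x y) z
        - sg (k * m) • comp h₄ g₄ (outer h₃ a i) (comp h₃ g₃ a x z) y)
  | equivariant {p q l : ℕ} {j k e : ℤ} (hl : p + q = l) (hk : j + k = e) (i : Fin (p + 1))
      (σ : Equiv.Perm (Fin (p + 1))) (τ : Equiv.Perm (Fin (q + 1)))
      (υ : Equiv.Perm (Fin (l + 1))) (h : IsBlockPerm hl i σ τ υ)
      (x : GerFree d p j) (y : GerFree d q k) :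
      GerNull d (comp hl hk i (act σ x) (act τ y) - act υ (comp hl hk (σ i) x y))
  -- `a ∧ b = b ∧ a` and `(a ∧ b) ∧ c = a ∧ (b ∧ c)`
  | mul_comm : GerNull d (act (Equiv.swap 0 1) (of GerTree.mul) - of GerTree.mul)
  | mul_assoc : GerNull d
      (comp (rfl : 1 + 1 = 2) (zero_add 0) 0 (of GerTree.mul) (of GerTree.mul)
        - comp (rfl : 1 + 1 = 2) (zero_add 0) 1 (of GerTree.mul) (of GerTree.mul))
  -- `{a, b} = (-1)^d {b, a}`
  | br_symm : GerNull d (act (Equiv.swap 0 1) (of GerTree.br) - sg d • of GerTree.br)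
  -- the sum of `{{a, b}, c}` over the cyclic permutations of `a, b, c` vanishes
  | jacobi : GerNull d
      (comp (rfl : 1 + 1 = 2) rfl 0 (of GerTree.br) (of GerTree.br)
        + act (finRotate 3) (comp (rfl : 1 + 1 = 2) rfl 0 (of GerTree.br) (of GerTree.br))
        + act (finRotate 3 * finRotate 3)
            (comp (rfl : 1 + 1 = 2) rfl 0 (of GerTree.br) (of GerTree.br)))
  -- `{a, b ∧ c} = {a, b} ∧ c + b ∧ {a, c}`
  | poisson : GerNull d
      (comp (rfl : 1 + 1 = 2) (add_zero (1 - d)) 1 (of GerTree.br) (of GerTree.mul)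
        - comp (rfl : 1 + 1 = 2) (zero_add (1 - d)) 0 (of GerTree.mul) (of GerTree.br)
        - act (Equiv.swap 0 1)
            (comp (rfl : 1 + 1 = 2) (zero_add (1 - d)) 1 (of GerTree.mul) (of GerTree.br)))

/-- The vanishing linear combinations as a subspace. -/
def gerIdeal (d : ℤ) (r : ℕ) (k : ℤ) : Submodule ℝ (GerFree d r k) where
  carrier := {x | GerNull d x}
  zero_mem' := GerNull.zero
  add_mem' := GerNull.add
  smul_mem' c _ h := GerNull.smul c h

/-- The operad `Ger_d` whose algebras are a graded commutative algebra with a Lie bracket of degree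
`1 - d` which is a derivation in each argument. -/
def Ger (d : ℤ) : OperadData where
  sp r k := GerFree d r k ⧸ gerIdeal d r k
  one := Submodule.Quotient.mk (GerFree.of GerTree.one)
  act {r k} σ := Submodule.mapQ (gerIdeal d r k) (gerIdeal d r k) (GerFree.act σ)
    fun _ h => GerNull.act σ h
  comp {p q l j k e} hl hk i := Submodule.liftQ (gerIdeal d p j)
    { toFun := fun x => Submodule.mapQ (gerIdeal d q k) (gerIdeal d l e) (GerFree.comp hl hk i x)
        fun _ h => GerNull.comp_right hl hk i x h
      map_add' := fun _ _ => Submodule.linearMap_qext _ (LinearMap.ext fun _ => by simp; rfl)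
      map_smul' := fun _ _ => Submodule.linearMap_qext _ (LinearMap.ext fun _ => by simp; rfl) }
    fun _ h => Submodule.linearMap_qext _ (LinearMap.ext fun y =>
      (Submodule.Quotient.mk_eq_zero _).2 (GerNull.comp_left hl hk i y h))

/-- The generator `a₁ ∧ a₂`. -/
def Ger.mul (d : ℤ) : (Ger d).sp 1 0 := Submodule.Quotient.mk (GerFree.of GerTree.mul)

/-- The generator `{a₁, a₂}`. -/
def Ger.br (d : ℤ) : (Ger d).sp 1 (1 - d) := Submodule.Quotient.mk (GerFree.of GerTree.br)

/-! ## The endomorphism operad of a graded vector space -/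

section Endomorphisms

variable {A : Type} [AddCommGroup A] [Module ℝ A] {𝒜 : ℤ → Submodule ℝ A}

/-- The identification of the direct sum of the homogeneous components with the whole space. -/
def gradedEquiv (h : DirectSum.IsInternal 𝒜) : (DirectSum ℤ fun k => 𝒜 k) ≃ₗ[ℝ] A :=
  LinearEquiv.ofBijective (DirectSum.coeLinearMap 𝒜)
    (show Function.Bijective (DirectSum.coeLinearMap 𝒜) from h)

/-- The degree involution of a graded vector space, `f ↦ (-1)^k f` on the degree `k` part. -/
def parity (h : DirectSum.IsInternal 𝒜) : A →ₗ[ℝ] A :=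
  (DirectSum.toModule ℝ ℤ A fun k => sg k • (𝒜 k).subtype) ∘ₗ
    (gradedEquiv h).symm.toLinearMap

theorem parity_apply (h : DirectSum.IsInternal 𝒜) {k : ℤ} {f : A} (hf : f ∈ 𝒜 k) :
    parity h f = sg k • f := by
  have h1 : (gradedEquiv h).symm f
      = DirectSum.lof ℝ ℤ (fun k => 𝒜 k) k ⟨f, hf⟩ := by
    rw [LinearEquiv.symm_apply_eq]
    exact (DirectSum.coeLinearMap_lof 𝒜 k ⟨f, hf⟩).symm
  simp [parity, h1]

theorem parity_pow_mem (h : DirectSum.IsInternal 𝒜) (m : ℕ) {k : ℤ} {f : A} (hf : f ∈ 𝒜 k) :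
    (parity h ^ m) f ∈ 𝒜 k := by
  induction m with
  | zero => simpa using hf
  | succ m ih =>
    rw [pow_succ', Module.End.mul_apply, parity_apply h ih]
    exact Submodule.smul_mem _ _ ih

/-- The projection onto the even part (`false`) or onto the odd part (`true`). -/
def parityProj (h : DirectSum.IsInternal 𝒜) (b : Bool) : A →ₗ[ℝ] A :=
  (1 / 2 : ℝ) • (LinearMap.id + (if b then (-1 : ℝ) else 1) • parity h)

theorem parityProj_mem (h : DirectSum.IsInternal 𝒜) (b : Bool) {k : ℤ} {f : A} (hf : f ∈ 𝒜 k) :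
    parityProj h b f ∈ 𝒜 k := by
  refine Submodule.smul_mem _ _ (Submodule.add_mem _ hf (Submodule.smul_mem _ _ ?_))
  simpa using parity_pow_mem h 1 hf

/-- The Koszul sign of the rearrangement of `f₁, …, f_N` into `f_{σ⁻¹ 1}, …, f_{σ⁻¹ N}`, where
`b a` tells whether `f_a` is odd. -/
def koszul {N : ℕ} (σ : Equiv.Perm (Fin N)) (b : Fin N → Bool) : ℝ :=
  ∏ x : Fin N × Fin N,
    if x.1 < x.2 ∧ σ⁻¹ x.2 < σ⁻¹ x.1 ∧ b (σ⁻¹ x.1) ∧ b (σ⁻¹ x.2) then -1 else 1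

variable (𝒜) in
/-- Multilinear maps of degree `e` in `r + 1` arguments. -/
def homDeg (r : ℕ) (e : ℤ) : Submodule ℝ (MultilinearMap ℝ (fun _ : Fin (r + 1) => A) A) where
  carrier := {θ | ∀ (k : Fin (r + 1) → ℤ) (f : Fin (r + 1) → A),
    (∀ a, f a ∈ 𝒜 (k a)) → θ f ∈ 𝒜 (∑ a, k a + e)}
  zero_mem' _ _ _ := Submodule.zero_mem _
  add_mem' h h' k f hf := Submodule.add_mem _ (h k f hf) (h' k f hf)
  smul_mem' c _ h k f hf := Submodule.smul_mem _ c (h k f hf)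

/-- Right action of a permutation, with Koszul signs: on homogeneous elements,
`(θ · σ)(f₁, …, f_N) = ± θ(f_{σ⁻¹ 1}, …, f_{σ⁻¹ N})`. -/
def multAct (h : DirectSum.IsInternal 𝒜) {r : ℕ} (σ : Equiv.Perm (Fin (r + 1)))
    (θ : MultilinearMap ℝ (fun _ : Fin (r + 1) => A) A) :
    MultilinearMap ℝ (fun _ : Fin (r + 1) => A) A :=
  ∑ b : Fin (r + 1) → Bool, koszul σ b •
    (θ.compLinearMap fun a => parityProj h (b (σ⁻¹ a))).domDomCongr σ⁻¹

theorem multAct_apply (h : DirectSum.IsInternal 𝒜) {r : ℕ} (σ : Equiv.Perm (Fin (r + 1)))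
    (θ : MultilinearMap ℝ (fun _ : Fin (r + 1) => A) A) (f : Fin (r + 1) → A) :
    multAct h σ θ f = ∑ b : Fin (r + 1) → Bool,
      koszul σ b • θ fun a => parityProj h (b (σ⁻¹ a)) (f (σ⁻¹ a)) := by
  simp [multAct]

theorem multAct_mem (h : DirectSum.IsInternal 𝒜) {r : ℕ} (σ : Equiv.Perm (Fin (r + 1))) {e : ℤ}
    {θ : MultilinearMap ℝ (fun _ : Fin (r + 1) => A) A} (hθ : θ ∈ homDeg 𝒜 r e) :
    multAct h σ θ ∈ homDeg 𝒜 r e := by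
  intro k f hf
  rw [multAct_apply]
  refine Submodule.sum_mem _ fun b _ => Submodule.smul_mem _ _ ?_
  have h1 := hθ (fun a => k (σ⁻¹ a)) (fun a => parityProj h (b (σ⁻¹ a)) (f (σ⁻¹ a)))
    fun a => parityProj_mem h _ (hf _)
  rwa [Equiv.sum_comp σ⁻¹ k] at h1

/-- The arguments given to the outer map in a partial composition at `i`. -/
def compArgs {p q l : ℕ} (hl : p + q = l) (i : Fin (p + 1)) (s : A →ₗ[ℝ] A)
    (θ' : MultilinearMap ℝ (fun _ : Fin (q + 1) => A) A) (f : Fin (l + 1) → A) :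
    Fin (p + 1) → A := fun a =>
  if a = i then θ' fun b => f (inner hl i b)
  else if a < i then s (f (outer hl i a)) else f (outer hl i a)

theorem compArgs_eq {p q l : ℕ} (hl : p + q = l) (i : Fin (p + 1)) (s : A →ₗ[ℝ] A)
    (θ' : MultilinearMap ℝ (fun _ : Fin (q + 1) => A) A) (f : Fin (l + 1) → A) :
    compArgs hl i s θ' f = Function.update
      (fun a => if a < i then s (f (outer hl i a)) else f (outer hl i a)) i
      (θ' fun b => f (inner hl i b)) := by
  funext a
  by_cases ha : a = i
  · subst ha; simp [compArgs]
  · simp [compArgs, ha]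

theorem inner_injective {p q l : ℕ} (hl : p + q = l) (i : Fin (p + 1)) :
    Function.Injective (inner hl i) := by
  intro b b' h
  simp only [inner, Fin.mk.injEq] at h
  ext; omega

theorem outer_ne_inner {p q l : ℕ} (hl : p + q = l) (i a : Fin (p + 1)) (ha : a ≠ i)
    (b : Fin (q + 1)) : outer hl i a ≠ inner hl i b := by
  intro h
  have ha' : (a : ℕ) ≠ i := fun h' => ha (Fin.ext h')
  unfold outer inner at h
  split_ifs at h with h1
  · simp only [Fin.mk.injEq] at h; rw [Fin.lt_def] at h1; omega
  · simp only [Fin.mk.injEq] at h; rw [Fin.lt_def] at h1; omega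

theorem outer_inj {p q l : ℕ} (hl : p + q = l) (i a a' : Fin (p + 1)) (ha : a ≠ i) (ha' : a' ≠ i)
    (h : outer hl i a = outer hl i a') : a = a' := by
  have h1 : (a : ℕ) ≠ i := fun h' => ha (Fin.ext h')
  have h2 : (a' : ℕ) ≠ i := fun h' => ha' (Fin.ext h')
  unfold outer at h
  ext
  split_ifs at h with h3 h4 h4 <;> simp only [Fin.mk.injEq] at h <;>
    simp only [Fin.lt_def] at h3 h4 <;> omega

theorem inner_or_outer {p q l : ℕ} (hl : p + q = l) (i : Fin (p + 1)) (c : Fin (l + 1)) :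
    (∃ b, inner hl i b = c) ∨ ∃ a, a ≠ i ∧ outer hl i a = c := by
  have hc := c.2
  have hi := i.2
  by_cases h1 : (c : ℕ) < i
  · refine .inr ⟨⟨c, by omega⟩, fun h => ?_, ?_⟩
    · rw [← h] at h1; simp at h1
    · simp [outer, Fin.lt_def, h1]
  · by_cases h2 : (c : ℕ) ≤ i + q
    · exact .inl ⟨⟨c - i, by omega⟩, by ext; simp [inner]; omega⟩
    · refine .inr ⟨⟨c - q, by omega⟩, fun h => ?_, ?_⟩
      · rw [← h] at h2; simp at h2; omega
      · have : ¬ ((c : ℕ) - q < i) := by omega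
        ext; simp [outer, Fin.lt_def, this]; omega

theorem compArgs_inner {p q l : ℕ} (hl : p + q = l) (i : Fin (p + 1)) (s : A →ₗ[ℝ] A)
    (θ' : MultilinearMap ℝ (fun _ : Fin (q + 1) => A) A) (f : Fin (l + 1) → A) (b : Fin (q + 1))
    (v : A) : compArgs hl i s θ' (Function.update f (inner hl i b) v)
      = Function.update (compArgs hl i s θ' f) i
        (θ' (Function.update (fun b => f (inner hl i b)) b v)) := by
  funext a
  by_cases ha : a = i
  · subst ha
    simp only [compArgs, if_pos, Function.update_self]
    congr 1
    exact Function.update_comp_eq_of_injective f (inner_injective hl a) b v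
  · have h := outer_ne_inner hl i a ha b
    simp [compArgs, ha, Function.update_of_ne h]

theorem compArgs_outer {p q l : ℕ} (hl : p + q = l) (i : Fin (p + 1)) (s : A →ₗ[ℝ] A)
    (θ' : MultilinearMap ℝ (fun _ : Fin (q + 1) => A) A) (f : Fin (l + 1) → A) (a : Fin (p + 1))
    (ha : a ≠ i) (v : A) : compArgs hl i s θ' (Function.update f (outer hl i a) v)
      = Function.update (compArgs hl i s θ' f) a (if a < i then s v else v) := by
  funext c
  by_cases hc : c = i
  · subst hc
    have h : ∀ b, inner hl c b ≠ outer hl c a := fun b => (outer_ne_inner hl c a ha b).symm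
    rw [Function.update_of_ne (Ne.symm ha)]
    simp only [compArgs, if_pos, Function.update_of_ne (h _)]
  · by_cases hca : c = a
    · subst hca
      simp [compArgs, ha]
    · have h : outer hl i c ≠ outer hl i a := fun h => hca (outer_inj hl i c a hc ha h)
      simp [compArgs, hc, Function.update_of_ne hca, Function.update_of_ne h]

/-- The multilinear map
`f ↦ θ(s f₁, …, s f_{i-1}, θ'(f_i, …, f_{i+q}), f_{i+q+1}, …)`. -/
def multComp {p q l : ℕ} (hl : p + q = l) (i : Fin (p + 1)) (s : A →ₗ[ℝ] A)
    (θ : MultilinearMap ℝ (fun _ : Fin (p + 1) => A) A)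
    (θ' : MultilinearMap ℝ (fun _ : Fin (q + 1) => A) A) :
    MultilinearMap ℝ (fun _ : Fin (l + 1) => A) A :=
  MultilinearMap.mk' (fun f => θ (compArgs hl i s θ' f))
    (fun f c x y => by
      rcases inner_or_outer hl i c with ⟨b, rfl⟩ | ⟨a, ha, rfl⟩
      · simp only [compArgs_inner, MultilinearMap.map_update_add]
      · simp only [compArgs_outer hl i s θ' f a ha]
        split_ifs <;> simp only [map_add, MultilinearMap.map_update_add])
    (fun f c t x => by
      rcases inner_or_outer hl i c with ⟨b, rfl⟩ | ⟨a, ha, rfl⟩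
      · simp only [compArgs_inner, MultilinearMap.map_update_smul]
      · simp only [compArgs_outer hl i s θ' f a ha]
        split_ifs <;> simp only [map_smul, MultilinearMap.map_update_smul])

theorem sum_inner_outer {p q l : ℕ} (hl : p + q = l) (i : Fin (p + 1)) (k : Fin (l + 1) → ℤ) :
    ∑ c, k c = ∑ b, k (inner hl i b) + ∑ a ∈ Finset.univ.erase i, k (outer hl i a) := by
  classical
  rw [← Finset.sum_image (s := Finset.univ) (f := k) (g := inner hl i)
      fun b _ b' _ h => inner_injective hl i h,
    ← Finset.sum_image (s := Finset.univ.erase i) (f := k) (g := outer hl i)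
      fun a ha a' ha' h => outer_inj hl i a a' (Finset.ne_of_mem_erase ha)
        (Finset.ne_of_mem_erase ha') h,
    ← Finset.sum_union]
  · refine Finset.sum_congr (Finset.ext fun c => ?_) fun _ _ => rfl
    simpa using inner_or_outer hl i c
  · rw [Finset.disjoint_left]
    intro c hc hc'
    simp only [Finset.mem_image, Finset.mem_univ, true_and, Finset.mem_erase, and_true] at hc hc'
    obtain ⟨b, rfl⟩ := hc
    obtain ⟨a, ha, h⟩ := hc'
    exact outer_ne_inner hl i a ha b h

theorem multComp_mem (h : DirectSum.IsInternal 𝒜) {p q l : ℕ} {j k e : ℤ} (hl : p + q = l)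
    (hk : j + k = e) (i : Fin (p + 1)) (m : ℕ)
    {θ : MultilinearMap ℝ (fun _ : Fin (p + 1) => A) A} (hθ : θ ∈ homDeg 𝒜 p j)
    {θ' : MultilinearMap ℝ (fun _ : Fin (q + 1) => A) A} (hθ' : θ' ∈ homDeg 𝒜 q k) :
    multComp hl i (parity h ^ m) θ θ' ∈ homDeg 𝒜 l e := by
  intro n f hf
  have h1 := hθ (fun a => if a = i then ∑ b, n (inner hl i b) + k else n (outer hl i a))
    (compArgs hl i (parity h ^ m) θ' f) (fun a => by
      by_cases ha : a = i
      · simpa only [compArgs, if_pos ha] using hθ' _ _ fun b => hf (inner hl i b)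
      · simp only [compArgs, if_neg ha]
        split_ifs
        · exact parity_pow_mem h m (hf _)
        · exact hf _)
  have h2 : ∑ a, (if a = i then ∑ b, n (inner hl i b) + k else n (outer hl i a)) + j
      = ∑ c, n c + e := by
    rw [sum_inner_outer hl i n, ← Finset.add_sum_erase _ _ (Finset.mem_univ i), if_pos rfl, ← hk,
      Finset.sum_congr rfl fun a ha => if_neg (Finset.ne_of_mem_erase ha)]
    ring
  rw [h2] at h1
  exact h1

/-- The identity as a multilinear map in one argument. -/
def idMap : MultilinearMap ℝ (fun _ : Fin (0 + 1) => A) A :=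
  MultilinearMap.ofSubsingleton ℝ A A (0 : Fin 1) LinearMap.id

/-- The endomorphism operad of a graded vector space. In
`θ ∘ᵢ θ' = θ ∘ (1 ⊗ ⋯ ⊗ θ' ⊗ ⋯ ⊗ 1)` the map `θ'` of degree `k` passes the arguments before it,
which gives the Koszul sign `(-1)^(k (f₁ + ⋯ + f_{i-1}))`. -/
def End (h : DirectSum.IsInternal 𝒜) : OperadData where
  sp r k := homDeg 𝒜 r k
  one := ⟨idMap, fun k f hf => by simpa [idMap] using hf 0⟩
  act σ :=
    { toFun := fun θ => ⟨multAct h σ θ.1, multAct_mem h σ θ.2⟩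
      map_add' := fun _ _ => Subtype.ext (MultilinearMap.ext fun _ => by
        simp [multAct_apply, Finset.sum_add_distrib])
      map_smul' := fun c _ => Subtype.ext (MultilinearMap.ext fun _ => by
        simp [multAct_apply, Finset.smul_sum, smul_comm c]) }
  comp {p q l j k e} hl hk i := LinearMap.mk₂ ℝ
    (fun θ θ' => ⟨multComp hl i (parity h ^ k.natAbs) θ.1 θ'.1,
      multComp_mem h hl hk i k.natAbs θ.2 θ'.2⟩)
    (fun _ _ _ => rfl)
    (fun _ _ _ => rfl)
    (fun θ x y => Subtype.ext (MultilinearMap.ext fun f => by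
      change θ.1 (compArgs hl i _ (x.1 + y.1) f) = θ.1 (compArgs hl i _ x.1 f)
        + θ.1 (compArgs hl i _ y.1 f)
      simp only [compArgs_eq hl i _ _ f, add_apply, MultilinearMap.map_update_add]))
    (fun c θ x => Subtype.ext (MultilinearMap.ext fun f => by
      change θ.1 (compArgs hl i _ (c • x.1) f) = c • θ.1 (compArgs hl i _ x.1 f)
      simp only [compArgs_eq hl i _ _ f, smul_apply,
        MultilinearMap.map_update_smul]))

end Endomorphisms

/-! ## Functions on an NP-manifold of degree `n` in Darboux coordinates -/

/-- Darboux coordinates of an NP-manifold of degree `n`: `m` pairs `(x^μ, p_μ)` of degrees `0` and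
`n`; for `1 ≤ i < n / 2`, `s (i - 1)` pairs `(ψ^α, χ_α)` of degrees `i` and `n - i` (the index
`i - 1` ranges over `Fin ((n - 1) / 2)`); and `c` coordinates `ξ^a` of degree `n / 2` (which are
only present if `n` is even). -/
inductive Coord (n m : ℕ) (s : Fin ((n - 1) / 2) → ℕ) (c : ℕ) : Type
  | x (μ : Fin m)
  | p (μ : Fin m)
  | psi (i : Fin ((n - 1) / 2)) (α : Fin (s i))
  | chi (i : Fin ((n - 1) / 2)) (α : Fin (s i))
  | xi (a : Fin c)
  deriving DecidableEq, Fintype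

/-- The degree of a coordinate. -/
def Coord.deg {n m : ℕ} {s : Fin ((n - 1) / 2) → ℕ} {c : ℕ} : Coord n m s c → ℕ
  | .x _ => 0
  | .p _ => n
  | .psi i _ => i + 1
  | .chi i _ => n - (i + 1)
  | .xi _ => n / 2

/-- An NP-manifold of degree `n` in Darboux coordinates. The symplectic form is
`dx^μ dp_μ + ∑ dψ^α dχ_α + ½ κ_ab dξ^a dξ^b`; the degree zero coordinates range over an open set. -/
structure NPChart (n : ℕ) where
  m : ℕ
  s : Fin ((n - 1) / 2) → ℕ
  c : ℕ
  c_eq_zero : Odd n → c = 0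
  κ : Matrix (Fin c) (Fin c) ℝ
  κ_symm : ∀ a b, κ a b = -sg ((n / 2 : ℕ) : ℤ) * κ b a
  κ_nondeg : IsUnit κ.det
  base : TopologicalSpace.Opens ({z : Coord n m s c // z.deg = 0} → ℝ)

/-- The smooth functions on an open set. -/
def SmoothFn {ι : Type} [Fintype ι] (U : TopologicalSpace.Opens (ι → ℝ)) :
    Subalgebra ℝ (U → ℝ) where
  carrier := {f | ∃ g : (ι → ℝ) → ℝ, ContDiffOn ℝ ∞ g U ∧ ∀ y : U, g y = f y}
  mul_mem' := by
    rintro f f' ⟨g, hg, h⟩ ⟨g', hg', h'⟩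
    exact ⟨g * g', hg.mul hg', fun y => by simp [h, h']⟩
  add_mem' := by
    rintro f f' ⟨g, hg, h⟩ ⟨g', hg', h'⟩
    exact ⟨g + g', hg.add hg', fun y => by simp [h, h']⟩
  algebraMap_mem' r := ⟨fun _ => r, contDiffOn_const, fun _ => rfl⟩

/-- Extension by zero of a function on an open set. -/
def extendZero {ι : Type} [Fintype ι] {U : TopologicalSpace.Opens (ι → ℝ)} (f : U → ℝ) :
    (ι → ℝ) → ℝ := Function.extend (Subtype.val : U → ι → ℝ) f 0

theorem extendZero_apply {ι : Type} [Fintype ι] {U : TopologicalSpace.Opens (ι → ℝ)} (f : U → ℝ)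
    (y : U) : extendZero f y = f y :=
  Subtype.val_injective.extend_apply f 0 y

theorem extendZero_contDiffOn {ι : Type} [Fintype ι] {U : TopologicalSpace.Opens (ι → ℝ)}
    (f : SmoothFn U) : ContDiffOn ℝ ∞ (extendZero f.1) U := by
  obtain ⟨g, hg, h⟩ := f.2
  exact hg.congr fun y hy => by rw [extendZero_apply f.1 ⟨y, hy⟩, h ⟨y, hy⟩]

theorem extendZero_differentiableAt {ι : Type} [Fintype ι] {U : TopologicalSpace.Opens (ι → ℝ)}
    (f : SmoothFn U) (y : U) : DifferentiableAt ℝ (extendZero f.1) y :=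
  ((extendZero_contDiffOn f).differentiableOn (by simp)).differentiableAt (U.2.mem_nhds y.2)

/-- The partial derivative of a smooth function with respect to a coordinate. -/
def smoothPartial {ι : Type} [Fintype ι] [DecidableEq ι] (U : TopologicalSpace.Opens (ι → ℝ))
    (i : ι) : SmoothFn U →ₗ[ℝ] SmoothFn U where
  toFun f := ⟨fun y => fderiv ℝ (extendZero f.1) y (Pi.single i 1),
    fun y => fderiv ℝ (extendZero f.1) y (Pi.single i 1),
    ((extendZero_contDiffOn f).fderiv_of_isOpen U.2 (by simp)).clm_apply contDiffOn_const,
    fun _ => rfl⟩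
  map_add' f g := Subtype.ext <| funext fun y => by
    have h : extendZero (f + g).1 =ᶠ[nhds (y : ι → ℝ)] extendZero f.1 + extendZero g.1 := by
      filter_upwards [U.2.mem_nhds y.2] with z hz
      have h1 := extendZero_apply f.1 ⟨z, hz⟩
      have h2 := extendZero_apply g.1 ⟨z, hz⟩
      have h3 := extendZero_apply (f + g).1 ⟨z, hz⟩
      simp only [Pi.add_apply, h1, h2, h3]
      rfl
    change fderiv ℝ (extendZero (f + g).1) y _ = fderiv ℝ (extendZero f.1) y _
      + fderiv ℝ (extendZero g.1) y _
    rw [h.fderiv_eq, fderiv_add (extendZero_differentiableAt f y)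
      (extendZero_differentiableAt g y), add_apply]
  map_smul' r f := Subtype.ext <| funext fun y => by
    have h : extendZero (r • f).1 =ᶠ[nhds (y : ι → ℝ)] r • extendZero f.1 := by
      filter_upwards [U.2.mem_nhds y.2] with z hz
      have h1 := extendZero_apply f.1 ⟨z, hz⟩
      have h3 := extendZero_apply (r • f).1 ⟨z, hz⟩
      simp only [Pi.smul_apply, h1, h3]
      rfl
    change fderiv ℝ (extendZero (r • f).1) y _ = r • fderiv ℝ (extendZero f.1) y _
    rw [h.fderiv_eq, fderiv_const_smul (extendZero_differentiableAt f y), smul_apply]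

namespace NPChart

variable {n : ℕ} (V : NPChart n)

/-- The coordinates. -/
abbrev Crd : Type := Coord n V.m V.s V.c

/-- The coordinates of degree zero. -/
abbrev Crd0 : Type := {z : V.Crd // z.deg = 0}

/-- The coordinates of positive even degree. -/
abbrev CrdEven : Type := {z : V.Crd // z.deg ≠ 0 ∧ Even z.deg}

/-- The coordinates of odd degree. -/
abbrev CrdOdd : Type := {z : V.Crd // Odd z.deg}

/-- The algebra `C^∞(V)`: smooth in the coordinates of degree zero, polynomial in the other
coordinates, of which those of odd degree anticommute. -/
def Fn : Type :=
  SmoothFn V.base ⊗[ℝ] (MvPolynomial V.CrdEven ℝ ⊗[ℝ] ExteriorAlgebra ℝ (V.CrdOdd → ℝ))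

instance : Ring V.Fn := inferInstanceAs (Ring
  (SmoothFn V.base ⊗[ℝ] (MvPolynomial V.CrdEven ℝ ⊗[ℝ] ExteriorAlgebra ℝ (V.CrdOdd → ℝ))))

instance : Algebra ℝ V.Fn := inferInstanceAs (Algebra ℝ
  (SmoothFn V.base ⊗[ℝ] (MvPolynomial V.CrdEven ℝ ⊗[ℝ] ExteriorAlgebra ℝ (V.CrdOdd → ℝ))))

/-- The function `g ⊗ P ⊗ w`: the product of a smooth function `g` of the coordinates of degree
zero, a polynomial `P` in the even ones and an element `w` of the exterior algebra on the odd
ones. -/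
def fnMk (g : SmoothFn V.base) (P : MvPolynomial V.CrdEven ℝ)
    (w : ExteriorAlgebra ℝ (V.CrdOdd → ℝ)) : V.Fn :=
  g ⊗ₜ[ℝ] (P ⊗ₜ[ℝ] w)

theorem fnMk_smul (g : SmoothFn V.base) (P : MvPolynomial V.CrdEven ℝ)
    (w : ExteriorAlgebra ℝ (V.CrdOdd → ℝ)) (r t : ℝ) :
    V.fnMk g (r • P) (t • w) = (r * t) • V.fnMk g P w := by
  have h : g ⊗ₜ[ℝ] ((r • P) ⊗ₜ[ℝ] (t • w)) = (r * t) • (g ⊗ₜ[ℝ] (P ⊗ₜ[ℝ] w)) := by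
    rw [TensorProduct.smul_tmul_smul, TensorProduct.tmul_smul]
  exact h

/-- An odd coordinate as a generator of the exterior algebra. -/
def oddGen (z : V.CrdOdd) : ExteriorAlgebra ℝ (V.CrdOdd → ℝ) :=
  ExteriorAlgebra.ι ℝ (Pi.single z 1)

/-- The functions which are homogeneous of degree `k`: spanned by the products of a smooth function
and a monomial of degree `k` in the coordinates of positive degree. -/
def fnDeg (k : ℤ) : Submodule ℝ V.Fn :=
  Submodule.span ℝ {f | ∃ (g : SmoothFn V.base) (a : V.CrdEven →₀ ℕ) (w : List V.CrdOdd),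
    (((a.sum fun z r => r * z.1.deg) + (w.map fun z => z.1.deg).sum : ℕ) : ℤ) = k ∧
      V.fnMk g (MvPolynomial.monomial a 1) (w.map V.oddGen).prod = f}

/-- The partial derivative with respect to a coordinate (acting from the left). -/
def pd (z : V.Crd) : V.Fn →ₗ[ℝ] V.Fn :=
  if h0 : z.deg = 0 then
    TensorProduct.map (smoothPartial V.base ⟨z, h0⟩) LinearMap.id
  else if he : Even z.deg then
    TensorProduct.map LinearMap.id
      (TensorProduct.map (MvPolynomial.pderiv (⟨z, h0, he⟩ : V.CrdEven)).toLinearMap LinearMap.id)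
  else
    TensorProduct.map LinearMap.id
      (TensorProduct.map LinearMap.id (CliffordAlgebra.contractLeft
        (LinearMap.proj (⟨z, Nat.not_even_iff_odd.1 he⟩ : V.CrdOdd))))

/-- Rescaling the coordinates of degree `k` by `2^k`. -/
def rescale : V.Fn →ₗ[ℝ] V.Fn :=
  TensorProduct.map LinearMap.id (TensorProduct.map
    (MvPolynomial.aeval fun z : V.CrdEven =>
      MvPolynomial.C ((2 : ℝ) ^ z.1.deg) * MvPolynomial.X z).toLinearMap
    (ExteriorAlgebra.map (LinearMap.pi fun z : V.CrdOdd =>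
      (2 : ℝ) ^ z.1.deg • LinearMap.proj z)).toLinearMap)

theorem rescale_fnMk (g : SmoothFn V.base) (P : MvPolynomial V.CrdEven ℝ)
    (w : ExteriorAlgebra ℝ (V.CrdOdd → ℝ)) : V.rescale (V.fnMk g P w) = V.fnMk g
      (MvPolynomial.aeval (fun z : V.CrdEven =>
        MvPolynomial.C ((2 : ℝ) ^ z.1.deg) * MvPolynomial.X z) P)
      (ExteriorAlgebra.map (LinearMap.pi fun z : V.CrdOdd =>
        (2 : ℝ) ^ z.1.deg • LinearMap.proj z) w) := rfl

theorem fnDeg_le_eigenspace (k : ℤ) :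
    V.fnDeg k ≤ Module.End.eigenspace (V.rescale : Module.End ℝ V.Fn) ((2 : ℝ) ^ k) := by
  refine Submodule.span_le.2 ?_
  rintro _ ⟨g, a, w, rfl, rfl⟩
  rw [SetLike.mem_coe, Module.End.mem_eigenspace_iff]
  have h1 : (MvPolynomial.aeval fun z : V.CrdEven =>
      MvPolynomial.C ((2 : ℝ) ^ z.1.deg) * MvPolynomial.X z) (MvPolynomial.monomial a (1 : ℝ))
        = (2 : ℝ) ^ (a.sum fun z r => r * z.1.deg) • MvPolynomial.monomial a (1 : ℝ) := by
    rw [MvPolynomial.aeval_monomial, map_one, one_mul, MvPolynomial.monomial_eq, map_one, one_mul]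
    simp only [Finsupp.prod, Finsupp.sum, mul_pow, Finset.prod_mul_distrib, ← map_pow, ← map_prod,
      ← Finset.prod_pow_eq_pow_sum, MvPolynomial.smul_eq_C_mul, ← pow_mul, mul_comm]
  have h2 : ∀ w : List V.CrdOdd, ExteriorAlgebra.map (LinearMap.pi fun z : V.CrdOdd =>
      (2 : ℝ) ^ z.1.deg • LinearMap.proj z) (w.map V.oddGen).prod
        = (2 : ℝ) ^ (w.map fun z => z.1.deg).sum • (w.map V.oddGen).prod := by
    intro w
    induction w with
    | nil => simp
    | cons z w ih =>
      have h3 : ExteriorAlgebra.map (LinearMap.pi fun z : V.CrdOdd =>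
          (2 : ℝ) ^ z.1.deg • LinearMap.proj z) (V.oddGen z) = (2 : ℝ) ^ z.1.deg • V.oddGen z := by
        rw [oddGen, ExteriorAlgebra.map_apply_ι, ← map_smul]
        congr 1
        funext y
        by_cases hy : y = z
        · subst hy; simp
        · simp [hy]
      rw [List.map_cons, List.prod_cons, map_mul, ih, h3, List.map_cons, List.sum_cons, pow_add,
        smul_mul_smul_comm]
  rw [rescale_fnMk, h1, h2, zpow_natCast, pow_add, fnMk_smul]

/-- Products of odd coordinates span the exterior algebra. -/
theorem span_oddGen :
    Submodule.span ℝ (Set.range fun w : List V.CrdOdd => (w.map V.oddGen).prod) = ⊤ := by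
  have hmul : ∀ x ∈ Submodule.span ℝ (Set.range fun w : List V.CrdOdd => (w.map V.oddGen).prod),
      ∀ y ∈ Submodule.span ℝ (Set.range fun w : List V.CrdOdd => (w.map V.oddGen).prod),
      x * y ∈ Submodule.span ℝ (Set.range fun w : List V.CrdOdd => (w.map V.oddGen).prod) := by
    intro x hx y hy
    have h := Submodule.mul_mem_mul hx hy
    rw [Submodule.span_mul_span] at h
    refine Submodule.span_mono ?_ h
    rintro _ ⟨_, ⟨w, rfl⟩, _, ⟨w', rfl⟩, rfl⟩
    exact ⟨w ++ w', by simp⟩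
  have hone : (1 : ExteriorAlgebra ℝ (V.CrdOdd → ℝ)) ∈
      Submodule.span ℝ (Set.range fun w : List V.CrdOdd => (w.map V.oddGen).prod) :=
    Submodule.subset_span ⟨[], rfl⟩
  refine Submodule.eq_top_iff'.2 fun x => ?_
  induction x using ExteriorAlgebra.induction with
  | algebraMap r =>
    rw [Algebra.algebraMap_eq_smul_one]
    exact Submodule.smul_mem _ _ hone
  | ι v =>
    have hv : v = ∑ z, v z • (Pi.single z (1 : ℝ) : V.CrdOdd → ℝ) := by
      funext y
      simp [Finset.sum_apply, Pi.single_apply]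
    rw [hv, map_sum]
    refine Submodule.sum_mem _ fun z _ => ?_
    rw [map_smul]
    exact Submodule.smul_mem _ _ (Submodule.subset_span ⟨[z], by simp [oddGen]⟩)
  | mul x y hx hy => exact hmul x hx y hy
  | add x y hx hy => exact Submodule.add_mem _ hx hy

theorem fnMk_mem_iSup (g : SmoothFn V.base) (P : MvPolynomial V.CrdEven ℝ)
    (w : ExteriorAlgebra ℝ (V.CrdOdd → ℝ)) : V.fnMk g P w ∈ ⨆ k, V.fnDeg k := by
  have hw : w ∈ Submodule.span ℝ (Set.range fun w : List V.CrdOdd => (w.map V.oddGen).prod) := by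
    rw [span_oddGen]; trivial
  induction hw using Submodule.span_induction with
  | mem _ h =>
    obtain ⟨u, rfl⟩ := h
    induction P using MvPolynomial.induction_on' with
    | monomial a r =>
      have h1 : V.fnMk g (MvPolynomial.monomial a r) (u.map V.oddGen).prod
          = r • V.fnMk g (MvPolynomial.monomial a 1) (u.map V.oddGen).prod := by
        have h2 := V.fnMk_smul g (MvPolynomial.monomial a 1) (u.map V.oddGen).prod r 1
        rw [mul_one, one_smul, MvPolynomial.smul_monomial, smul_eq_mul, mul_one] at h2
        exact h2
      simp only [h1]
      exact Submodule.smul_mem _ _ (Submodule.mem_iSup_of_mem _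
        (Submodule.subset_span ⟨g, a, u, rfl, rfl⟩))
    | add P Q hP hQ =>
      have h1 : V.fnMk g (P + Q) (u.map V.oddGen).prod
          = V.fnMk g P (u.map V.oddGen).prod + V.fnMk g Q (u.map V.oddGen).prod := by
        unfold fnMk
        rw [TensorProduct.add_tmul]
        exact TensorProduct.tmul_add _ _ _
      simp only [h1]
      exact Submodule.add_mem _ hP hQ
  | zero =>
    have h1 : V.fnMk g P 0 = 0 := by
      unfold fnMk
      rw [TensorProduct.tmul_zero]
      exact TensorProduct.tmul_zero _ _
    rw [h1]
    exact Submodule.zero_mem _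
  | add x y _ _ hx hy =>
    have h1 : V.fnMk g P (x + y) = V.fnMk g P x + V.fnMk g P y := by
      unfold fnMk
      rw [TensorProduct.tmul_add]
      exact TensorProduct.tmul_add _ _ _
    rw [h1]
    exact Submodule.add_mem _ hx hy
  | smul r x _ hx =>
    have h1 := V.fnMk_smul g P x 1 r
    rw [one_smul, one_mul] at h1
    rw [h1]
    exact Submodule.smul_mem _ _ hx

theorem iSup_fnDeg : ⨆ k, V.fnDeg k = ⊤ := by
  refine Submodule.eq_top_iff'.2 fun f => ?_
  refine TensorProduct.induction_on (motive := fun f : V.Fn => f ∈ ⨆ k, V.fnDeg k) f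
    (Submodule.zero_mem _) (fun g t => ?_) fun x y hx hy => Submodule.add_mem _ hx hy
  induction t using TensorProduct.induction_on with
  | zero =>
    rw [TensorProduct.tmul_zero]
    exact Submodule.zero_mem _
  | tmul P w => exact V.fnMk_mem_iSup g P w
  | add x y hx hy =>
    rw [TensorProduct.tmul_add]
    exact Submodule.add_mem _ hx hy

/-- `C^∞(V)` is the direct sum of its homogeneous components. -/
theorem fnDeg_internal : DirectSum.IsInternal V.fnDeg := by
  refine DirectSum.isInternal_submodule_of_iSupIndep_of_iSup_eq_top ?_ V.iSup_fnDeg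
  have h := (Module.End.eigenspaces_iSupIndep (V.rescale : Module.End ℝ V.Fn)).comp
    (zpow_right_injective₀ (a := (2 : ℝ)) (by norm_num) (by norm_num))
  exact h.mono V.fnDeg_le_eigenspace

/-- The endomorphism operad of `C^∞(V)`. -/
def EndFn : OperadData := End V.fnDeg_internal

/-- The map `f ↦ (-1)^f f`. -/
def par : V.Fn →ₗ[ℝ] V.Fn := parity V.fnDeg_internal

/-- The bilinear map `(f, g) ↦ (D f) (D' g)`. -/
def prodOf (D D' : V.Fn →ₗ[ℝ] V.Fn) : V.Fn →ₗ[ℝ] V.Fn →ₗ[ℝ] V.Fn :=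
  (LinearMap.mul ℝ V.Fn).compl₁₂ D D'

/-- The Poisson bracket of degree `-n`. A sign `(-1)^(j f)` is written `par ^ j` applied to `f`. -/
def bracket : V.Fn →ₗ[ℝ] V.Fn →ₗ[ℝ] V.Fn :=
  if Odd n then
    ∑ μ, (V.prodOf (V.pd (.x μ) ∘ₗ V.par) (V.pd (.p μ)) + V.prodOf (V.pd (.p μ)) (V.pd (.x μ)))
    + ∑ i : Fin ((n - 1) / 2), ∑ α,
        (V.prodOf (V.pd (.psi i α) ∘ₗ V.par ^ (i + 1 + 1 : ℕ)) (V.pd (.chi i α))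
          + V.prodOf (V.pd (.chi i α) ∘ₗ V.par ^ (i + 1 : ℕ)) (V.pd (.psi i α)))
  else
    ∑ μ, (V.prodOf (V.pd (.x μ)) (V.pd (.p μ)) - V.prodOf (V.pd (.p μ)) (V.pd (.x μ)))
    + ∑ i : Fin ((n - 1) / 2), ∑ α,
        (V.prodOf (V.pd (.psi i α) ∘ₗ V.par ^ (i + 1 : ℕ)) (V.pd (.chi i α))
          - sg ((i : ℕ) + 1) •
            V.prodOf (V.pd (.chi i α) ∘ₗ V.par ^ (i + 1 : ℕ)) (V.pd (.psi i α)))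
    + ∑ a, ∑ b, V.κ⁻¹ a b • V.prodOf (V.pd (.xi a) ∘ₗ V.par ^ (n / 2)) (V.pd (.xi b))

/-- The tensor power `C^∞(V)^{⊗ N}`. -/
abbrev Tensor (N : ℕ) : Type := PiTensorProduct ℝ fun _ : Fin N => V.Fn

/-- The partial derivative `∂/∂z_{(i)}` acting on the `i`-th factor of a tensor power; it passes the
factors before it with a Koszul sign. -/
def pdAt {N : ℕ} (z : V.Crd) (i : Fin N) : Module.End ℝ (V.Tensor N) :=
  PiTensorProduct.map fun a =>
    if a < i then V.par ^ z.deg else if a = i then V.pd z else LinearMap.id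

/-- The operator `Δ_ij` attached to an edge from `i` to `j`. -/
def Delta {N : ℕ} (i j : Fin N) : Module.End ℝ (V.Tensor N) :=
  if Odd n then
    ∑ μ, (V.pdAt (.x μ) i * V.pdAt (.p μ) j + V.pdAt (.p μ) i * V.pdAt (.x μ) j)
    + ∑ k : Fin ((n - 1) / 2), ∑ α,
        (V.pdAt (.psi k α) i * V.pdAt (.chi k α) j + V.pdAt (.chi k α) i * V.pdAt (.psi k α) j)
  else
    ∑ μ, (V.pdAt (.x μ) i * V.pdAt (.p μ) j - V.pdAt (.p μ) i * V.pdAt (.x μ) j)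
    + ∑ k : Fin ((n - 1) / 2), ∑ α,
        (V.pdAt (.psi k α) i * V.pdAt (.chi k α) j
          - sg ((k : ℕ) + 1) • (V.pdAt (.chi k α) i * V.pdAt (.psi k α) j))
    + ∑ a, ∑ b, V.κ⁻¹ a b • (V.pdAt (.xi a) i * V.pdAt (.xi b) j)

/-- The multiplication map `f₁ ⊗ ⋯ ⊗ f_N ↦ f₁ ⋯ f_N`. -/
def mulMap (N : ℕ) : V.Tensor N →ₗ[ℝ] V.Fn :=
  PiTensorProduct.lift (MultilinearMap.mkPiAlgebraFin ℝ N V.Fn)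

/-- The value `μ_N (∏ Δ_ij (f₁ ⊗ ⋯ ⊗ f_N))`, where the product is over the ordered list `E` of
edges. -/
def graphValue {N : ℕ} (E : List (Fin N × Fin N)) (f : Fin N → V.Fn) : V.Fn :=
  V.mulMap N ((E.map fun e => V.Delta e.1 e.2).prod (PiTensorProduct.tprod ℝ f))

end NPChart

end NPOperad

end

/-! ### Signs, the operad `Ger_d` and its universal property -/

noncomputable section

namespace NPOperad

/-! ## Signs -/

/-! `Ger d` is a quotient of formal composites by exactly the operad laws and the defining
relations. It is therefore an operad, a morphism out of it is the same as a pair of operations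
satisfying `GerRelations` (`Ger.lift`), and the generators determine it (`Ger.hom_ext`).

Graphs on a fixed vertex set form an algebra generated by the edges, and inserting one graph into
another is a product of images under two algebra morphisms, `reconnect` and `relabel`. The operad
laws of `Gra d` thus reduce to statements about single edges, namely about which vertices an end may
be attached to (`reconnect_reconnect`), together with graded commutativity of the algebra
(`graDeg_comm`), which supplies the sign of the parallel law. The relations of `Ger_d` between the
two graphs are short computations, and this gives `i_d`.

Injectivity is proved by induction on the arity. The Jacobi and Poisson identities allow a chosen
input to be moved until it is either an outermost factor or bracketed directly with one other input
(`InsSpan.brDeriv`, `InsSpan.mulIns_and_mem`). Hence every operation is a product of some `a` with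
the last input plus a sum over `v` of operations `b v` in which the input `v` is replaced by its
bracket with the last one (`InsSpan.exists_normalForm`). On the graph side, discarding the graphs in
which the last vertex has an edge (`dropLast`) recovers the image of `a`. Keeping those in which
that vertex is a leaf attached to `v`, and cutting the leaf (`leaf`), recovers the image of `b v`.
If the whole image vanishes, the induction hypothesis makes `a` and all the `b v` vanish.

For the representation, the brackets and the operators `Δ` in all degrees are written as one
weighted sum over pairs of coordinates, `pairing`, whose graded symmetry is `pairing_flip`. The
operators `Δ` then satisfy the flip and exchange relations of edges, so graphs act on tensor powers
through an algebra morphism `graphOp`. Equivariance holds because the signed permutation of the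
factors intertwines this action and does not change the product of the factors
(`graphMult_relabel`). Compatibility with composition is the Leibniz rule: differentiating a product
of a block of functions is the sum over the factors of the block, which is the reconnection of edge
ends (`graphOp_mulBlock`), while derivatives inside a block pass the earlier functions with the
Koszul sign of the endomorphism operad (`mulBlock_graphOp_relabel`).

The action of `Ger_d` on functions is defined as the composite of the two morphisms. The
factorisation is then immediate, and the Jacobi and Poisson identities of the bracket of functions
are inherited from graphs and need no separate verification. -/

theorem sg_of_even {k : ℤ} (h : Even k) : sg k = 1 := if_pos h

theorem sg_of_odd {k : ℤ} (h : Odd k) : sg k = -1 := if_neg (Int.not_even_iff_odd.2 h)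

@[simp] theorem sg_zero : sg 0 = 1 := sg_of_even (by decide)

@[simp] theorem sg_one : sg 1 = -1 := sg_of_odd (by decide)

theorem sg_add (a b : ℤ) : sg (a + b) = sg a * sg b := by
  unfold sg
  by_cases ha : Even a <;> by_cases hb : Even b <;> simp [ha, hb, Int.even_add]

@[simp] theorem sg_mul_self (a : ℤ) : sg a * sg a = 1 := by
  unfold sg; split_ifs <;> simp

@[simp] theorem sg_neg (a : ℤ) : sg (-a) = sg a := by simp [sg]

theorem sg_sub (a b : ℤ) : sg (a - b) = sg a * sg b := by
  rw [sub_eq_add_neg, sg_add, sg_neg]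

theorem sg_congr {a b : ℤ} (h : Even (a - b)) : sg a = sg b := by
  rw [← sub_add_cancel a b, sg_add, sg_of_even h, one_mul]

theorem sg_sum {ι : Type*} (s : Finset ι) (f : ι → ℤ) : sg (∑ i ∈ s, f i) = ∏ i ∈ s, sg (f i) := by
  classical
  induction s using Finset.induction_on with
  | empty => simp
  | insert a s ha ih => rw [Finset.sum_insert ha, Finset.prod_insert ha, sg_add, ih]

/-- `(-1)^(ab)` equals `(-1)^b` for odd `a` and `1` for even `a`. -/
theorem sg_mul (a b : ℤ) : sg (a * b) = if Even a then 1 else sg b := by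
  unfold sg
  by_cases ha : Even a <;> by_cases hb : Even b <;> simp [ha, hb, Int.even_mul]

theorem sg_natAbs_mul (k a : ℤ) : sg (k.natAbs * a) = sg (k * a) := by
  rw [sg_mul, sg_mul]; simp only [Int.natCast_natAbs, even_abs]

theorem sg_smul_sg_smul {M : Type*} [AddCommGroup M] [Module ℝ M] (a : ℤ) (x : M) :
    sg a • sg a • x = x := by
  rw [smul_smul, sg_mul_self, one_smul]

/-! ## The operad `Ger_d` -/

namespace GerFree

variable {d : ℤ}

@[simp] theorem act_of {r : ℕ} {k : ℤ} (σ : Equiv.Perm (Fin (r + 1))) (t : GerTree d r k) :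
    act σ (of t) = of (GerTree.act σ t) := by
  simp [act, of]

@[simp] theorem comp_of {p q l : ℕ} {j k e : ℤ} (hl : p + q = l) (hk : j + k = e)
    (i : Fin (p + 1)) (s : GerTree d p j) (t : GerTree d q k) :
    comp hl hk i (of s) (of t) = of (GerTree.comp hl hk i s t) := by
  simp [comp, of]

end GerFree

namespace Ger

variable {d : ℤ}

/-- The class of a linear combination of formal composites. -/
def mk {r : ℕ} {k : ℤ} : GerFree d r k →ₗ[ℝ] (Ger d).sp r k := (gerIdeal d r k).mkQ

theorem mk_surjective {r : ℕ} {k : ℤ} : Function.Surjective (mk (d := d) (r := r) (k := k)) :=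
  Submodule.mkQ_surjective _

theorem mk_eq_mk {r : ℕ} {k : ℤ} {x y : GerFree d r k} (h : GerNull d (x - y)) : mk x = mk y :=
  (Submodule.Quotient.eq _).2 h

theorem mk_act {r : ℕ} {k : ℤ} (σ : Equiv.Perm (Fin (r + 1))) (x : GerFree d r k) :
    mk (GerFree.act σ x) = (Ger d).act σ (mk x) := rfl

theorem mk_comp {p q l : ℕ} {j k e : ℤ} (hl : p + q = l) (hk : j + k = e) (i : Fin (p + 1))
    (x : GerFree d p j) (y : GerFree d q k) :
    mk (GerFree.comp hl hk i x y) = (Ger d).comp hl hk i (mk x) (mk y) := rfl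

variable (d) in
theorem isOperad : IsOperad (Ger d) where
  act_one x := by
    obtain ⟨x, rfl⟩ := mk_surjective x
    exact mk_eq_mk (GerNull.act_one x)
  act_mul σ τ x := by
    obtain ⟨x, rfl⟩ := mk_surjective x
    exact mk_eq_mk (GerNull.act_mul σ τ x)
  one_comp x := by
    obtain ⟨x, rfl⟩ := mk_surjective x
    exact mk_eq_mk (GerNull.one_comp x)
  comp_one i x := by
    obtain ⟨x, rfl⟩ := mk_surjective x
    exact mk_eq_mk (GerNull.comp_one i x)
  seq h₁ h₂ h₃ h₄ g₁ g₂ g₃ g₄ i b x y z := by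
    obtain ⟨x, rfl⟩ := mk_surjective x
    obtain ⟨y, rfl⟩ := mk_surjective y
    obtain ⟨z, rfl⟩ := mk_surjective z
    exact mk_eq_mk (GerNull.seq h₁ h₂ h₃ h₄ g₁ g₂ g₃ g₄ i b x y z)
  par h₁ h₂ h₃ h₄ g₁ g₂ g₃ g₄ i a h x y z := by
    obtain ⟨x, rfl⟩ := mk_surjective x
    obtain ⟨y, rfl⟩ := mk_surjective y
    obtain ⟨z, rfl⟩ := mk_surjective z
    have h := mk_eq_mk (GerNull.par h₁ h₂ h₃ h₄ g₁ g₂ g₃ g₄ i a h x y z)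
    rwa [map_smul] at h
  equivariant hl hk i σ τ υ h x y := by
    obtain ⟨x, rfl⟩ := mk_surjective x
    obtain ⟨y, rfl⟩ := mk_surjective y
    exact mk_eq_mk (GerNull.equivariant hl hk i σ τ υ h x y)

/-- A property of elements of `Ger_d` which is additive and closed under the operations holds
as soon as it holds for the generators. -/
theorem induction {P : ∀ {r : ℕ} {k : ℤ}, (Ger d).sp r k → Prop}
    (zero : ∀ {r k}, P (0 : (Ger d).sp r k))
    (add : ∀ {r k} {x y : (Ger d).sp r k}, P x → P y → P (x + y))
    (smul : ∀ {r k} (c : ℝ) {x : (Ger d).sp r k}, P x → P (c • x))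
    (one : P (Ger d).one) (mul : P (Ger.mul d)) (br : P (Ger.br d))
    (act : ∀ {r k} (σ : Equiv.Perm (Fin (r + 1))) {x : (Ger d).sp r k}, P x → P ((Ger d).act σ x))
    (comp : ∀ {p q l : ℕ} {j k e : ℤ} (hl : p + q = l) (hk : j + k = e) (i : Fin (p + 1))
      {x : (Ger d).sp p j} {y : (Ger d).sp q k}, P x → P y → P ((Ger d).comp hl hk i x y))
    {r : ℕ} {k : ℤ} (x : (Ger d).sp r k) : P x := by
  obtain ⟨x, rfl⟩ := mk_surjective x
  have tree : ∀ {r : ℕ} {k : ℤ} (t : GerTree d r k), P (mk (GerFree.of t)) := by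
    intro r k t
    induction t with
    | one => exact one
    | mul => exact mul
    | br => exact br
    | act σ t ih =>
      rw [← GerFree.act_of, mk_act]
      exact act σ ih
    | comp hl hk i s t ihs iht =>
      rw [← GerFree.comp_of, mk_comp]
      exact comp hl hk i ihs iht
  induction x using Finsupp.induction_linear with
  | zero => rw [map_zero]; exact zero
  | add x y hx hy => rw [map_add]; exact add hx hy
  | single t c =>
    have h : (Finsupp.single t c : GerFree d r k) = c • GerFree.of t := by simp [GerFree.of]
    rw [h, map_smul]
    exact smul c (tree t)

/-- The elements on which two morphisms agree are closed under every operation of the operad, so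
agreement on the two generators propagates to everything. All uniqueness claims rest on this. -/
theorem hom_ext {Q : OperadData} {F G : OperadHom (Ger d) Q}
    (hm : F.map (Ger.mul d) = G.map (Ger.mul d)) (hb : F.map (Ger.br d) = G.map (Ger.br d)) :
    F = G := by
  refine OperadHom.ext ?_
  funext r k
  refine LinearMap.ext fun x => ?_
  refine induction (P := fun {r k} x => F.map x = G.map x) ?_ ?_ ?_ ?_ hm hb ?_ ?_ x
  · intros; simp
  · intro r k x y hx hy; rw [map_add, map_add, hx, hy]
  · intro r k c x hx; rw [map_smul, map_smul, hx]
  · rw [F.map_one, G.map_one]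
  · intro r k σ x hx; rw [F.map_act, G.map_act, hx]
  · intro p q l j k e hl hk i x y hx hy; rw [F.map_comp, G.map_comp, hx, hy]

end Ger

/-- The relations between the product and the bracket of a `Ger_d`-algebra, in an operad. -/
structure GerRelations (d : ℤ) (Q : OperadData) (m : Q.sp 1 0) (b : Q.sp 1 (1 - d)) : Prop where
  mul_comm : Q.act (Equiv.swap 0 1) m = m
  mul_assoc : Q.comp (rfl : 1 + 1 = 2) (zero_add 0) 0 m m
    = Q.comp (rfl : 1 + 1 = 2) (zero_add 0) 1 m m
  br_symm : Q.act (Equiv.swap 0 1) b = sg d • b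
  jacobi : Q.comp (rfl : 1 + 1 = 2) rfl 0 b b
        + Q.act (finRotate 3) (Q.comp (rfl : 1 + 1 = 2) rfl 0 b b)
        + Q.act (finRotate 3 * finRotate 3) (Q.comp (rfl : 1 + 1 = 2) rfl 0 b b) = 0
  poisson : Q.comp (rfl : 1 + 1 = 2) (add_zero (1 - d)) 1 b m
    = Q.comp (rfl : 1 + 1 = 2) (zero_add (1 - d)) 0 m b
      + Q.act (Equiv.swap 0 1) (Q.comp (rfl : 1 + 1 = 2) (zero_add (1 - d)) 1 m b)

theorem Ger.relations (d : ℤ) : GerRelations d (Ger d) (Ger.mul d) (Ger.br d) where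
  mul_comm := mk_eq_mk GerNull.mul_comm
  mul_assoc := mk_eq_mk GerNull.mul_assoc
  br_symm := by
    have h := mk_eq_mk (GerNull.br_symm (d := d))
    rwa [map_smul] at h
  jacobi := (Submodule.Quotient.mk_eq_zero _).2 GerNull.jacobi
  poisson := by
    have h : mk _ = 0 := (Submodule.Quotient.mk_eq_zero _).2 (GerNull.poisson (d := d))
    rw [map_sub, map_sub, sub_sub, sub_eq_zero] at h
    exact h

namespace Ger

variable {d : ℤ} {Q : OperadData}

/-- Evaluation of a formal composite in an operad. -/
def evalTree (m : Q.sp 1 0) (b : Q.sp 1 (1 - d)) : ∀ {r : ℕ} {k : ℤ}, GerTree d r k → Q.sp r k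
  | _, _, .one => Q.one
  | _, _, .mul => m
  | _, _, .br => b
  | _, _, .act σ t => Q.act σ (evalTree m b t)
  | _, _, .comp hl hk i s t => Q.comp hl hk i (evalTree m b s) (evalTree m b t)

/-- Linear extension of `evalTree`. -/
def evalFree (m : Q.sp 1 0) (b : Q.sp 1 (1 - d)) {r : ℕ} {k : ℤ} : GerFree d r k →ₗ[ℝ] Q.sp r k :=
  Finsupp.linearCombination ℝ (evalTree m b)

@[simp] theorem evalFree_of (m : Q.sp 1 0) (b : Q.sp 1 (1 - d)) {r : ℕ} {k : ℤ}
    (t : GerTree d r k) : evalFree m b (GerFree.of t) = evalTree m b t := by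
  simp [evalFree, GerFree.of]

@[simp] theorem evalFree_act (m : Q.sp 1 0) (b : Q.sp 1 (1 - d)) {r : ℕ} {k : ℤ}
    (σ : Equiv.Perm (Fin (r + 1))) (x : GerFree d r k) :
    evalFree m b (GerFree.act σ x) = Q.act σ (evalFree m b x) := by
  have h : evalFree m b ∘ₗ GerFree.act (k := k) σ = Q.act σ ∘ₗ evalFree m b := by
    refine Finsupp.lhom_ext' fun t => LinearMap.ext_ring ?_
    change evalFree m b (GerFree.act σ (GerFree.of t)) = Q.act σ (evalFree m b (GerFree.of t))
    rw [GerFree.act_of, evalFree_of, evalFree_of, evalTree]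
  exact LinearMap.congr_fun h x

@[simp] theorem evalFree_comp (m : Q.sp 1 0) (b : Q.sp 1 (1 - d)) {p q l : ℕ} {j k e : ℤ}
    (hl : p + q = l) (hk : j + k = e) (i : Fin (p + 1)) (x : GerFree d p j) (y : GerFree d q k) :
    evalFree m b (GerFree.comp hl hk i x y)
      = Q.comp hl hk i (evalFree m b x) (evalFree m b y) := by
  have h : (GerFree.comp hl hk i).compr₂ (evalFree m b)
      = (Q.comp hl hk i).compl₁₂ (evalFree m b) (evalFree m b) := by
    refine Finsupp.lhom_ext' fun s => LinearMap.ext_ring ?_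
    refine Finsupp.lhom_ext' fun t => LinearMap.ext_ring ?_
    change evalFree m b (GerFree.comp hl hk i (GerFree.of s) (GerFree.of t))
      = Q.comp hl hk i (evalFree m b (GerFree.of s)) (evalFree m b (GerFree.of t))
    rw [GerFree.comp_of, evalFree_of, evalFree_of, evalFree_of, evalTree]
  exact LinearMap.congr_fun₂ h x y

/-- Each way of producing a vanishing combination is a closure rule respected by evaluation, an
operad law of the target, or one of the five relations. Evaluation therefore descends to the
quotient. -/
theorem evalFree_eq_zero (hQ : IsOperad Q) {m : Q.sp 1 0} {b : Q.sp 1 (1 - d)}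
    (h : GerRelations d Q m b) {r : ℕ} {k : ℤ} {x : GerFree d r k} (hx : GerNull d x) :
    evalFree m b x = 0 := by
  induction hx with
  | zero => exact map_zero _
  | add _ _ hx hy => rw [map_add, hx, hy, add_zero]
  | smul c _ hx => rw [map_smul, hx, smul_zero]
  | act σ _ hx => rw [evalFree_act, hx, map_zero]
  | comp_left hl hk i y _ hx => rw [evalFree_comp, hx, map_zero]; rfl
  | comp_right hl hk i x _ hy => rw [evalFree_comp, hy, map_zero]
  | act_one x => rw [map_sub, evalFree_act, hQ.act_one, sub_self]
  | act_mul σ τ x =>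
    rw [map_sub, evalFree_act, evalFree_act, evalFree_act, hQ.act_mul, sub_self]
  | one_comp x => rw [map_sub, evalFree_comp, evalFree_of, evalTree, hQ.one_comp, sub_self]
  | comp_one i x => rw [map_sub, evalFree_comp, evalFree_of, evalTree, hQ.comp_one, sub_self]
  | seq h₁ h₂ h₃ h₄ g₁ g₂ g₃ g₄ i b x y z =>
    simp only [map_sub, evalFree_comp]
    rw [hQ.seq h₁ h₂ h₃ h₄ g₁ g₂ g₃ g₄, sub_self]
  | par h₁ h₂ h₃ h₄ g₁ g₂ g₃ g₄ i a hia x y z =>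
    simp only [map_sub, map_smul, evalFree_comp]
    rw [hQ.par h₁ h₂ h₃ h₄ g₁ g₂ g₃ g₄ i a hia, sub_self]
  | equivariant hl hk i σ τ υ hυ x y =>
    simp only [map_sub, evalFree_comp, evalFree_act]
    rw [hQ.equivariant hl hk i σ τ υ hυ, sub_self]
  | mul_comm => simp only [map_sub, evalFree_act, evalFree_of, evalTree, h.mul_comm, sub_self]
  | mul_assoc => simp only [map_sub, evalFree_comp, evalFree_of, evalTree, h.mul_assoc, sub_self]
  | br_symm =>
    simp only [map_sub, map_smul, evalFree_act, evalFree_of, evalTree, h.br_symm, sub_self]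
  | jacobi =>
    simp only [map_add, evalFree_act, evalFree_comp, evalFree_of, evalTree, h.jacobi]
  | poisson =>
    simp only [map_sub, evalFree_act, evalFree_comp, evalFree_of, evalTree, h.poisson]
    abel

/-- The universal property of `Ger_d`. -/
def lift (hQ : IsOperad Q) {m : Q.sp 1 0} {b : Q.sp 1 (1 - d)} (h : GerRelations d Q m b) :
    OperadHom (Ger d) Q where
  map {r k} := (gerIdeal d r k).liftQ (evalFree m b) fun _ hx => evalFree_eq_zero hQ h hx
  map_one := evalFree_of m b GerTree.one
  map_act σ x := by
    obtain ⟨x, rfl⟩ := mk_surjective x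
    exact evalFree_act m b σ x
  map_comp hl hk i x y := by
    obtain ⟨x, rfl⟩ := mk_surjective x
    obtain ⟨y, rfl⟩ := mk_surjective y
    exact evalFree_comp m b hl hk i x y

theorem lift_mul (hQ : IsOperad Q) {m : Q.sp 1 0} {b : Q.sp 1 (1 - d)}
    (h : GerRelations d Q m b) : (lift hQ h).map (Ger.mul d) = m :=
  evalFree_of m b GerTree.mul

theorem lift_br (hQ : IsOperad Q) {m : Q.sp 1 0} {b : Q.sp 1 (1 - d)}
    (h : GerRelations d Q m b) : (lift hQ h).map (Ger.br d) = b :=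
  evalFree_of m b GerTree.br

end Ger

end NPOperad

end

/-! ### The graph operad and the relations of `Ger_d` inside it -/

noncomputable section

namespace NPOperad

/-! ## Positions of inputs -/

theorem outer_val_of_lt {p q l : ℕ} (hl : p + q = l) {i a : Fin (p + 1)} (h : a < i) :
    (outer hl i a : ℕ) = a := by simp [outer, h]

theorem outer_val_of_not_lt {p q l : ℕ} (hl : p + q = l) {i a : Fin (p + 1)} (h : ¬ a < i) :
    (outer hl i a : ℕ) = a + q := by simp [outer, h]

theorem outer_val {p q l : ℕ} (hl : p + q = l) (i a : Fin (p + 1)) :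
    ((a : ℕ) < i ∧ (outer hl i a : ℕ) = a) ∨ ((i : ℕ) ≤ a ∧ (outer hl i a : ℕ) = a + q) := by
  by_cases h : a < i
  · exact .inl ⟨h, outer_val_of_lt hl h⟩
  · exact .inr ⟨Fin.not_lt.1 h, outer_val_of_not_lt hl h⟩

@[simp] theorem inner_val {p q l : ℕ} (hl : p + q = l) (i : Fin (p + 1)) (b : Fin (q + 1)) :
    (inner hl i b : ℕ) = i + b := rfl

theorem mem_spread {p q l : ℕ} (hl : p + q = l) (i a : Fin (p + 1)) (x : Fin (l + 1)) :
    x ∈ spread hl i a ↔ (a = i ∧ ∃ b, inner hl i b = x) ∨ (a ≠ i ∧ outer hl i a = x) := by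
  unfold spread
  by_cases h : a = i <;> simp [h, eq_comm]

/-- Expressed through numerical inequalities, membership in a spread becomes linear arithmetic, so
identities between iterated insertions can be left to decision procedures. -/
theorem mem_spread_iff {p q l : ℕ} (hl : p + q = l) (i a : Fin (p + 1)) (x : Fin (l + 1)) :
    x ∈ spread hl i a ↔ ((a : ℕ) = i ∧ (i : ℕ) ≤ x ∧ (x : ℕ) ≤ i + q) ∨
      ((a : ℕ) < i ∧ (x : ℕ) = a) ∨ ((i : ℕ) < a ∧ (x : ℕ) = a + q) := by
  rw [mem_spread]
  constructor
  · rintro (⟨h, b, h'⟩ | ⟨h, h'⟩)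
    · have h1 := congrArg Fin.val h
      have h2 := inner_val hl i b
      rw [h'] at h2
      omega
    · have h1 : (a : ℕ) ≠ i := fun h' => h (Fin.ext h')
      have h2 := outer_val hl i a
      rw [h'] at h2
      omega
  · rintro (⟨h, h1, h2⟩ | h)
    · exact .inl ⟨Fin.ext h, ⟨x - i, by omega⟩, Fin.ext (by simp; omega)⟩
    · refine .inr ⟨fun h' => ?_, Fin.ext ?_⟩
      · subst h'; omega
      · have := outer_val hl i a
        omega

/-! ## The algebra of graphs -/

namespace GraAlg

variable {d : ℤ}

/-- The edges generate the algebra of graphs, so the identities between reconnections used for the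
operad laws need to be compared only on one edge. -/
theorem algHom_ext {N : ℕ} {B : Type*} [Ring B] [Algebra ℝ B] {f g : GraAlg d N →ₐ[ℝ] B}
    (h : ∀ e, f (edge d e) = g (edge d e)) : f = g := by
  refine RingQuot.ringQuot_ext' ℝ f g (FreeAlgebra.hom_ext (funext fun e => ?_))
  exact h e

theorem reconnect_edge {N N' : ℕ} (F : Fin N → Finset (Fin N')) (a b : Fin N) :
    reconnect d F (edge d (a, b)) = ∑ x ∈ F a, ∑ y ∈ F b, edge d (x, y) := by
  rw [reconnect, lift_edge, Finset.sum_product]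

theorem relabel_edge {N N' : ℕ} (g : Fin N → Fin N') (a b : Fin N) :
    relabel d g (edge d (a, b)) = edge d (g a, g b) := by
  simp [relabel, reconnect_edge]

theorem reconnect_id {N : ℕ} {F : Fin N → Finset (Fin N)} (h : ∀ v, F v = {v}) (x : GraAlg d N) :
    reconnect d F x = x := by
  have : reconnect d F = AlgHom.id ℝ (GraAlg d N) := algHom_ext fun ⟨a, b⟩ => by
    simp [reconnect_edge, h]
  rw [this]; rfl

theorem relabel_id {N : ℕ} {g : Fin N → Fin N} (h : ∀ v, g v = v) (x : GraAlg d N) :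
    relabel d g x = x := reconnect_id (fun v => by rw [h]) x

/-- Successive reconnections, when the sets of possible ends at different vertices are
disjoint. -/
theorem reconnect_reconnect {N N' N'' : ℕ} {F : Fin N → Finset (Fin N')}
    {G : Fin N' → Finset (Fin N'')} {H : Fin N → Finset (Fin N'')}
    (hG : ∀ u u' x, x ∈ G u → x ∈ G u' → u = u')
    (hH : ∀ v x, x ∈ H v ↔ ∃ u ∈ F v, x ∈ G u) (x : GraAlg d N) :
    reconnect d G (reconnect d F x) = reconnect d H x := by
  have hs : ∀ {M : Type} [AddCommMonoid M] (φ : Fin N'' → M) (v : Fin N),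
      ∑ u ∈ F v, ∑ x ∈ G u, φ x = ∑ x ∈ H v, φ x := by
    intro M _ φ v
    have h : H v = (F v).biUnion G := by ext x; simp [hH]
    -- Disjointness guarantees that each final vertex is reached through only one intermediate
    -- vertex, so the double sum counts it once.
    rw [h, Finset.sum_biUnion]
    intro u _ u' _ huu'
    refine Finset.disjoint_left.2 fun x hx hx' => huu' (hG u u' x hx hx')
  have : (reconnect d G).comp (reconnect d F) = reconnect d H := algHom_ext fun ⟨a, b⟩ => by
    rw [AlgHom.comp_apply, reconnect_edge, map_sum, reconnect_edge, ← hs]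
    refine Finset.sum_congr rfl fun x _ => ?_
    simp only [map_sum, reconnect_edge, ← hs]
    rw [Finset.sum_comm]
  exact DFunLike.congr_fun this x

theorem relabel_relabel {N N' N'' : ℕ} (g : Fin N → Fin N') (g' : Fin N' → Fin N'')
    {g'' : Fin N → Fin N''} (h : ∀ v, g'' v = g' (g v)) (x : GraAlg d N) :
    relabel d g' (relabel d g x) = relabel d g'' x := by
  have : (relabel d g').comp (relabel d g) = relabel d g'' := algHom_ext fun ⟨a, b⟩ => by
    simp [relabel_edge, h]
  exact DFunLike.congr_fun this x

theorem graph_cons {N : ℕ} (e : Fin N × Fin N) (E : List (Fin N × Fin N)) :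
    graph d (e :: E) = edge d e * graph d E := by simp [graph]

@[simp] theorem graph_nil {N : ℕ} : graph d ([] : List (Fin N × Fin N)) = 1 := by simp [graph]

theorem edge_mul_graph {N : ℕ} (e : Fin N × Fin N) (E : List (Fin N × Fin N)) :
    edge d e * graph d E = sg ((d + 1) * E.length) • (graph d E * edge d e) := by
  induction E with
  | nil => simp
  | cons e' E ih =>
    rw [graph_cons, ← mul_assoc, edge_swap d e' e, smul_mul_assoc, mul_assoc, ih, mul_smul_comm,
      smul_smul, ← sg_add, mul_assoc]
    congr 2
    push_cast [List.length_cons]; ring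

theorem graph_mul_graph {N : ℕ} (E E' : List (Fin N × Fin N)) :
    graph d E * graph d E' = sg ((d + 1) * E.length * E'.length) • (graph d E' * graph d E) := by
  induction E with
  | nil => simp
  | cons e E ih =>
    have h : ((d + 1) * (e :: E).length * E'.length : ℤ)
        = (d + 1) * E.length * E'.length + (d + 1) * E'.length := by
      push_cast [List.length_cons]; ring
    rw [h, sg_add, graph_cons, mul_assoc, ih, mul_smul_comm, ← mul_assoc, edge_mul_graph,
      smul_mul_assoc, smul_smul, mul_assoc (graph d E')]

end GraAlg

open GraAlg

/-- Exchanging blocks of `m` and `m'` edges costs the exponent `(d + 1) m m'`, while the Koszul rule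
predicts `m m' (1 - d)²`. The difference `m m' d (3 - d)` is even because `d` and `3 - d` have
opposite parity. -/
theorem graDeg_comm {d : ℤ} {N : ℕ} {j k : ℤ} {x y : GraAlg d N} (hx : x ∈ graDeg d N j)
    (hy : y ∈ graDeg d N k) : x * y = sg (j * k) • (y * x) := by
  induction hx, hy using Submodule.span_induction₂ with
  | mem_mem x y hx hy =>
    obtain ⟨E, hE, rfl⟩ := hx
    obtain ⟨E', hE', rfl⟩ := hy
    rw [graph_mul_graph]
    congr 1
    refine sg_congr ?_
    rw [← hE, ← hE']
    have h : (d + 1) * E.length * E'.length - E.length * (1 - d) * (E'.length * (1 - d))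
        = E.length * E'.length * (d * (3 - d)) := by ring
    rw [h]
    refine Even.mul_left ?_ _
    rcases Int.even_or_odd d with h | h
    · exact h.mul_right _
    · exact (Odd.sub_odd (by decide : Odd (3 : ℤ)) h).mul_left _
  | zero_left => simp
  | zero_right => simp
  | add_left x y z _ _ _ hx hy => rw [add_mul, mul_add, smul_add, hx, hy]
  | add_right x y z _ _ _ hx hy => rw [add_mul, mul_add, smul_add, hx, hy]
  | smul_left c x y _ _ h => rw [smul_mul_assoc, mul_smul_comm, h, smul_comm]
  | smul_right c x y _ _ h => rw [smul_mul_assoc, mul_smul_comm, h, smul_comm]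

/-! ## The operad laws of `Gra_d` -/

namespace Gra

variable {d : ℤ}

/-- The underlying element of the algebra of graphs. -/
def toAlg {r : ℕ} {k : ℤ} : (Gra d).sp r k →ₗ[ℝ] GraAlg d (r + 1) :=
  (graDeg d (r + 1) k).subtype

theorem toAlg_mem {r : ℕ} {k : ℤ} (x : (Gra d).sp r k) : toAlg x ∈ graDeg d (r + 1) k :=
  Subtype.prop (p := (· ∈ graDeg d (r + 1) k)) x

theorem toAlg_injective {r : ℕ} {k : ℤ} : Function.Injective (toAlg (d := d) (r := r) (k := k)) :=
  Subtype.val_injective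

theorem toAlg_act {r : ℕ} {k : ℤ} (σ : Equiv.Perm (Fin (r + 1))) (x : (Gra d).sp r k) :
    toAlg ((Gra d).act σ x) = relabel d ⇑σ⁻¹ (toAlg x) := rfl

theorem toAlg_comp {p q l : ℕ} {j k e : ℤ} (hl : p + q = l) (hk : j + k = e) (i : Fin (p + 1))
    (x : (Gra d).sp p j) (y : (Gra d).sp q k) :
    toAlg ((Gra d).comp hl hk i x y)
      = reconnect d (spread hl i) (toAlg x) * relabel d (inner hl i) (toAlg y) := rfl

@[simp] theorem toAlg_one : toAlg (Gra d).one = 1 := GraAlg.graph_nil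

@[simp] theorem toAlg_gammaMult : toAlg (gammaMult d) = 1 := GraAlg.graph_nil

@[simp] theorem toAlg_gammaBr : toAlg (gammaBr d) = edge d ((0 : Fin 2), (1 : Fin 2)) := by
  simp [toAlg, gammaBr, GraAlg.graph]
  rfl

theorem spread_disjoint {p q l : ℕ} (hl : p + q = l) (i u u' : Fin (p + 1)) (x : Fin (l + 1))
    (h : x ∈ spread hl i u) (h' : x ∈ spread hl i u') : u = u' := by
  rw [mem_spread_iff] at h h'
  ext; omega

variable (d) in
-- Both sides of each law are products of reconnected factors, which are compared one by one. The
-- spreads of distinct vertices are disjoint, so successive reconnections merge into one and only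
-- memberships in spreads remain. A sign appears only in the parallel law, where the two inserted
-- graphs are interchanged.
theorem isOperad : IsOperad (Gra d) where
  act_one x := toAlg_injective (relabel_id (fun _ => rfl) _)
  act_mul σ τ x := toAlg_injective (by
    rw [toAlg_act, toAlg_act, toAlg_act, relabel_relabel]
    intro v
    rw [mul_inv_rev]; rfl)
  one_comp {q k} x := toAlg_injective (by
    rw [toAlg_comp, toAlg_one, map_one, one_mul]
    exact relabel_id (fun v => Fin.ext (by simp)) _)
  comp_one {p k} i x := toAlg_injective (by
    rw [toAlg_comp, toAlg_one, map_one, mul_one]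
    refine reconnect_id (fun v => ?_) _
    ext u
    rw [mem_spread_iff, Finset.mem_singleton, Fin.ext_iff]
    omega)
  seq {p q r pq qr pqr} {j k m jk km jkm} h₁ h₂ h₃ h₄ g₁ g₂ g₃ g₄ i b x y z := toAlg_injective (by
    simp only [toAlg_comp, map_mul]
    rw [mul_assoc]
    congr 1
    · refine reconnect_reconnect (spread_disjoint _ _) (fun v u => ?_) _
      have hv := v.2
      have hi := i.2
      have hu := u.2
      have hb := b.2
      simp only [mem_spread_iff, inner_val]
      constructor
      · intro h
        -- The intermediate vertex is recovered from the final one: positions before the inserted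
        -- block are unchanged, the block comes from the vertex `i + b`, and later positions are
        -- shifted back by `r`.
        by_cases hui : (u : ℕ) < i + b
        · exact ⟨⟨u, by omega⟩, by simp only; lia⟩
        · by_cases hur : (u : ℕ) ≤ i + b + r
          · exact ⟨⟨i + b, by omega⟩, by simp only; lia⟩
          · exact ⟨⟨u - r, by omega⟩, by simp only; lia⟩
      · rintro ⟨w, h, h'⟩
        omega
    · congr 1
      · rw [relabel, relabel]
        have hH : ∀ (v : Fin (q + 1)) (u : Fin (pqr + 1)), u ∈
            (spread h₂ (inner h₁ i b) (inner h₁ i v)) ↔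
              ∃ w ∈ ({inner h₁ i v} : Finset _), u ∈ spread h₂ (inner h₁ i b) w := by
          intro v u; simp
        rw [reconnect_reconnect (spread_disjoint _ _) hH]
        symm
        refine reconnect_reconnect (fun u u' w hu hu' => ?_) (fun v u => ?_) _
        · rw [Finset.mem_singleton] at hu hu'
          exact inner_injective h₄ i (hu.symm.trans hu')
        · have hv := v.2
          have hi := i.2
          have hu := u.2
          have hb := b.2
          simp only [mem_spread_iff, inner_val, Finset.mem_singleton, Fin.ext_iff]
          constructor
          · intro h
            exact ⟨⟨u - i, by omega⟩, by simp only; lia⟩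
          · rintro ⟨w, h, h'⟩
            omega
      · symm
        exact relabel_relabel _ _ (fun v => Fin.ext (by simp [add_assoc])) _)
  par {p q r pq pr pqr} {j k m jk jm jkm} h₁ h₂ h₃ h₄ g₁ g₂ g₃ g₄ i a hia x y z :=
    toAlg_injective (by
    rw [map_smul]
    simp only [toAlg_comp, map_mul]
    rw [mul_assoc, mul_assoc, ← mul_smul_comm]
    have hia' : (i : ℕ) < a := hia
    have ha := a.2
    have e1 : (outer h₁ i a : ℕ) = a + q := outer_val_of_not_lt h₁ (not_lt_of_gt hia)
    have e2 : (outer h₃ a i : ℕ) = i := outer_val_of_lt h₃ hia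
    congr 1
    -- The two orders of insertion are compared through the set of vertices reached by the first
    -- order; an intermediate vertex is then produced in each direction.
    · rw [reconnect_reconnect (H := fun v => (spread h₁ i v).biUnion (spread h₂ (outer h₁ i a)))
        (spread_disjoint _ _) (by simp)]
      symm
      refine reconnect_reconnect (spread_disjoint _ _) (fun v u => ?_) _
      have hv := v.2
      have hu := u.2
      simp only [Finset.mem_biUnion, mem_spread_iff, e1, e2]
      constructor
      · rintro ⟨w, h, h'⟩
        by_cases hw : (w : ℕ) < i
        · exact ⟨⟨w, by omega⟩, by simp only; lia⟩
        · by_cases hw' : (w : ℕ) ≤ i + q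
          · exact ⟨⟨i, by omega⟩, by simp only; lia⟩
          · exact ⟨⟨u - q, by omega⟩, by simp only; lia⟩
      · rintro ⟨w, h, h'⟩
        by_cases hw : (w : ℕ) < a
        · exact ⟨⟨u, by omega⟩, by simp only; lia⟩
        · by_cases hw' : (w : ℕ) ≤ a + r
          · exact ⟨⟨a + q, by omega⟩, by simp only; lia⟩
          · exact ⟨⟨w + q - r, by omega⟩, by simp only; lia⟩
    -- The edges of the two inserted graphs stand in opposite orders on the two sides, and
    -- interchanging them yields the sign of the parallel law.
    · have hc := graDeg_comm (reconnect_mem d (spread h₂ (outer h₁ i a)) (GraAlg.reconnect_mem d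
          (fun v => {inner h₁ i v}) (toAlg_mem y)))
        (reconnect_mem d (fun v => {inner h₂ (outer h₁ i a) v}) (toAlg_mem z))
      refine hc.trans ?_
      congr 1
      congr 1
      · symm
        rw [relabel]
        refine reconnect_reconnect (spread_disjoint _ _) (fun v u => ?_) _
        have hv := v.2
        simp only [mem_spread_iff, inner_val, Finset.mem_singleton, Fin.ext_iff, e1, e2]
        constructor
        · intro h
          exact ⟨⟨a + v, by omega⟩, by simp only; lia⟩
        · rintro ⟨w, h, h'⟩
          omega
      · rw [relabel]
        refine reconnect_reconnect (spread_disjoint _ _) (fun v u => ?_) _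
        have hv := v.2
        simp only [mem_spread_iff, inner_val, Finset.mem_singleton, Fin.ext_iff, e1, e2]
        constructor
        · intro h
          exact ⟨⟨i + v, by omega⟩, by simp only; lia⟩
        · rintro ⟨w, h, h'⟩
          omega)
  equivariant {p q l j k e} hl hk i σ τ υ hυ x y := toAlg_injective (by
    simp only [toAlg_comp, toAlg_act, map_mul]
    obtain ⟨ho, hi⟩ := hυ
    congr 1
    · rw [relabel, relabel, reconnect_reconnect (H := fun v => spread hl i (σ⁻¹ v))
        (spread_disjoint _ _) (by simp)]
      symm
      refine reconnect_reconnect (fun u u' w hu hu' => ?_) (fun v u => ?_) _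
      · rw [Finset.mem_singleton] at hu hu'
        exact υ⁻¹.injective (hu.symm.trans hu')
      · simp only [Finset.mem_singleton, mem_spread]
        constructor
        · rintro (⟨h, b, rfl⟩ | ⟨h, rfl⟩)
          · refine ⟨υ (inner hl i b), .inl ⟨?_, τ b, ?_⟩, by simp⟩
            · rw [← h]; simp
            · rw [hi]
          · refine ⟨υ (outer hl i (σ⁻¹ v)), .inr ⟨?_, ?_⟩, by simp⟩
            · rintro rfl; simp at h
            · rw [ho _ h]; simp
        · rintro ⟨w, (⟨rfl, b, rfl⟩ | ⟨h, rfl⟩), rfl⟩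
          · refine .inl ⟨by simp, τ⁻¹ b, ?_⟩
            rw [Equiv.Perm.eq_inv_iff_eq, hi]; simp
          · have h' : σ⁻¹ v ≠ i := by rintro rfl; simp at h
            refine .inr ⟨h', ?_⟩
            rw [Equiv.Perm.eq_inv_iff_eq, ho _ h']; simp
    · rw [relabel_relabel _ _ (g'' := fun v => inner hl i (τ⁻¹ v)) (fun _ => rfl)]
      symm
      refine relabel_relabel _ _ (fun v => ?_) _
      rw [Equiv.Perm.eq_inv_iff_eq, hi]; simp)

/-- The product relations hold because the graph of the product has no edges. The Poisson identity
holds because an edge arriving at an inserted pair of disconnected vertices becomes the sum of its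
two attachments. -/
theorem relations (d : ℤ) : GerRelations d (Gra d) (gammaMult d) (gammaBr d) where
  mul_comm := toAlg_injective (by rw [toAlg_act, toAlg_gammaMult, map_one])
  mul_assoc := toAlg_injective (by simp only [toAlg_comp, toAlg_gammaMult, map_one])
  br_symm := toAlg_injective (by
    rw [toAlg_act, map_smul, toAlg_gammaBr, relabel_edge, ← edge_flip]
    simp)
  jacobi := toAlg_injective (by
    have s0 : spread (rfl : 1 + 1 = 2) 0 0 = ({0, 1} : Finset (Fin 3)) := by decide
    have s1 : spread (rfl : 1 + 1 = 2) 0 1 = ({2} : Finset (Fin 3)) := by decide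
    have i0 : inner (rfl : 1 + 1 = 2) 0 0 = (0 : Fin 3) := by decide
    have i1 : inner (rfl : 1 + 1 = 2) 0 1 = (1 : Fin 3) := by decide
    have r0 : (finRotate 3)⁻¹ 0 = 2 := by decide
    have r1 : (finRotate 3)⁻¹ 1 = 0 := by decide
    have r2 : (finRotate 3)⁻¹ 2 = 1 := by decide
    have t0 : (finRotate 3 * finRotate 3)⁻¹ 0 = 1 := by decide
    have t1 : (finRotate 3 * finRotate 3)⁻¹ 1 = 2 := by decide
    have t2 : (finRotate 3 * finRotate 3)⁻¹ 2 = 0 := by decide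
    -- After orienting and ordering the edges, the six terms of the Jacobi sum become multiples of
    -- the three products of two edges of a triangle. Each product occurs twice, with opposite
    -- signs, since `sg d * sg (d + 1) = -1`.
    have f20 := edge_flip d (0 : Fin 3) 2
    have f21 := edge_flip d (1 : Fin 3) 2
    have f10 := edge_flip d (0 : Fin 3) 1
    have c1 := edge_swap d ((0 : Fin 3), (2 : Fin 3)) (0, 1)
    have c2 := edge_swap d ((1 : Fin 3), (2 : Fin 3)) (0, 1)
    have c3 := edge_swap d ((1 : Fin 3), (2 : Fin 3)) (0, 2)
    simp only [toAlg_act, toAlg_comp, toAlg_gammaBr, map_zero, reconnect_edge, relabel_edge,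
      s0, s1, i0, i1, map_mul, map_add, r0, r1, r2, t0, t1, t2, Finset.sum_pair (show (0 : Fin 3) ≠ 1 by decide),
      Finset.sum_singleton, add_mul, f20, f21, f10, smul_mul_assoc, mul_smul_comm, c1, c2, c3,
      smul_smul, sg_mul_self, sg_add, sg_one, one_smul, mul_neg, mul_one, neg_smul]
    abel)
  poisson := toAlg_injective (by
    have s0 : spread (rfl : 1 + 1 = 2) 1 0 = ({0} : Finset (Fin 3)) := by decide
    have s1 : spread (rfl : 1 + 1 = 2) 1 1 = ({1, 2} : Finset (Fin 3)) := by decide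
    have i0 : inner (rfl : 1 + 1 = 2) 0 0 = (0 : Fin 3) := by decide
    have i1 : inner (rfl : 1 + 1 = 2) 0 1 = (1 : Fin 3) := by decide
    have j0 : inner (rfl : 1 + 1 = 2) 1 0 = (1 : Fin 3) := by decide
    have j1 : inner (rfl : 1 + 1 = 2) 1 1 = (2 : Fin 3) := by decide
    have t1 : (Equiv.swap 0 1 : Equiv.Perm (Fin 3))⁻¹ 1 = 0 := by decide
    have t2 : (Equiv.swap 0 1 : Equiv.Perm (Fin 3))⁻¹ 2 = 2 := by decide
    rw [map_add]
    simp only [toAlg_act, toAlg_comp, toAlg_gammaBr, toAlg_gammaMult, map_one, mul_one, one_mul,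
      reconnect_edge, relabel_edge, s0, s1, i0, i1, j0, j1, t1, t2,
      Finset.sum_pair (show (1 : Fin 3) ≠ 2 by decide), Finset.sum_singleton])

end Gra

end NPOperad

end

/-! ### Moving one input of an operation of `Ger_d` to the outside or to an innermost bracket -/

noncomputable section

namespace NPOperad

/-! ## Block permutations -/

/-- The inputs of a composite are those of the inserted operation and the old ones except `i`. -/
def blockEquiv {p q l : ℕ} (hl : p + q = l) (i : Fin (p + 1)) :
    Fin (q + 1) ⊕ {a : Fin (p + 1) // a ≠ i} ≃ Fin (l + 1) :=
  Equiv.ofBijective (Sum.elim (inner hl i) fun a => outer hl i a) ⟨by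
    rintro (b | ⟨a, ha⟩) (b' | ⟨a', ha'⟩) h
    · exact congrArg Sum.inl (inner_injective hl i h)
    · exact absurd h.symm (outer_ne_inner hl i a' ha' b)
    · exact absurd h (outer_ne_inner hl i a ha b')
    · exact congrArg Sum.inr (Subtype.ext (outer_inj hl i a a' ha ha' h)), fun c => by
    rcases inner_or_outer hl i c with ⟨b, rfl⟩ | ⟨a, ha, rfl⟩
    · exact ⟨.inl b, rfl⟩
    · exact ⟨.inr ⟨a, ha⟩, rfl⟩⟩

@[simp] theorem blockEquiv_symm_inner {p q l : ℕ} (hl : p + q = l) (i : Fin (p + 1))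
    (b : Fin (q + 1)) : (blockEquiv hl i).symm (inner hl i b) = .inl b :=
  (blockEquiv hl i).symm_apply_apply (.inl b)

theorem blockEquiv_symm_outer {p q l : ℕ} (hl : p + q = l) (i a : Fin (p + 1)) (ha : a ≠ i) :
    (blockEquiv hl i).symm (outer hl i a) = .inr ⟨a, ha⟩ :=
  (blockEquiv hl i).symm_apply_apply (.inr ⟨a, ha⟩)

/-- The permutation of the inputs of a composite induced by permutations of the inputs of the outer
and of the inner operation. -/
def blockPerm {p q l : ℕ} (hl : p + q = l) (i : Fin (p + 1)) (σ : Equiv.Perm (Fin (p + 1)))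
    (τ : Equiv.Perm (Fin (q + 1))) : Equiv.Perm (Fin (l + 1)) :=
  ((blockEquiv hl i).symm.trans (Equiv.sumCongr τ (σ.subtypeEquiv fun a => by simp))).trans
    (blockEquiv hl (σ i))

theorem blockPerm_inner {p q l : ℕ} (hl : p + q = l) (i : Fin (p + 1))
    (σ : Equiv.Perm (Fin (p + 1))) (τ : Equiv.Perm (Fin (q + 1))) (b : Fin (q + 1)) :
    blockPerm hl i σ τ (inner hl i b) = inner hl (σ i) (τ b) := by
  simp [blockPerm]; rfl

theorem blockPerm_outer {p q l : ℕ} (hl : p + q = l) (i : Fin (p + 1))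
    (σ : Equiv.Perm (Fin (p + 1))) (τ : Equiv.Perm (Fin (q + 1))) {a : Fin (p + 1)} (ha : a ≠ i) :
    blockPerm hl i σ τ (outer hl i a) = outer hl (σ i) (σ a) := by
  simp [blockPerm, blockEquiv_symm_outer hl i a ha]; rfl

theorem isBlockPerm_blockPerm {p q l : ℕ} (hl : p + q = l) (i : Fin (p + 1))
    (σ : Equiv.Perm (Fin (p + 1))) (τ : Equiv.Perm (Fin (q + 1))) :
    IsBlockPerm hl i σ τ (blockPerm hl i σ τ) :=
  ⟨fun _ ha => blockPerm_outer hl i σ τ ha, blockPerm_inner hl i σ τ⟩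

/-- A permutation of the inputs of a composite which maps the inputs of the inserted operation in
order to such inputs is induced by a permutation of the inputs of the outer operation. -/
theorem exists_isBlockPerm_left {p q l : ℕ} (hl : p + q = l) (i i' : Fin (p + 1))
    (υ : Equiv.Perm (Fin (l + 1))) (h : ∀ b : Fin (q + 1), υ (inner hl i b) = inner hl i' b) :
    ∃ σ : Equiv.Perm (Fin (p + 1)), σ i = i' ∧ IsBlockPerm hl i σ 1 υ := by
  have key : ∀ a, a ≠ i → ∃ a', a' ≠ i' ∧ outer hl i' a' = υ (outer hl i a) := by
    intro a ha
    rcases inner_or_outer hl i' (υ (outer hl i a)) with ⟨b, hb⟩ | h'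
    · rw [← h b] at hb
      exact absurd (υ.injective hb).symm (outer_ne_inner hl i a ha b)
    · exact h'
  choose f hf hf' using key
  let s : Fin (p + 1) → Fin (p + 1) := fun a => if ha : a = i then i' else f a ha
  have hs : Function.Injective s := by
    intro a a' haa'
    simp only [s] at haa'
    split_ifs at haa' with h1 h2 h2
    · rw [h1, h2]
    · exact absurd haa'.symm (hf a' h2)
    · exact absurd haa' (hf a h1)
    · have h3 := congrArg (outer hl i') haa'
      rw [hf', hf'] at h3
      exact outer_inj hl i a a' h1 h2 (υ.injective h3)
  refine ⟨Equiv.ofBijective s (Finite.injective_iff_bijective.1 hs), ?_, fun a ha => ?_,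
    fun b => ?_⟩
  · simp [s]
  · simp [s, ha, hf']
  · simp [s, h]

/-- A permutation of the inputs of a composite which fixes those of the outer operation is induced
by a permutation of the inputs of the inserted operation. -/
theorem exists_isBlockPerm_right {p q l : ℕ} (hl : p + q = l) (i : Fin (p + 1))
    (υ : Equiv.Perm (Fin (l + 1))) (h : ∀ a, a ≠ i → υ (outer hl i a) = outer hl i a) :
    ∃ τ : Equiv.Perm (Fin (q + 1)), IsBlockPerm hl i 1 τ υ := by
  have key : ∀ b, ∃ b', inner hl i b' = υ (inner hl i b) := by
    intro b
    rcases inner_or_outer hl i (υ (inner hl i b)) with h' | ⟨a, ha, hb⟩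
    · exact h'
    · rw [← h a ha] at hb
      exact absurd (υ.injective hb) (outer_ne_inner hl i a ha b)
  choose f hf using key
  have hs : Function.Injective f := by
    intro b b' hbb'
    have h3 := congrArg (inner hl i) hbb'
    rw [hf, hf] at h3
    exact inner_injective hl i (υ.injective h3)
  exact ⟨Equiv.ofBijective f (Finite.injective_iff_bijective.1 hs), fun a ha => by simp [h a ha],
    fun b => by simp [hf]⟩

/-! ## Consequences of the operad laws -/

namespace IsOperad

variable {O : OperadData}

theorem comp_act_left (hO : IsOperad O) {p q l : ℕ} {j k e : ℤ} (hl : p + q = l) (hk : j + k = e) (i : Fin (p + 1))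
    (σ : Equiv.Perm (Fin (p + 1))) (x : O.sp p j) (y : O.sp q k) :
    O.comp hl hk i (O.act σ x) y = O.act (blockPerm hl i σ 1) (O.comp hl hk (σ i) x y) := by
  rw [← hO.equivariant hl hk i σ 1 _ (isBlockPerm_blockPerm hl i σ 1), hO.act_one]

theorem comp_act_right (hO : IsOperad O) {p q l : ℕ} {j k e : ℤ} (hl : p + q = l) (hk : j + k = e) (i : Fin (p + 1))
    (τ : Equiv.Perm (Fin (q + 1))) (x : O.sp p j) (y : O.sp q k) :
    O.comp hl hk i x (O.act τ y) = O.act (blockPerm hl i 1 τ) (O.comp hl hk i x y) := by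
  have h := hO.equivariant hl hk i 1 τ _ (isBlockPerm_blockPerm hl i 1 τ) x y
  rwa [hO.act_one] at h

/-- The parallel law can be read from right to left because its sign squares to one, so the order of
the two insertion points does not matter. -/
theorem par_of_ne (hO : IsOperad O) {p q r pq pr pqr : ℕ} {j k m jk jm jkm : ℤ}
    (h₁ : p + q = pq) (h₂ : pq + r = pqr) (h₃ : p + r = pr) (h₄ : pr + q = pqr)
    (g₁ : j + k = jk) (g₂ : jk + m = jkm) (g₃ : j + m = jm) (g₄ : jm + k = jkm)
    (i a : Fin (p + 1)) (h : i ≠ a) (x : O.sp p j) (y : O.sp q k) (z : O.sp r m) :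
    O.comp h₂ g₂ (outer h₁ i a) (O.comp h₁ g₁ i x y) z
      = sg (k * m) • O.comp h₄ g₄ (outer h₃ a i) (O.comp h₃ g₃ a x z) y := by
  rcases lt_or_gt_of_ne h with h | h
  · exact hO.par h₁ h₂ h₃ h₄ g₁ g₂ g₃ g₄ i a h x y z
  · rw [hO.par h₃ h₄ h₁ h₂ g₃ g₄ g₁ g₂ a i h x z y, mul_comm k m, sg_smul_sg_smul]

end IsOperad

/-! ## Elements of `Ger_d` in which a given input is multiplied or bracketed directly -/

/-- The span of the elements of `Ger_d` in which the input `z` is bracketed with another input, and,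
if `B` holds, of those which are the product of `z` and an operation in the other inputs. -/
inductive InsSpan (d : ℤ) (B : Prop) :
    ∀ {r : ℕ} {k : ℤ}, Fin (r + 1) → (Ger d).sp r k → Prop
  | zero {r : ℕ} {k : ℤ} (z : Fin (r + 1)) : InsSpan d B z (0 : (Ger d).sp r k)
  | add {r : ℕ} {k : ℤ} {z : Fin (r + 1)} {x y : (Ger d).sp r k} :
      InsSpan d B z x → InsSpan d B z y → InsSpan d B z (x + y)
  | one (hB : B) (c : ℝ) (z : Fin 1) : InsSpan d B z (c • (Ger d).one)
  | mul (hB : B) {p l : ℕ} {j e : ℤ} (hl : 1 + p = l) (hk : 0 + j = e) (a : (Ger d).sp p j)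
      (υ : Equiv.Perm (Fin (l + 1))) (z : Fin (l + 1)) (hz : υ z = Fin.last l) :
      InsSpan d B z ((Ger d).act υ ((Ger d).comp hl hk 0 (Ger.mul d) a))
  | br {p l : ℕ} {j e : ℤ} (hl : p + 1 = l) (hk : j + (1 - d) = e) (v : Fin (p + 1))
      (a : (Ger d).sp p j) (υ : Equiv.Perm (Fin (l + 1))) (z : Fin (l + 1))
      (hz : υ z = inner hl v 1) :
      InsSpan d B z ((Ger d).act υ ((Ger d).comp hl hk v a (Ger.br d)))

namespace InsSpan

variable {d : ℤ} {B : Prop}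

theorem smul {r : ℕ} {k : ℤ} {z : Fin (r + 1)} {x : (Ger d).sp r k} (c : ℝ)
    (h : InsSpan d B z x) : InsSpan d B z (c • x) := by
  induction h with
  | zero z => rw [smul_zero]; exact zero z
  | add _ _ hx hy => rw [smul_add]; exact add hx hy
  | one hB c' z => rw [smul_smul]; exact one hB _ z
  | mul hB hl hk a υ z hz =>
    rw [← map_smul, ← map_smul]
    exact mul hB hl hk _ υ z hz
  | br hl hk v a υ z hz =>
    rw [← map_smul, ← LinearMap.smul_apply, ← map_smul]
    exact br hl hk v _ υ z hz

theorem neg {r : ℕ} {k : ℤ} {z : Fin (r + 1)} {x : (Ger d).sp r k}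
    (h : InsSpan d B z x) : InsSpan d B z (-x) := by
  rw [← neg_one_smul ℝ x]
  exact h.smul (-1)

theorem act {r : ℕ} {k : ℤ} (σ : Equiv.Perm (Fin (r + 1))) {z z' : Fin (r + 1)}
    {x : (Ger d).sp r k} (h : InsSpan d B z x) (hz : σ z' = z) :
    InsSpan d B z' ((Ger d).act σ x) := by
  induction h with
  | zero z => rw [map_zero]; exact zero z'
  | add _ _ hx hy => rw [map_add]; exact add (hx σ hz) (hy σ hz)
  | one hB c z =>
    have : Subsingleton (Fin (0 + 1)) := inferInstanceAs (Subsingleton (Fin 1))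
    rw [Subsingleton.elim σ 1, (Ger.isOperad d).act_one]
    exact one hB _ _
  | mul hB hl hk a υ z h =>
    rw [← (Ger.isOperad d).act_mul]
    exact mul hB hl hk a _ z' (by simp [hz, h])
  | br hl hk v a υ z h =>
    rw [← (Ger.isOperad d).act_mul]
    exact br hl hk v a _ z' (by simp [hz, h])

theorem comp_br_one {p l : ℕ} {j e : ℤ} (hl : p + 1 = l) (hk : j + (1 - d) = e) (v : Fin (p + 1))
    (a : (Ger d).sp p j) {z : Fin (l + 1)} (hz : z = inner hl v 1) :
    InsSpan d B z ((Ger d).comp hl hk v a (Ger.br d)) := by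
  rw [← (Ger.isOperad d).act_one ((Ger d).comp hl hk v a (Ger.br d))]
  exact br hl hk v a 1 z hz

theorem zero_or_one : ∀ b : Fin (1 + 1), b = 0 ∨ b = 1 := by decide

theorem br_eq (d : ℤ) : Ger.br d = sg d • (Ger d).act (Equiv.swap 0 1) (Ger.br d) := by
  rw [(Ger.relations d).br_symm, sg_smul_sg_smul]

theorem comp_br_zero {p l : ℕ} {j e : ℤ} (hl : p + 1 = l) (hk : j + (1 - d) = e) (v : Fin (p + 1))
    (a : (Ger d).sp p j) {z : Fin (l + 1)} (hz : z = inner hl v 0) :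
    InsSpan d B z ((Ger d).comp hl hk v a (Ger.br d)) := by
  rw [br_eq, map_smul, (Ger.isOperad d).comp_act_right]
  refine smul _ (br hl hk v a _ z ?_)
  rw [hz, blockPerm_inner]
  simp

theorem comp_mul {p l : ℕ} {j e : ℤ} (hB : B) (hl : 1 + p = l) (hk : 0 + j = e)
    (a : (Ger d).sp p j) {z : Fin (l + 1)} (hz : z = Fin.last l) :
    InsSpan d B z ((Ger d).comp hl hk 0 (Ger.mul d) a) := by
  rw [← (Ger.isOperad d).act_one ((Ger d).comp hl hk 0 (Ger.mul d) a)]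
  exact mul hB hl hk a 1 z hz

/-- By the sequential law, an operation applied outside leaves an innermost bracket in place. The
product alternative is excluded because a product with `z` would end up inside `a` and would first
have to be expanded. -/
theorem comp_right_of_br {p q l : ℕ} {j k e : ℤ} (hl : p + q = l) (hk : j + k = e)
    (i : Fin (p + 1)) (a : (Ger d).sp p j) {z : Fin (q + 1)} {x : (Ger d).sp q k}
    (h : InsSpan d False z x) : InsSpan d B (inner hl i z) ((Ger d).comp hl hk i a x) := by
  induction h with
  | zero z => rw [map_zero]; exact zero _
  | add _ _ hx hy => rw [map_add]; exact add (hx hl hk) (hy hl hk)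
  | one h c z => exact h.elim
  | mul h => exact h.elim
  | @br p' l' j' e' hl' hk' v b υ z hz =>
    rw [(Ger.isOperad d).comp_act_right, ← (Ger.isOperad d).seq (rfl : p + p' = p + p')
      (by omega) hl' hl (rfl : j + j' = j + j') (by omega) hk' hk]
    refine br _ _ _ _ _ _ ?_
    rw [blockPerm_inner, hz]
    exact Fin.ext (by simp [add_assoc])

/-- The bracket of `y` with a further input is a sum of operations obtained from operations by
bracketing one input with the new one. -/
def BrDeriv {r : ℕ} {k : ℤ} (y : (Ger d).sp r k) : Prop :=
  ∀ ⦃l : ℕ⦄ ⦃e : ℤ⦄ (hl : 1 + r = l) (hk : (1 - d) + k = e),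
    InsSpan d False (Fin.last l) ((Ger d).comp hl hk 0 (Ger.br d) y)

/-- Inserting `y` at another input usually leaves the position of `z` intact. The exception is
insertion at the partner of `z` in its bracket; there the bracket of `y` with `z` must be
distributed over the inputs of `y`, which is what `BrDeriv` provides. -/
theorem comp_left {p q l : ℕ} {j k e : ℤ} (hl : p + q = l) (hk : j + k = e)
    {i z : Fin (p + 1)} (hiz : z ≠ i) {x : (Ger d).sp p j} (h : InsSpan d B z x)
    {y : (Ger d).sp q k} (hy : BrDeriv y) :
    InsSpan d B (outer hl i z) ((Ger d).comp hl hk i x y) := by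
  have hO := Ger.isOperad d
  induction h with
  | zero z => rw [map_zero]; exact zero _
  | add _ _ hx hy => rw [map_add]; exact add (hx hl hk hiz) (hy hl hk hiz)
  | one hB c z => exact absurd (Fin.ext (by omega)) hiz
  | @mul hB p' l' j' e' hl' hk' a υ z hz =>
    have hi : υ i ≠ Fin.last l' := fun h => hiz (υ.injective (hz.trans h.symm))
    have hi' : (υ i : ℕ) < l' := Fin.val_lt_last hi
    obtain ⟨c, hc⟩ : ∃ c, υ i = inner hl' 0 c := ⟨⟨υ i, by omega⟩, Fin.ext (by simp)⟩
    rw [hO.comp_act_left, hc, hO.seq hl' hl rfl (by omega) hk' hk rfl (by omega)]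
    refine mul hB _ _ _ _ _ ?_
    rw [blockPerm_outer _ _ _ _ hiz, hz]
    have := outer_val hl (υ i) (Fin.last l')
    refine Fin.ext ?_
    simp only [Fin.val_last] at this ⊢
    omega
  | @br p' l' j' e' hl' hk' v a υ z hz =>
    rw [hO.comp_act_left]
    refine InsSpan.act _ ?_ (blockPerm_outer hl i υ 1 hiz)
    rw [hz]
    -- Either `y` replaces the partner of `z` in the bracket, and the derivation property of `y` is
    -- needed, or it is inserted elsewhere in `a` and the parallel law moves it past the bracket.
    rcases inner_or_outer hl' v (υ i) with ⟨b, hb⟩ | ⟨c, hc, hb⟩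
    · obtain rfl : b = 0 := by
        by_contra hb0
        obtain rfl : b = 1 := (zero_or_one b).resolve_left hb0
        exact hiz (υ.injective (hz.trans hb))
      rw [← hb, hO.seq hl' hl rfl (by omega) hk' hk rfl (by omega)]
      have h1 := comp_right_of_br (B := B) (e := e) (by omega : p' + (1 + q) = l)
        (by omega) v a (hy rfl rfl)
      convert h1 using 1
      have := outer_val hl (inner hl' v 0) (inner hl' v 1)
      refine Fin.ext ?_
      simp only [Fin.val_last, inner_val, Fin.val_zero, Fin.val_one] at this ⊢
      omega
    · rw [← hb, hO.par_of_ne hl' hl rfl (by omega) hk' hk rfl (by omega) v c (Ne.symm hc)]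
      refine smul _ (comp_br_one _ _ _ _ ?_)
      have h1 := outer_val hl (outer hl' v c) (inner hl' v 1)
      have h2 := outer_val hl' v c
      have h3 := outer_val (rfl : p' + q = p' + q) c v
      have h4 : (v : ℕ) ≠ c := fun h => hc (Fin.ext h.symm)
      refine Fin.ext ?_
      simp only [inner_val, Fin.val_one] at h1 h2 h3 ⊢
      omega

/-- Bracketing with an input is a derivation of every operation. For the product this is the Poisson
identity and for the bracket it is the Jacobi identity. A composite is treated by bracketing the
outer operation first, after which `comp_left` distributes the bracket over the inserted one. -/
theorem brDeriv {r : ℕ} {k : ℤ} (y : (Ger d).sp r k) : BrDeriv y := by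
  have hO := Ger.isOperad d
  refine Ger.induction (P := fun {r k} y => BrDeriv y) ?_ ?_ ?_ ?_ ?_ ?_ ?_ ?_ y
  · intro r k l e hl hk
    rw [map_zero]; exact zero _
  · intro r k x y hx hy l e hl hk
    rw [map_add]; exact add (hx hl hk) (hy hl hk)
  · intro r k c x hx l e hl hk
    rw [map_smul]; exact smul c (hx hl hk)
  · intro l e hl hk
    obtain rfl : l = 1 := by omega
    obtain rfl : e = 1 - d := by omega
    rw [hO.comp_one, ← hO.one_comp (Ger.br d)]
    exact comp_br_one _ _ _ _ (by decide)
  · intro l e hl hk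
    obtain rfl : l = 2 := by omega
    obtain rfl : e = 1 - d := by omega
    -- The Poisson identity is stated for a product in the second slot of the bracket, so the two
    -- slots are exchanged first.
    rw [br_eq, map_smul, LinearMap.smul_apply, hO.comp_act_left]
    refine smul _ (InsSpan.act _ (z := 0) ?_ ?_)
    · rw [Equiv.swap_apply_left, (Ger.relations d).poisson]
      refine add (comp_br_zero _ _ _ _ (by decide)) (InsSpan.act _ (z := 1) ?_ (by decide))
      exact comp_br_zero _ _ _ _ (by decide)
    · have h1 : Fin.last 2 = outer hl 0 1 := rfl
      rw [h1, blockPerm_outer _ _ _ _ (by decide), Equiv.swap_apply_left, Equiv.swap_apply_right]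
      rfl
  · intro l e hl hk
    obtain rfl : l = 2 := by omega
    obtain rfl : e = (1 - d) + (1 - d) := by omega
    -- The Jacobi identity is solved for the term in which the last input is in the outer bracket;
    -- in the other two terms it lies in the inner one.
    have h := (Ger.relations d).jacobi
    rw [add_assoc, add_eq_zero_iff_eq_neg] at h
    rw [h]
    refine neg (add (InsSpan.act _ (z := 0) ?_ (by decide)) (InsSpan.act _ (z := 1) ?_ (by decide)))
    · exact comp_br_zero _ _ _ _ (by decide)
    · exact comp_br_one _ _ _ _ (by decide)
  · intro r k σ x hx l e hl hk
    rw [hO.comp_act_right]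
    refine InsSpan.act _ (hx hl hk) ?_
    have h1 : Fin.last l = outer hl 0 1 := Fin.ext (by simp [outer]; omega)
    rw [h1, blockPerm_outer _ _ _ _ (by decide)]
    rfl
  · intro p q l' j k e' hl' hk' i x y hx hy l e hl hk
    rw [← hO.seq (rfl : 1 + p = 1 + p) (by omega) hl' hl rfl (by omega) hk' hk]
    have hne : Fin.last (1 + p) ≠ inner (rfl : 1 + p = 1 + p) 0 i := by
      intro h
      have := congrArg Fin.val h
      simp only [Fin.val_last, inner_val, Fin.val_zero] at this
      omega
    have h1 := comp_left (by omega : (1 + p) + q = l) (by omega : (1 - d + j) + k = e) hne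
      (hx rfl rfl) hy
    convert h1 using 1
    have := outer_val (by omega : (1 + p) + q = l) (inner (rfl : 1 + p = 1 + p) 0 i)
      (Fin.last (1 + p))
    refine Fin.ext ?_
    simp only [Fin.val_last, inner_val, Fin.val_zero] at this ⊢
    omega

/-- Inserting a product of an input and `z` gives an element of the span. -/
def MulIns {r : ℕ} {k : ℤ} (x : (Ger d).sp r k) : Prop :=
  ∀ ⦃l : ℕ⦄ ⦃e : ℤ⦄ (hl : r + 1 = l) (hk : k + 0 = e) (i : Fin (r + 1)),
    InsSpan d True (inner hl i 1) ((Ger d).comp hl hk i x (Ger.mul d))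

/-- When `x` is a product of some `b` with `z`, the product is inserted into `a` before `b` is: the
hypothesis `MulIns` expands the result with respect to `z`, and `comp_left` then allows `b` to be
inserted. When `x` is a multiple of the identity, `z` is just the input `i` of `a`, which explains
the second hypothesis on `a`. -/
theorem comp_right {p q l : ℕ} {j k e : ℤ} (hl : p + q = l) (hk : j + k = e)
    (i : Fin (p + 1)) {a : (Ger d).sp p j} (ha : MulIns a) (ha' : InsSpan d True i a)
    {z : Fin (q + 1)} {x : (Ger d).sp q k}
    (h : InsSpan d True z x) : InsSpan d True (inner hl i z) ((Ger d).comp hl hk i a x) := by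
  have hO := Ger.isOperad d
  induction h with
  | zero z => rw [map_zero]; exact zero _
  | add _ _ hx hy => rw [map_add]; exact add (hx hl hk) (hy hl hk)
  | one h c z =>
    obtain rfl : l = p := by omega
    obtain rfl : e = j := by omega
    rw [map_smul, hO.comp_one]
    have h1 : inner hl i z = i := Fin.ext (by simp)
    rw [h1]
    exact ha'.smul c
  | @mul _ p' l' j' e' hl' hk' b υ z hz =>
    rw [hO.comp_act_right, ← hO.seq (rfl : p + 1 = p + 1) (by omega) hl' hl rfl (by omega) hk' hk]
    have hne : inner (rfl : p + 1 = p + 1) i 1 ≠ inner (rfl : p + 1 = p + 1) i 0 := by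
      intro h
      exact absurd (inner_injective _ _ h) (by decide)
    refine InsSpan.act _ (comp_left _ _ hne (ha _ _ i) (brDeriv b)) ?_
    rw [blockPerm_inner, hz]
    have := outer_val (by omega : (p + 1) + p' = l) (inner (rfl : p + 1 = p + 1) i 0)
      (inner (rfl : p + 1 = p + 1) i 1)
    refine Fin.ext ?_
    simp only [Fin.val_last, inner_val, Fin.val_zero, Fin.val_one, Equiv.Perm.one_apply] at this ⊢
    omega
  | @br p' l' j' e' hl' hk' v b υ z hz =>
    exact comp_right_of_br hl hk i a (br hl' hk' v b υ z hz)

/-- The two claims are proved together: to place an input of `y` in a composite of `x` with `y`, one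
must know how `x` behaves when a product is inserted into it, and to propagate that behaviour to
composites one must know the position of inputs in `x`. On generators only commutativity,
associativity, symmetry and the Poisson identity are needed. -/
theorem mulIns_and_mem {r : ℕ} {k : ℤ} (x : (Ger d).sp r k) :
    MulIns x ∧ ∀ z, InsSpan d True z x := by
  have hO := Ger.isOperad d
  have hR := Ger.relations d
  refine Ger.induction (P := fun {r k} x => MulIns x ∧ ∀ z, InsSpan d True z x)
    ?_ ?_ ?_ ?_ ?_ ?_ ?_ ?_ x
  · refine ⟨fun l e hl hk i => ?_, fun z => zero z⟩
    rw [map_zero]; exact zero _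
  · intro r k x y hx hy
    refine ⟨fun l e hl hk i => ?_, fun z => add (hx.2 z) (hy.2 z)⟩
    rw [map_add]; exact add (hx.1 hl hk i) (hy.1 hl hk i)
  · intro r k c x hx
    refine ⟨fun l e hl hk i => ?_, fun z => smul c (hx.2 z)⟩
    rw [map_smul]; exact smul c (hx.1 hl hk i)
  · refine ⟨fun l e hl hk i => ?_, fun z => ?_⟩
    · obtain rfl : l = 1 := by omega
      obtain rfl : e = 0 := by omega
      obtain rfl : i = 0 := Fin.ext (by omega)
      rw [hO.one_comp, ← hO.comp_one 0 (Ger.mul d)]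
      exact comp_mul trivial _ _ _ rfl
    · rw [← one_smul ℝ (Ger d).one]
      exact one trivial 1 z
  · have h1 : InsSpan d True 1 (Ger.mul d) := by
      rw [← hO.comp_one 0 (Ger.mul d)]
      exact comp_mul trivial _ _ _ rfl
    refine ⟨fun l e hl hk i => ?_, fun z => ?_⟩
    · obtain rfl : l = 2 := by omega
      obtain rfl : e = 0 := by omega
      have hi := zero_or_one i
      rcases hi with rfl | rfl
      -- In this product of three inputs `z` is the middle one. Exchanging it with the third input,
      -- which changes nothing by associativity and commutativity, makes it the outermost factor.
      · have h2 : (Ger d).comp hl hk 0 (Ger.mul d) (Ger.mul d)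
            = (Ger d).act (blockPerm hl 1 1 (Equiv.swap 0 1))
              ((Ger d).comp hl hk 0 (Ger.mul d) (Ger.mul d)) := by
          have h3 := hR.mul_assoc
          rw [h3, ← hO.comp_act_right, hR.mul_comm]
        rw [h2]
        refine mul trivial _ _ _ _ _ ?_
        have h3 : inner hl 0 1 = inner hl 1 0 := rfl
        rw [h3, blockPerm_inner, Equiv.swap_apply_left]
        rfl
      · have h3 := hR.mul_assoc
        rw [← h3]
        exact comp_mul trivial _ _ _ rfl
    · have hz := zero_or_one z
      rcases hz with rfl | rfl
      · rw [← hR.mul_comm]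
        exact InsSpan.act _ h1 (by decide)
      · exact h1
  · have h1 : InsSpan d True 2 ((Ger d).comp (rfl : 1 + 1 = 2) (add_zero (1 - d)) 1 (Ger.br d)
        (Ger.mul d)) := by
      rw [hR.poisson]
      refine add (comp_mul trivial _ _ _ (by decide)) (InsSpan.act _ (z := 2) ?_ (by decide))
      exact comp_br_one _ _ _ _ (by decide)
    refine ⟨fun l e hl hk i => ?_, fun z => ?_⟩
    · obtain rfl : l = 2 := by omega
      obtain rfl : e = 1 - d := by omega
      have hi := zero_or_one i
      rcases hi with rfl | rfl
      · rw [br_eq, map_smul, LinearMap.smul_apply, hO.comp_act_left, Equiv.swap_apply_left]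
        refine smul _ (InsSpan.act _ h1 ?_)
        rw [blockPerm_inner, Equiv.swap_apply_left]
        rfl
      · exact h1
    · have hz := zero_or_one z
      rw [← hO.one_comp (Ger.br d)]
      rcases hz with rfl | rfl
      · exact comp_br_zero _ _ _ _ (by decide)
      · exact comp_br_one _ _ _ _ (by decide)
  · intro r k σ x hx
    refine ⟨fun l e hl hk i => ?_, fun z => InsSpan.act σ (hx.2 (σ z)) rfl⟩
    rw [hO.comp_act_left]
    exact InsSpan.act _ (hx.1 hl hk (σ i)) (blockPerm_inner _ _ _ _ _)
  · intro p q l' j k e' hl' hk' i x y hx hy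
    refine ⟨fun l e hl hk c => ?_, fun z => ?_⟩
    · rcases inner_or_outer hl' i c with ⟨b, rfl⟩ | ⟨c, hc, rfl⟩
      · rw [hO.seq hl' hl rfl (by omega) hk' hk rfl (by omega)]
        have h1 := comp_right (by omega : p + (q + 1) = l) (by omega : j + (k + 0) = e) i hx.1
          (hx.2 i) (hy.1 rfl rfl b)
        convert h1 using 1
        exact Fin.ext (by simp [add_assoc])
      · rw [hO.par_of_ne hl' hl rfl (by omega) hk' hk rfl (by omega) i c (Ne.symm hc)]
        have hne : inner (rfl : p + 1 = p + 1) c 1 ≠ outer (rfl : p + 1 = p + 1) c i :=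
          (outer_ne_inner _ _ _ (Ne.symm hc) _).symm
        have h1 := comp_left (by omega : (p + 1) + q = l) (by omega : (j + 0) + k = e) hne
          (hx.1 rfl rfl c) (brDeriv y)
        refine smul _ ?_
        convert h1 using 1
        have h2 := outer_val (by omega : (p + 1) + q = l) (outer (rfl : p + 1 = p + 1) c i)
          (inner (rfl : p + 1 = p + 1) c 1)
        have h3 := outer_val hl' i c
        have h4 := outer_val (rfl : p + 1 = p + 1) c i
        have h5 : (c : ℕ) ≠ i := fun h => hc (Fin.ext h)
        refine Fin.ext ?_
        simp only [inner_val, Fin.val_one] at h2 ⊢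
        omega
    · rcases inner_or_outer hl' i z with ⟨b, rfl⟩ | ⟨c, hc, rfl⟩
      · exact comp_right hl' hk' i hx.1 (hx.2 i) (hy.2 b)
      · exact comp_left hl' hk' hc (hx.2 c) (brDeriv y)

end InsSpan

end NPOperad

end

/-! ### Normal forms in `Ger_d` and injectivity of `i_d` -/

noncomputable section

namespace NPOperad

/-! ## Normal forms in `Ger_d` -/

/-- The permutation which moves the last input to the position of the input `1` of an operation
with two inputs inserted at `v`, and preserves the order of the other ones. -/
def insPerm {p l : ℕ} (hl : p + 1 = l) (v : Fin (p + 1)) : Equiv.Perm (Fin (l + 1)) :=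
  (finSuccEquivLast (n := l)).trans (finSuccEquiv' (inner hl v (1 : Fin (1 + 1)))).symm

theorem insPerm_last {p l : ℕ} (hl : p + 1 = l) (v : Fin (p + 1)) :
    insPerm hl v (Fin.last l) = inner hl v (1 : Fin (1 + 1)) := by
  simp [insPerm]

theorem insPerm_castSucc {p l : ℕ} (hl : p + 1 = l) (v : Fin (p + 1)) (a : Fin l) :
    (insPerm hl v a.castSucc : ℕ) = if (a : ℕ) ≤ v then (a : ℕ) else a + 1 := by
  simp only [insPerm, Equiv.trans_apply, finSuccEquivLast_castSucc, finSuccEquiv'_symm_some,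
    Fin.succAbove, Fin.lt_def, inner_val, Fin.val_castSucc]
  have h : ((1 : Fin (1 + 1)) : ℕ) = 1 := rfl
  rw [h]
  split_ifs <;> first | rfl | omega

theorem insPerm_castSucc_self {p l : ℕ} (hl : p + 1 = l) (v : Fin (p + 1)) :
    insPerm hl v ⟨v, by omega⟩ = inner hl v (0 : Fin (1 + 1)) := by
  have h := insPerm_castSucc hl v ⟨v, by omega⟩
  refine Fin.ext ?_
  simpa using h

namespace InsSpan

variable {d : ℤ}

/-- A product or a bracket involving the input raises the arity above one, so in arity one the
spanning set leaves only multiples of the identity. This starts the induction on the arity. -/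
theorem exists_eq_smul_one {k : ℤ} (x : (Ger d).sp 0 k) :
    x = 0 ∨ ∃ (h : 0 = k) (c : ℝ), x = c • (h ▸ (Ger d).one) := by
  have key : ∀ {r : ℕ} {k : ℤ} (z : Fin (r + 1)) (x : (Ger d).sp r k), InsSpan d True z x →
      ∀ hr : 0 = r, x = 0 ∨ ∃ (h : 0 = k) (c : ℝ), x = c • (h ▸ hr ▸ (Ger d).one) := by
    intro r k z x h
    induction h with
    | zero z => exact fun _ => .inl rfl
    | add _ _ hx hy =>
      intro hr
      rcases hx hr with rfl | ⟨h, c, rfl⟩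
      · rw [zero_add]; exact hy hr
      · rcases hy hr with rfl | ⟨h', c', rfl⟩
        · rw [add_zero]; exact .inr ⟨h, c, rfl⟩
        · exact .inr ⟨h, c + c', by rw [add_smul]⟩
    | one _ c z => exact fun _ => .inr ⟨rfl, c, rfl⟩
    | mul _ hl => intro hr; omega
    | br hl => intro hr; omega
  exact key 0 x ((mulIns_and_mem x).2 0) rfl

/-- Every operation is the sum of the product of an operation with the last input, and of operations
in which the last input is bracketed with another one. -/
theorem exists_normalForm {p l : ℕ} {e : ℤ} (hl : p + 1 = l) (x : (Ger d).sp l e) :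
    ∃ (a : (Ger d).sp p e) (b : Fin (p + 1) → (Ger d).sp p (e - (1 - d))),
      x = (Ger d).comp (by omega : 1 + p = l) (zero_add e) 0 (Ger.mul d) a
        + ∑ v, (Ger d).act (insPerm hl v)
          ((Ger d).comp hl (sub_add_cancel e (1 - d)) v (b v) (Ger.br d)) := by
  have hO := Ger.isOperad d
  have key : ∀ {l : ℕ} {e : ℤ} (z : Fin (l + 1)) (x : (Ger d).sp l e), InsSpan d True z x →
      ∀ hl : p + 1 = l, z = Fin.last l →
      ∃ (a : (Ger d).sp p e) (b : Fin (p + 1) → (Ger d).sp p (e - (1 - d))),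
      x = (Ger d).comp (by omega : 1 + p = l) (zero_add e) 0 (Ger.mul d) a
        + ∑ v, (Ger d).act (insPerm hl v)
          ((Ger d).comp hl (sub_add_cancel e (1 - d)) v (b v) (Ger.br d)) := by
    intro l e z x h
    induction h with
    | zero z => exact fun hl _ => ⟨0, fun _ => 0, by simp⟩
    | add _ _ hx hy =>
      intro hl hz
      obtain ⟨a, b, rfl⟩ := hx hl hz
      obtain ⟨a', b', rfl⟩ := hy hl hz
      refine ⟨a + a', fun v => b v + b' v, ?_⟩
      simp only [map_add, LinearMap.add_apply, Finset.sum_add_distrib]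
      abel
    | one _ c z => intro hl; omega
    | @mul _ p' l j e hl' hk a υ z hz =>
      intro hl hz'
      obtain rfl : p' = p := by omega
      obtain rfl : e = j := by omega
      -- The permutation fixes the last input, so it only permutes the inputs of `a` and can be
      -- absorbed into `a`.
      obtain ⟨τ, hτ⟩ := exists_isBlockPerm_right hl' 0 υ (by
        intro c hc
        obtain rfl : c = 1 := (zero_or_one c).resolve_left hc
        have h1 : outer hl' 0 1 = Fin.last l := Fin.ext (by simp [outer]; omega)
        rw [h1, ← hz', hz, hz'])
      refine ⟨(Ger d).act τ a, fun _ => 0, ?_⟩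
      have h := hO.equivariant hl' hk 0 1 τ υ hτ (Ger.mul d) a
      rw [hO.act_one] at h
      rw [h]
      simp
    | @br p' l j e hl' hk v a υ z hz =>
      intro hl hz'
      obtain rfl : p' = p := by omega
      obtain rfl : j = e - (1 - d) := by omega
      -- This is the input bracketed with the last one; the family `b` will be concentrated at it.
      set u' := υ.symm (inner hl' v 0) with hu'
      have hu1 : υ u' = inner hl' v 0 := by simp [u']
      have hne : u' ≠ Fin.last l := by
        intro h
        rw [h, ← hz', hz] at hu1
        exact absurd (inner_injective _ _ hu1) (by decide)
      have hlt : (u' : ℕ) < l := Fin.val_lt_last hne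
      -- Once the standard permutation `insPerm` is divided out, the bracketed pair at `u'` goes in
      -- order to the pair at `v`. What remains comes from a permutation of the inputs of `a`, which
      -- is absorbed into `a`.
      obtain ⟨τ, hτ, hβ⟩ := exists_isBlockPerm_left (q := 1) hl' ⟨u', by omega⟩ v
        (υ * (insPerm hl ⟨u', by omega⟩)⁻¹) (by
          intro c
          rcases zero_or_one c with rfl | rfl
          · rw [← insPerm_castSucc_self hl, Equiv.Perm.mul_apply, Equiv.Perm.inv_def, Equiv.symm_apply_apply]
            exact hu1
          · rw [← insPerm_last hl, Equiv.Perm.mul_apply, Equiv.Perm.inv_def, Equiv.symm_apply_apply, ← hz', hz])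
      refine ⟨0, Pi.single ⟨u', by omega⟩ ((Ger d).act τ a), ?_⟩
      rw [Finset.sum_eq_single (⟨u', by omega⟩ : Fin (p' + 1))
        (fun w _ hw => by simp [Pi.single_eq_of_ne hw]) (fun h => absurd (Finset.mem_univ _) h),
        Pi.single_eq_same]
      have h := hO.equivariant hl' hk ⟨u', by omega⟩ τ 1 _ hβ a (Ger.br d)
      rw [hO.act_one, hτ] at h
      rw [h, ← hO.act_mul, map_zero, zero_add, inv_mul_cancel_right]
  exact key _ x ((mulIns_and_mem x).2 (Fin.last l)) hl rfl

end InsSpan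

/-! ## The embedding of `Ger_d` into `Gra_d` -/

theorem GraAlg.induction {d : ℤ} {N : ℕ} {P : GraAlg d N → Prop}
    (algebraMap : ∀ r, P (algebraMap ℝ _ r)) (edge : ∀ e, P (GraAlg.edge d e))
    (mul : ∀ x y, P x → P y → P (x * y)) (add : ∀ x y, P x → P y → P (x + y))
    (x : GraAlg d N) : P x := by
  obtain ⟨x, rfl⟩ := RingQuot.mkAlgHom_surjective ℝ (GraRel d N) x
  induction x using FreeAlgebra.induction with
  | grade0 r => rw [AlgHom.commutes]; exact algebraMap r
  | grade1 e => exact edge e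
  | mul x y hx hy => rw [map_mul]; exact mul _ _ hx hy
  | add x y hx hy => rw [map_add]; exact add _ _ hx hy

namespace GraAlg

variable {d : ℤ}

/-- The map to graphs without the last vertex, sending to zero the graphs in which the last vertex
has an edge. -/
def dropLast (d : ℤ) (N : ℕ) : GraAlg d (N + 1) →ₐ[ℝ] GraAlg d N :=
  reconnect d fun x => Finset.univ.filter fun a => a.castSucc = x

theorem dropLast_edge {N : ℕ} (a b : Fin N) :
    dropLast d N (edge d (a.castSucc, b.castSucc)) = edge d (a, b) := by
  have h : ∀ a : Fin N, (Finset.univ.filter fun b : Fin N => b.castSucc = a.castSucc) = {a} := by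
    intro a; ext b; simp
  rw [dropLast, reconnect_edge, h, h, Finset.sum_singleton, Finset.sum_singleton]

theorem dropLast_edge_left {N : ℕ} (x : Fin (N + 1)) :
    dropLast d N (edge d (Fin.last N, x)) = 0 := by
  have h : (Finset.univ.filter fun b : Fin N => b.castSucc = Fin.last N) = ∅ := by
    ext b; simp [Fin.castSucc_ne_last]
  rw [dropLast, reconnect_edge, h, Finset.sum_empty]

theorem dropLast_edge_right {N : ℕ} (x : Fin (N + 1)) :
    dropLast d N (edge d (x, Fin.last N)) = 0 := by
  rw [edge_flip, map_smul, dropLast_edge_left, smul_zero]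

/-- The value on an edge of the map `leaf`. -/
def leafEdge (d : ℤ) {N : ℕ} (v : Fin N) (e : Fin (N + 1) × Fin (N + 1)) :
    Matrix (Fin 2) (Fin 2) (GraAlg d N) :=
  !![dropLast d N (edge d e),
      if e = (v.castSucc, Fin.last N) then 1 else if e = (Fin.last N, v.castSucc) then sg d • 1
        else 0;
    0, sg (d + 1) • dropLast d N (edge d e)]

theorem leafEdge_flip {N : ℕ} (v : Fin N) (a b : Fin (N + 1)) :
    leafEdge d v (b, a) = sg d • leafEdge d v (a, b) := by
  have hv := Fin.castSucc_ne_last v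
  ext i j
  fin_cases i <;> fin_cases j
  · simp [leafEdge, edge_flip d a b]
  · change (if (b, a) = (v.castSucc, Fin.last N) then (1 : GraAlg d N)
        else if (b, a) = (Fin.last N, v.castSucc) then sg d • 1 else 0)
      = sg d • (if (a, b) = (v.castSucc, Fin.last N) then (1 : GraAlg d N)
        else if (a, b) = (Fin.last N, v.castSucc) then sg d • 1 else 0)
    simp only [Prod.mk.injEq]
    by_cases h1 : b = v.castSucc ∧ a = Fin.last N
    · obtain ⟨rfl, rfl⟩ := h1
      simp only [hv, hv.symm, and_self, if_true, if_false, smul_smul, sg_mul_self, one_smul]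
    · by_cases h2 : b = Fin.last N ∧ a = v.castSucc
      · obtain ⟨rfl, rfl⟩ := h2
        rw [if_neg fun h => hv h.1.symm, if_pos ⟨rfl, rfl⟩, if_pos ⟨rfl, rfl⟩]
      · rw [if_neg h1, if_neg h2, if_neg (fun h => h2 h.symm), if_neg (fun h => h1 h.symm),
          smul_zero]
  · simp [leafEdge]
  · change sg (d + 1) • dropLast d N (edge d (b, a))
      = sg d • sg (d + 1) • dropLast d N (edge d (a, b))
    rw [edge_flip, map_smul, smul_smul, smul_smul, mul_comm]

/-- For upper triangular matrices, multiplicativity turns the upper right entry into a twisted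
derivation over `dropLast`. Its values on edges are scalars and commute with everything; the factor
`(-1)^(d+1)` in the lower right corner, which is the price of passing an edge, makes the cross terms
match after the exchange. -/
theorem leafEdge_swap {N : ℕ} (v : Fin N) (e e' : Fin (N + 1) × Fin (N + 1)) :
    leafEdge d v e' * leafEdge d v e = sg (d + 1) • (leafEdge d v e * leafEdge d v e') := by
  have hs := congrArg (dropLast d N) (edge_swap d e e')
  simp only [map_mul, map_smul] at hs
  have hc : ∀ (e : Fin (N + 1) × Fin (N + 1)) (x : GraAlg d N),
      leafEdge d v e 0 1 * x = x * leafEdge d v e 0 1 := by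
    intro e x
    simp only [leafEdge, Matrix.of_apply, Matrix.cons_val', Matrix.cons_val_zero,
      Matrix.cons_val_one, Matrix.cons_val_fin_one]
    split_ifs <;> simp
  have h00 : ∀ e, leafEdge d v e 0 0 = dropLast d N (edge d e) := fun _ => rfl
  have h10 : ∀ e, leafEdge d v e 1 0 = 0 := fun _ => rfl
  have h11 : ∀ e, leafEdge d v e 1 1 = sg (d + 1) • dropLast d N (edge d e) := fun _ => rfl
  ext i j
  fin_cases i <;> fin_cases j
  · simp [Matrix.mul_apply, Fin.sum_univ_two, h00, h10, hs]
  · simp only [Fin.zero_eta, Fin.mk_one, Matrix.mul_apply, Fin.sum_univ_two, h00, h11, hc,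
      Matrix.smul_apply, smul_add, smul_mul_assoc]
    rw [add_comm, smul_smul (sg (d + 1)) (sg (d + 1)), sg_mul_self, one_smul]
  · simp [Matrix.mul_apply, Fin.sum_univ_two, h10]
  · simp [Matrix.mul_apply, Fin.sum_univ_two, h10, h11, hs]

/-- A map whose upper right entry keeps the graphs in which the last vertex has a single edge, which
connects it to `v`, and removes this edge. -/
def leaf (d : ℤ) {N : ℕ} (v : Fin N) :
    GraAlg d (N + 1) →ₐ[ℝ] Matrix (Fin 2) (Fin 2) (GraAlg d N) :=
  GraAlg.lift d (leafEdge d v) (leafEdge_flip v) (leafEdge_swap v)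

theorem leaf_zero_zero {N : ℕ} (v : Fin N) (x : GraAlg d (N + 1)) :
    leaf d v x 0 0 = dropLast d N x ∧ leaf d v x 1 0 = 0 := by
  induction x using GraAlg.induction with
  | algebraMap r => simp [Matrix.algebraMap_matrix_apply]
  | edge e => rw [leaf, lift_edge]; exact ⟨rfl, rfl⟩
  | mul x y hx hy =>
    simp [Matrix.mul_apply, Fin.sum_univ_two, hx.1, hx.2, hy.1, hy.2]
  | add x y hx hy => simp [hx.1, hx.2, hy.1, hy.2]

/-- The edge touches the last vertex, so `dropLast` kills it, and of the two terms of the twisted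
Leibniz rule only the one cutting this very edge survives. -/
theorem leaf_mul_edge {N : ℕ} (v u : Fin N) (x : GraAlg d (N + 1)) :
    leaf d v (x * edge d (u.castSucc, Fin.last N)) 0 1 = if u = v then dropLast d N x else 0 := by
  have h : leaf d v (edge d (u.castSucc, Fin.last N)) = leafEdge d v (u.castSucc, Fin.last N) :=
    lift_edge ..
  rw [map_mul, Matrix.mul_apply, Fin.sum_univ_two, (leaf_zero_zero v x).1, h]
  have h1 : leafEdge d v (u.castSucc, Fin.last N) 1 1 = 0 := by
    simp [leafEdge, dropLast_edge_right]
  rw [h1, mul_zero, add_zero]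
  by_cases huv : u = v
  · simp [leafEdge, huv]
  · simp [leafEdge, huv, Fin.castSucc_ne_last]

end GraAlg

open GraAlg

namespace Gra

variable (d : ℤ)

/-- The morphism `i_d`. -/
def ofGer : OperadHom (Ger d) (Gra d) := Ger.lift (Gra.isOperad d) (Gra.relations d)

theorem ofGer_mul : (ofGer d).map (Ger.mul d) = gammaMult d := Ger.lift_mul _ _

theorem ofGer_br : (ofGer d).map (Ger.br d) = gammaBr d := Ger.lift_br _ _

variable {d}

theorem toAlg_mult_comp {p : ℕ} {e : ℤ} (h : 1 + p = p + 1) (a : (Gra d).sp p e) :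
    toAlg ((Gra d).comp h (zero_add e) 0 (gammaMult d) a) = relabel d Fin.castSucc (toAlg a) := by
  rw [toAlg_comp, toAlg_gammaMult, map_one, one_mul]
  congr 2
  funext b
  exact Fin.ext (by simp)

/-- With the standard permutation `insPerm`, the edge created by the bracket runs exactly from `v`
to the last vertex and stands at the end of the product, ready to be cut by `leaf`. -/
theorem toAlg_act_comp_br {p : ℕ} {j e : ℤ} (hk : j + (1 - d) = e) (v : Fin (p + 1))
    (b : (Gra d).sp p j) :
    toAlg ((Gra d).act (insPerm rfl v) ((Gra d).comp rfl hk v b (gammaBr d)))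
      = relabel d ⇑(insPerm rfl v)⁻¹ (reconnect d (spread rfl v) (toAlg b))
        * edge d (v.castSucc, Fin.last (p + 1)) := by
  rw [toAlg_act, toAlg_comp, toAlg_gammaBr, map_mul, relabel_edge, relabel_edge]
  congr 3
  · rw [Equiv.Perm.inv_eq_iff_eq]
    exact (insPerm_castSucc_self rfl v).symm
  · rw [Equiv.Perm.inv_eq_iff_eq]
    exact (insPerm_last rfl v).symm

theorem dropLast_castSucc {N : ℕ} (x : GraAlg d N) :
    dropLast d N (relabel d Fin.castSucc x) = x := by
  have : (dropLast d N).comp (relabel d Fin.castSucc) = AlgHom.id ℝ _ :=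
    algHom_ext fun ⟨a, b⟩ => by simp [relabel_edge, dropLast_edge]
  exact DFunLike.congr_fun this x

/-- Inserting the bracket at `v` spreads the edge ends at `v` over `v` and the last vertex.
Discarding every graph with an end at the last vertex leaves one choice for each end, and this
choice gives back the original graph. -/
theorem dropLast_relabel_reconnect {p : ℕ} (v : Fin (p + 1)) (x : GraAlg d (p + 1)) :
    dropLast d (p + 1) (relabel d ⇑(insPerm rfl v)⁻¹ (reconnect d (spread rfl v) x)) = x := by
  have h1 : ∀ a : Fin (p + 1), insPerm rfl v a.castSucc ∈ spread rfl v a := by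
    intro a
    rw [mem_spread_iff, insPerm_castSucc]
    split_ifs <;> omega
  rw [dropLast, relabel, reconnect_reconnect
    (H := fun x => Finset.univ.filter fun a => insPerm rfl v a.castSucc = x)]
  · rw [reconnect_reconnect (H := fun x => {x})]
    · exact reconnect_id (fun _ => rfl) x
    · rintro u u' a hu hu'
      simp only [Finset.mem_filter, Finset.mem_univ, true_and] at hu hu'
      rw [← hu, hu']
    · intro u a
      rw [Finset.mem_singleton]
      constructor
      · rintro rfl
        exact ⟨_, h1 a, by simp⟩
      · rintro ⟨w, hw, ha⟩
        simp only [Finset.mem_filter, Finset.mem_univ, true_and] at ha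
        rw [← ha] at hw
        exact spread_disjoint _ _ _ _ _ (h1 a) hw
  · rintro u u' a hu hu'
    simp only [Finset.mem_filter, Finset.mem_univ, true_and] at hu hu'
    rw [← hu, hu']
  · intro w a
    simp only [Finset.mem_filter, Finset.mem_univ, true_and, Finset.mem_singleton, 
      Equiv.Perm.eq_inv_iff_eq, exists_eq_right']

/-- In the normal form of `x`, the components `a` and `b v` have one input fewer. Linear maps on
graphs extract their images from the image of `x`, so the induction on the arity applies to each of
them. -/
theorem ofGer_injective {r : ℕ} {k : ℤ} :
    Function.Injective ((ofGer d).map (r := r) (k := k)) := by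
  induction r generalizing k with
  | zero =>
    refine (injective_iff_map_eq_zero _).2 fun x hx => ?_
    rcases InsSpan.exists_eq_smul_one x with rfl | ⟨rfl, c, rfl⟩
    · rfl
    · rw [map_smul, (ofGer d).map_one] at hx
      -- The augmentation that kills all edges shows that the edgeless graph is nonzero and reads
      -- off the coefficient.
      have h := congrArg (fun y => GraAlg.lift d (fun _ => (0 : ℝ)) (by simp) (by simp)
        (toAlg y)) hx
      simp only [map_smul, toAlg_one, map_one, map_zero, smul_eq_mul, mul_one] at h
      rw [h, zero_smul]
  | succ p ih =>
    refine (injective_iff_map_eq_zero _).2 fun x hx => ?_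
    obtain ⟨a, b, rfl⟩ := InsSpan.exists_normalForm rfl x
    have hx' := congrArg toAlg hx
    simp only [map_add, map_sum, map_zero, (ofGer d).map_act, (ofGer d).map_comp, ofGer_mul,
      ofGer_br] at hx'
    rw [toAlg_mult_comp] at hx'
    simp only [toAlg_act_comp_br] at hx'
    -- Every bracket term contains an edge at the last vertex and is killed by `dropLast`, so only
    -- the image of `a` is left.
    have ha : a = 0 := by
      have h := congrArg (dropLast d (p + 1)) hx'
      simp only [map_add, map_sum, map_mul, dropLast_edge_right, mul_zero,
        Finset.sum_const_zero, add_zero, dropLast_castSucc, map_zero] at h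
      rw [← map_zero toAlg] at h
      have h' := toAlg_injective h
      rw [← map_zero (ofGer d).map] at h'
      exact ih h'
    -- With `a` gone, `leaf d v` annihilates the terms whose final edge starts at a vertex other
    -- than `v`, and from the remaining term it returns the image of `b v`.
    have hb : ∀ v, b v = 0 := by
      intro v
      have h := congrArg (fun y => leaf d v y 0 1) hx'
      simp only [ha, map_zero, zero_add, map_sum, Matrix.sum_apply, leaf_mul_edge,
        dropLast_relabel_reconnect, Matrix.zero_apply] at h
      rw [Finset.sum_ite_eq' , if_pos (Finset.mem_univ _)] at h
      rw [← map_zero toAlg] at h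
      have h' := toAlg_injective h
      rw [← map_zero (ofGer d).map] at h'
      exact ih h'
    simp [ha, hb]

end Gra

end NPOperad

end

/-! ### Koszul signs and the endomorphism operad -/

noncomputable section

namespace NPOperad

/-! ## Koszul signs -/

/-- The product of `F u v` over the pairs `u < v`. -/
def pairProd {N : ℕ} (F : Fin N → Fin N → ℝ) : ℝ := ∏ u, ∏ v, if u < v then F u v else 1

theorem pairProd_eq_prod_filter {N : ℕ} (F : Fin N → Fin N → ℝ) :
    pairProd F = ∏ x : Fin N × Fin N with x.1 < x.2, F x.1 x.2 := by
  rw [pairProd, ← Finset.prod_product', Finset.prod_filter]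
  rfl

theorem pairProd_mul {N : ℕ} (F G : Fin N → Fin N → ℝ) :
    pairProd (fun u v => F u v * G u v) = pairProd F * pairProd G := by
  simp only [pairProd_eq_prod_filter, Finset.prod_mul_distrib]

theorem pairProd_congr {N : ℕ} {F G : Fin N → Fin N → ℝ} (h : ∀ u v, u < v → F u v = G u v) :
    pairProd F = pairProd G := by
  simp only [pairProd]
  refine Finset.prod_congr rfl fun u _ => Finset.prod_congr rfl fun v _ => ?_
  split_ifs with huv
  · exact h u v huv
  · rfl

/-- For a symmetric function the product runs over unordered pairs, which a permutation merely
rearranges. -/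
theorem pairProd_comp {N : ℕ} (F : Fin N → Fin N → ℝ) (hF : ∀ u v, F u v = F v u)
    (τ : Equiv.Perm (Fin N)) : pairProd (fun u v => F (τ u) (τ v)) = pairProd F := by
  simp only [pairProd_eq_prod_filter]
  refine Finset.prod_bij'
    (fun x _ => if τ x.1 < τ x.2 then (τ x.1, τ x.2) else (τ x.2, τ x.1))
    (fun x _ => if τ⁻¹ x.1 < τ⁻¹ x.2 then (τ⁻¹ x.1, τ⁻¹ x.2) else (τ⁻¹ x.2, τ⁻¹ x.1))
    ?_ ?_ ?_ ?_ ?_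
  · rintro ⟨u, v⟩ h
    simp only [Finset.mem_filter, Finset.mem_univ, true_and] at h ⊢
    split_ifs with h1
    · exact h1
    · exact lt_of_le_of_ne (not_lt.1 h1) fun h2 => h.ne' (τ.injective h2)
  · rintro ⟨u, v⟩ h
    simp only [Finset.mem_filter, Finset.mem_univ, true_and] at h ⊢
    split_ifs with h1
    · exact h1
    · exact lt_of_le_of_ne (not_lt.1 h1) fun h2 => h.ne' (τ⁻¹.injective h2)
  · rintro ⟨u, v⟩ h
    simp only [Finset.mem_filter, Finset.mem_univ, true_and] at h
    by_cases h1 : τ u < τ v <;> simp [h1, h, h.not_gt]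
  · rintro ⟨u, v⟩ h
    simp only [Finset.mem_filter, Finset.mem_univ, true_and] at h
    by_cases h1 : τ.symm u < τ.symm v <;> simp [h1, h, h.not_gt]
  · rintro ⟨u, v⟩ h
    simp only
    split_ifs
    · rfl
    · exact hF _ _

/-- The Koszul sign of the rearrangement of homogeneous elements of degrees `k` by a permutation. -/
def kz {N : ℕ} (σ : Equiv.Perm (Fin N)) (k : Fin N → ℤ) : ℝ :=
  pairProd fun u v => if (u < v ↔ σ u < σ v) then 1 else sg (k u * k v)

theorem kz_factor_symm {N : ℕ} (σ : Equiv.Perm (Fin N)) (k : Fin N → ℤ) (u v : Fin N) :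
    (if (u < v ↔ σ u < σ v) then 1 else sg (k u * k v))
      = if (v < u ↔ σ v < σ u) then 1 else sg (k v * k u) := by
  rw [mul_comm]
  have h : (u < v ↔ σ u < σ v) ↔ (v < u ↔ σ v < σ u) := by
    by_cases h : u = v
    · simp [h]
    · have h' : σ u ≠ σ v := fun h' => h (σ.injective h')
      rcases lt_or_gt_of_ne h with h1 | h1 <;> rcases lt_or_gt_of_ne h' with h2 | h2 <;>
        simp [h1, h2, h1.not_gt, h2.not_gt]
  simp only [h]

/-- One sign is a product over pairs of new positions, the other over pairs of elements. Reindexing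
by the permutation identifies them, since each factor depends only on parities and on whether the
pair is inverted. -/
theorem koszul_eq_kz {N : ℕ} (σ : Equiv.Perm (Fin N)) (k : Fin N → ℤ) :
    koszul σ (fun a => decide (Odd (k a))) = kz σ k := by
  rw [koszul, kz, ← pairProd_comp _ (kz_factor_symm σ k) σ⁻¹, pairProd, ← Finset.prod_product']
  refine Finset.prod_congr rfl fun x _ => ?_
  obtain ⟨u, v⟩ := x
  simp only [Equiv.Perm.inv_def, Equiv.apply_symm_apply, decide_eq_true_eq]
  by_cases h : u < v
  · by_cases h' : σ.symm v < σ.symm u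
    · simp only [h, h', h'.not_gt, true_and, if_true, iff_true, if_false]
      rw [sg_mul]
      by_cases h1 : Odd (k (σ.symm u)) <;> by_cases h2 : Odd (k (σ.symm v)) <;>
        simp_all [sg, ← Int.not_odd_iff_even]
    · have h1 : σ.symm u < σ.symm v :=
        lt_of_le_of_ne (not_lt.1 h') fun h2 => h.ne (σ.symm.injective h2)
      simp only [h, h', h1, true_and, false_and, if_true, if_false]
  · simp [h]

theorem kz_one {N : ℕ} (k : Fin N → ℤ) : kz 1 k = 1 := by
  simp [kz, pairProd]

/-- A pair is inverted by the composite exactly when one and only one of the two successive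
permutations inverts it, and its sign squares to one. -/
theorem kz_mul {N : ℕ} (σ τ : Equiv.Perm (Fin N)) (k : Fin N → ℤ) :
    kz (σ * τ) k = kz τ k * kz σ (fun a => k (τ⁻¹ a)) := by
  rw [kz, kz, kz, ← pairProd_comp _ (kz_factor_symm σ fun a => k (τ⁻¹ a)) τ, ← pairProd_mul]
  refine pairProd_congr fun u v huv => ?_
  simp only [Equiv.Perm.mul_apply, Equiv.Perm.inv_def, Equiv.symm_apply_apply, huv, true_iff]
  by_cases h1 : τ u < τ v <;> by_cases h2 : σ (τ u) < σ (τ v) <;> simp [h1, h2]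

/-- Change of a Koszul sign under a change of degree of one element. -/
theorem kz_update {N : ℕ} (σ : Equiv.Perm (Fin N)) (k k' : Fin N → ℤ) (i : Fin N) (e : ℤ)
    (hi : k' i = k i + e) (hk : ∀ a, a ≠ i → k' a = k a) :
    kz σ k' = kz σ k * (∏ a, if a < i then sg (e * k a) else 1)
      * ∏ a, if σ a < σ i then sg (e * k a) else 1 := by
  have h1 : kz σ k' = kz σ k * pairProd (fun u v =>
      (if u = i then if (i < v ↔ σ i < σ v) then 1 else sg (e * k v) else 1)
        * (if v = i then if (u < i ↔ σ u < σ i) then 1 else sg (e * k u) else 1)) := by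
    rw [kz, kz, ← pairProd_mul]
    refine pairProd_congr fun u v huv => ?_
    by_cases hu : u = i
    · subst hu
      simp only [if_true, huv.ne', if_false, mul_one, hi, hk v huv.ne', add_mul, sg_add]
      split_ifs <;> simp
    · by_cases hv : v = i
      · subst hv
        simp only [if_true, huv.ne, if_false, one_mul, hi, hk u huv.ne, mul_add, sg_add,
          mul_comm e]
        split_ifs <;> simp
      · simp only [hu, hv, if_false, mul_one, hk u hu, hk v hv]
  rw [h1, mul_assoc, pairProd_mul]
  congr 1
  have h2 : pairProd (fun u v => if u = i then
      if (i < v ↔ σ i < σ v) then 1 else sg (e * k v) else 1)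
      = ∏ a, if i < a then if (i < a ↔ σ i < σ a) then 1 else sg (e * k a) else 1 := by
    rw [pairProd, Finset.prod_eq_single i]
    · simp
    · intro u _ hu; simp [hu]
    · intro h; exact absurd (Finset.mem_univ i) h
  have h3 : pairProd (fun u v => if v = i then
      if (u < i ↔ σ u < σ i) then 1 else sg (e * k u) else 1)
      = ∏ a, if a < i then if (a < i ↔ σ a < σ i) then 1 else sg (e * k a) else 1 := by
    rw [pairProd]
    refine Finset.prod_congr rfl fun u _ => ?_
    rw [Finset.prod_eq_single i]
    · simp
    · intro v _ hv; simp [hv]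
    · intro h; exact absurd (Finset.mem_univ i) h
  rw [h2, h3, ← Finset.prod_mul_distrib, ← Finset.prod_mul_distrib]
  refine Finset.prod_congr rfl fun a _ => ?_
  -- Only pairs containing `i` change. The pair formed by `a` and `i` is inverted exactly when one
  -- of `a < i` and `σ a < σ i` holds without the other, which splits its contribution into the two
  -- stated products.
  rcases lt_trichotomy a i with h | rfl | h
  · by_cases h' : σ a < σ i <;> simp [h, h', h.not_gt]
  · simp
  · have h4 : σ a ≠ σ i := fun h4 => h.ne' (σ.injective h4)
    rcases lt_or_gt_of_ne h4 with h' | h' <;> simp [h, h', h.not_gt, h'.not_gt]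

theorem prod_eq_prod_spread {p q l : ℕ} (hl : p + q = l) (i : Fin (p + 1)) {M : Type*}
    [CommMonoid M] (g : Fin (l + 1) → M) : ∏ c, g c = ∏ a, ∏ c ∈ spread hl i a, g c := by
  rw [← Finset.prod_biUnion]
  · refine Finset.prod_congr (Finset.ext fun c => ?_) fun _ _ => rfl
    simp only [Finset.mem_univ, Finset.mem_biUnion, true_and, true_iff, mem_spread]
    rcases inner_or_outer hl i c with ⟨b, rfl⟩ | ⟨a, ha, rfl⟩
    · exact ⟨i, .inl ⟨rfl, b, rfl⟩⟩
    · exact ⟨a, .inr ⟨ha, rfl⟩⟩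
  · intro a _ a' _ haa'
    refine Finset.disjoint_left.2 fun c hc hc' => haa' ?_
    exact Gra.spread_disjoint hl i a a' c hc hc'

theorem spread_lt_iff {p q l : ℕ} (hl : p + q = l) (i : Fin (p + 1)) {a a' : Fin (p + 1)}
    {c c' : Fin (l + 1)} (hc : c ∈ spread hl i a) (hc' : c' ∈ spread hl i a') (h : a ≠ a') :
    c < c' ↔ a < a' := by
  rw [mem_spread_iff] at hc hc'
  have h' : (a : ℕ) ≠ a' := fun h' => h (Fin.ext h')
  rw [Fin.lt_def, Fin.lt_def]
  omega

theorem spread_self {p q l : ℕ} (hl : p + q = l) (i : Fin (p + 1)) :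
    spread hl i i = Finset.univ.image (inner hl i) := by simp [spread]

theorem spread_of_ne {p q l : ℕ} (hl : p + q = l) {i a : Fin (p + 1)} (h : a ≠ i) :
    spread hl i a = {outer hl i a} := by simp [spread, h]

theorem IsBlockPerm.mem_spread {p q l : ℕ} {hl : p + q = l} {i : Fin (p + 1)}
    {σ : Equiv.Perm (Fin (p + 1))} {τ : Equiv.Perm (Fin (q + 1))} {υ : Equiv.Perm (Fin (l + 1))}
    (h : IsBlockPerm hl i σ τ υ) {a : Fin (p + 1)} {c : Fin (l + 1)} (hc : c ∈ spread hl i a) :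
    υ c ∈ spread hl (σ i) (σ a) := by
  rw [NPOperad.mem_spread] at hc ⊢
  rcases hc with ⟨rfl, b, rfl⟩ | ⟨ha, rfl⟩
  · exact .inl ⟨rfl, τ b, (h.2 b).symm⟩
  · exact .inr ⟨fun h' => ha (σ.injective h'), (h.1 a ha).symm⟩

theorem inner_lt_inner {p q l : ℕ} (hl : p + q = l) (i : Fin (p + 1)) (b b' : Fin (q + 1)) :
    inner hl i b < inner hl i b' ↔ b < b' := by
  rw [Fin.lt_def, Fin.lt_def, inner_val, inner_val]; omega

/-- The Koszul sign of a block permutation. -/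
theorem kz_block {p q l : ℕ} {hl : p + q = l} {i : Fin (p + 1)}
    {σ : Equiv.Perm (Fin (p + 1))} {τ : Equiv.Perm (Fin (q + 1))} {υ : Equiv.Perm (Fin (l + 1))}
    (h : IsBlockPerm hl i σ τ υ) (k : Fin (l + 1) → ℤ) :
    kz υ k = kz τ (fun b => k (inner hl i b)) * kz σ (fun a => ∑ c ∈ spread hl i a, k c) := by
  have h1 : kz υ k = ∏ a, ∏ a', ∏ c ∈ spread hl i a, ∏ c' ∈ spread hl i a',
      if c < c' then (if (c < c' ↔ υ c < υ c') then 1 else sg (k c * k c')) else 1 := by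
    rw [kz, pairProd, prod_eq_prod_spread hl i]
    refine Finset.prod_congr rfl fun a _ => ?_
    refine (Finset.prod_congr rfl fun c _ => prod_eq_prod_spread hl i _).trans ?_
    rw [Finset.prod_comm]
  have h2 : kz τ (fun b => k (inner hl i b)) = ∏ a, ∏ a', if a = i ∧ a' = i then
      kz τ (fun b => k (inner hl i b)) else 1 := by
    rw [Finset.prod_eq_single i, Finset.prod_eq_single i]
    · simp
    · intro a _ ha; simp [ha]
    · intro h; exact absurd (Finset.mem_univ i) h
    · intro a _ ha; simp [ha]
    · intro h; exact absurd (Finset.mem_univ i) h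
  have h0 := kz.eq_def σ fun a => ∑ c ∈ spread hl i a, k c
  rw [h1, h2, h0, pairProd, ← Finset.prod_mul_distrib]
  refine Finset.prod_congr rfl fun a _ => ?_
  rw [← Finset.prod_mul_distrib]
  refine Finset.prod_congr rfl fun a' _ => ?_
  -- Pairs within the block at `i` produce the sign of `τ`, and all other blocks are single
  -- elements. Two elements of different blocks are ordered as their blocks are, so their signs
  -- multiply to one with the summed degrees in its exponent.
  by_cases haa' : a = a'
  · subst haa'
    by_cases ha : a = i
    · subst ha
      simp only [and_self, if_true, lt_irrefl, if_false, mul_one]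
      rw [spread_self, Finset.prod_image fun b _ b' _ h => inner_injective hl a h, kz, pairProd]
      refine Finset.prod_congr rfl fun b _ => ?_
      rw [Finset.prod_image fun b _ b' _ h => inner_injective hl a h]
      refine Finset.prod_congr rfl fun b' _ => ?_
      simp only [h.2, inner_lt_inner]
    · rw [spread_of_ne hl ha]
      simp [ha]
  · have hne : ¬ (a = i ∧ a' = i) := fun h => haa' (h.1.trans h.2.symm)
    rw [if_neg hne, one_mul]
    have h3 : ∀ c ∈ spread hl i a, ∀ c' ∈ spread hl i a',
        (if c < c' then (if (c < c' ↔ υ c < υ c') then 1 else sg (k c * k c')) else 1)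
        = if a < a' then (if (a < a' ↔ σ a < σ a') then 1 else sg (k c * k c')) else 1 := by
      intro c hc c' hc'
      simp only [spread_lt_iff hl i hc hc' haa', spread_lt_iff hl (σ i) (h.mem_spread hc)
        (h.mem_spread hc') fun h => haa' (σ.injective h)]
    rw [Finset.prod_congr rfl fun c hc => Finset.prod_congr rfl fun c' hc' => h3 c hc c' hc']
    split_ifs
    · simp
    · rw [Finset.sum_mul_sum, sg_sum]
      refine Finset.prod_congr rfl fun c _ => ?_
      rw [sg_sum]
    · simp

/-! ## Graded vector spaces -/

section Graded

variable {A : Type} [AddCommGroup A] [Module ℝ A] {𝒜 : ℤ → Submodule ℝ A}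

theorem exists_sum_homogeneous (h : DirectSum.IsInternal 𝒜) (x : A) :
    ∃ (S : Finset ℤ) (g : ℤ → A), (∀ k, g k ∈ 𝒜 k) ∧ x = ∑ k ∈ S, g k := by
  have hx : x ∈ ⨆ k, 𝒜 k := by rw [h.submodule_iSup_eq_top]; trivial
  obtain ⟨g, hg, rfl⟩ := (Submodule.mem_iSup_iff_exists_finsupp _ _).1 hx
  exact ⟨g.support, g, hg, rfl⟩

theorem linearMap_ext_homogeneous (h : DirectSum.IsInternal 𝒜) {M : Type*} [AddCommGroup M]
    [Module ℝ M] {s t : A →ₗ[ℝ] M} (hst : ∀ k, ∀ x ∈ 𝒜 k, s x = t x) : s = t := by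
  refine LinearMap.ext fun x => ?_
  obtain ⟨S, g, hg, rfl⟩ := exists_sum_homogeneous h x
  rw [map_sum, map_sum]
  exact Finset.sum_congr rfl fun k _ => hst k _ (hg k)

theorem multilinearMap_ext_homogeneous (h : DirectSum.IsInternal 𝒜) {N : ℕ} {M : Type*}
    [AddCommGroup M] [Module ℝ M] {θ θ' : MultilinearMap ℝ (fun _ : Fin N => A) M}
    (hθ : ∀ (k : Fin N → ℤ) (f : Fin N → A), (∀ a, f a ∈ 𝒜 (k a)) → θ f = θ' f) : θ = θ' := by
  refine MultilinearMap.ext fun f => ?_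
  choose S g hg hf using fun a => exists_sum_homogeneous h (f a)
  rw [funext hf, MultilinearMap.map_sum_finset, MultilinearMap.map_sum_finset]
  exact Finset.sum_congr rfl fun k _ => hθ k _ fun a => hg a (k a)

theorem parity_pow_apply (h : DirectSum.IsInternal 𝒜) (m : ℕ) {k : ℤ} {f : A} (hf : f ∈ 𝒜 k) :
    (parity h ^ m) f = sg (m * k) • f := by
  induction m with
  | zero => simp
  | succ m ih =>
    rw [pow_succ', Module.End.mul_apply, ih, map_smul, parity_apply h hf, smul_smul, ← sg_add]
    congr 2; push_cast; ring

theorem parity_pow_congr (h : DirectSum.IsInternal 𝒜) {m m' : ℕ} (hm : Even (m - m' : ℤ)) :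
    parity h ^ m = parity h ^ m' := by
  refine linearMap_ext_homogeneous h fun k x hx => ?_
  rw [parity_pow_apply h m hx, parity_pow_apply h m' hx]
  congr 1
  refine sg_congr ?_
  rw [← sub_mul]
  exact hm.mul_right k

theorem parity_pow_natAbs_add (h : DirectSum.IsInternal 𝒜) (a b : ℤ) :
    parity h ^ (a + b).natAbs = parity h ^ a.natAbs * parity h ^ b.natAbs := by
  rw [← pow_add]
  refine parity_pow_congr h ?_
  push_cast
  simp only [Int.even_sub, Int.even_add, even_abs]

/-- A multilinear map of degree `e` commutes with the degree involution up to the sign `(-1)^e`. -/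
theorem parity_pow_multilinear (h : DirectSum.IsInternal 𝒜) (m : ℕ) {r : ℕ} {e : ℤ}
    {θ : MultilinearMap ℝ (fun _ : Fin (r + 1) => A) A} (hθ : θ ∈ homDeg 𝒜 r e)
    (f : Fin (r + 1) → A) :
    (parity h ^ m) (θ f) = sg (m * e) • θ fun a => (parity h ^ m) (f a) := by
  have key : (parity h ^ m).compMultilinearMap θ
      = sg (m * e) • θ.compLinearMap fun _ => parity h ^ m := by
    refine multilinearMap_ext_homogeneous h fun k f hf => ?_
    simp only [LinearMap.compMultilinearMap_apply, smul_apply,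
      MultilinearMap.compLinearMap_apply]
    rw [parity_pow_apply h m (hθ k f hf), funext fun a => parity_pow_apply h m (hf a),
      MultilinearMap.map_smul_univ, smul_smul, ← sg_sum, ← sg_add, ← Finset.mul_sum]
    congr 2; ring
  exact MultilinearMap.congr_fun key f

theorem parityProj_apply (h : DirectSum.IsInternal 𝒜) (b : Bool) {k : ℤ} {f : A} (hf : f ∈ 𝒜 k) :
    parityProj h b f = if b = decide (Odd k) then f else 0 := by
  have h1 : parityProj h b f = (1 / 2 : ℝ) • (f + (if b then (-1 : ℝ) else 1) • sg k • f) := by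
    cases b <;> simp [parityProj, parity_apply h hf]
  rw [h1]
  by_cases hk : Odd k
  · cases b
    · simp [hk, sg_of_odd hk]
    · simp only [hk, decide_true, if_true, sg_of_odd hk, smul_smul]
      norm_num [smul_smul, ← two_smul ℝ f]
  · have hk' : Even k := Int.not_odd_iff_even.1 hk
    cases b
    · simp only [hk, decide_false, if_true, sg_of_even hk', one_smul]
      norm_num [smul_smul, ← two_smul ℝ f]
    · simp [hk, sg_of_even hk']

/-- A homogeneous argument survives only the projection onto its own parity, so the sum over parity
vectors collapses to a single term. -/
theorem multAct_homogeneous (h : DirectSum.IsInternal 𝒜) {r : ℕ} (σ : Equiv.Perm (Fin (r + 1)))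
    (θ : MultilinearMap ℝ (fun _ : Fin (r + 1) => A) A) {k : Fin (r + 1) → ℤ}
    {f : Fin (r + 1) → A} (hf : ∀ a, f a ∈ 𝒜 (k a)) :
    multAct h σ θ f = kz σ k • θ fun a => f (σ⁻¹ a) := by
  rw [multAct_apply, Finset.sum_eq_single fun a => decide (Odd (k a))]
  · rw [koszul_eq_kz]
    congr 2
    funext a
    rw [parityProj_apply h _ (hf _), if_pos rfl]
  · intro b _ hb
    obtain ⟨a, ha⟩ := Function.ne_iff.1 hb
    rw [θ.map_coord_zero (σ a), smul_zero]
    rw [parityProj_apply h _ (hf _), if_neg]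
    simpa using ha
  · intro h; exact absurd (Finset.mem_univ _) h

/-! ## The operad laws of the endomorphism operad -/

theorem compArgs_self {p q l : ℕ} (hl : p + q = l) (i : Fin (p + 1)) (s : A →ₗ[ℝ] A)
    (θ' : MultilinearMap ℝ (fun _ : Fin (q + 1) => A) A) (f : Fin (l + 1) → A) :
    compArgs hl i s θ' f i = θ' fun b => f (inner hl i b) := if_pos rfl

theorem compArgs_of_lt {p q l : ℕ} (hl : p + q = l) {i a : Fin (p + 1)} (h : a < i)
    (s : A →ₗ[ℝ] A) (θ' : MultilinearMap ℝ (fun _ : Fin (q + 1) => A) A) (f : Fin (l + 1) → A) :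
    compArgs hl i s θ' f a = s (f (outer hl i a)) := by
  simp [compArgs, h, h.ne]

theorem compArgs_of_gt {p q l : ℕ} (hl : p + q = l) {i a : Fin (p + 1)} (h : i < a)
    (s : A →ₗ[ℝ] A) (θ' : MultilinearMap ℝ (fun _ : Fin (q + 1) => A) A) (f : Fin (l + 1) → A) :
    compArgs hl i s θ' f a = f (outer hl i a) := by
  simp [compArgs, h.ne', h.not_gt]

theorem multComp_apply {p q l : ℕ} (hl : p + q = l) (i : Fin (p + 1)) (s : A →ₗ[ℝ] A)
    (θ : MultilinearMap ℝ (fun _ : Fin (p + 1) => A) A)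
    (θ' : MultilinearMap ℝ (fun _ : Fin (q + 1) => A) A) (f : Fin (l + 1) → A) :
    multComp hl i s θ θ' f = θ (compArgs hl i s θ' f) := rfl

/-- Arguments before `i` are passed by both `y` and `z`, either one after the other or as a single
composite, and the condition `st = s * t` says that these signs agree. The remainder is a comparison
of input positions. -/
theorem multComp_seq {p q r pq qr pqr : ℕ} (h₁ : p + q = pq) (h₂ : pq + r = pqr)
    (h₃ : q + r = qr) (h₄ : p + qr = pqr) (i : Fin (p + 1)) (b : Fin (q + 1))
    {s t st : Module.End ℝ A} (hst : st = s * t)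
    (x : MultilinearMap ℝ (fun _ : Fin (p + 1) => A) A)
    (y : MultilinearMap ℝ (fun _ : Fin (q + 1) => A) A)
    (z : MultilinearMap ℝ (fun _ : Fin (r + 1) => A) A) :
    multComp h₂ (inner h₁ i b) t (multComp h₁ i s x y) z
      = multComp h₄ i st x (multComp h₃ b t y z) := by
  refine MultilinearMap.ext fun f => ?_
  rw [multComp_apply, multComp_apply, multComp_apply]
  congr 1
  funext a
  have o1 := outer_val h₁ i a
  have o4 := outer_val h₄ i a
  have o2 := outer_val h₂ (inner h₁ i b) (outer h₁ i a)
  rw [inner_val] at o2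
  rcases lt_trichotomy a i with ha | rfl | ha
  · rw [compArgs_of_lt _ ha, compArgs_of_lt _ ha, compArgs_of_lt, hst]
    · rw [Module.End.mul_apply]
      congr 3
      refine Fin.ext ?_
      rw [Fin.lt_def] at ha; omega
    · rw [Fin.lt_def] at ha ⊢; rw [inner_val]; omega
  · rw [compArgs_self, compArgs_self, multComp_apply]
    congr 1
    funext b'
    have p2 := outer_val h₂ (inner h₁ a b) (inner h₁ a b')
    have p3 := outer_val h₃ b b'
    simp only [inner_val] at p2
    rcases lt_trichotomy b' b with hb | rfl | hb
    · rw [compArgs_of_lt _ hb, compArgs_of_lt _ ((inner_lt_inner _ _ _ _).2 hb)]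
      congr 2
      refine Fin.ext ?_
      rw [inner_val]
      rw [Fin.lt_def] at hb; omega
    · rw [compArgs_self, compArgs_self]
      congr 1
      funext c
      congr 1
      refine Fin.ext ?_
      simp only [inner_val]; omega
    · rw [compArgs_of_gt _ hb, compArgs_of_gt _ ((inner_lt_inner _ _ _ _).2 hb)]
      congr 1
      refine Fin.ext ?_
      rw [inner_val]
      rw [Fin.lt_def] at hb; omega
  · rw [compArgs_of_gt _ ha, compArgs_of_gt _ ha, compArgs_of_gt]
    · congr 1
      refine Fin.ext ?_
      rw [Fin.lt_def] at ha; omega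
    · rw [Fin.lt_def] at ha ⊢; rw [inner_val]; omega

/-- The operation `z` lies to the right of `y`, so its sign operator `t` acts on the inputs of `y`
in one order of insertion and on the output of `y` in the other. Pulling `t` through `y` costs the
factor `c`, which leaves the slot `i` by multilinearity. -/
theorem multComp_par {p q r pq pr pqr : ℕ} (h₁ : p + q = pq) (h₂ : pq + r = pqr)
    (h₃ : p + r = pr) (h₄ : pr + q = pqr) {i a : Fin (p + 1)} (hia : i < a) {c : ℝ}
    {s t : Module.End ℝ A} (hst : Commute s t)
    (x : MultilinearMap ℝ (fun _ : Fin (p + 1) => A) A)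
    (y : MultilinearMap ℝ (fun _ : Fin (q + 1) => A) A)
    (z : MultilinearMap ℝ (fun _ : Fin (r + 1) => A) A)
    (hy : ∀ f, (y fun b => t (f b)) = c • t (y f)) :
    multComp h₂ (outer h₁ i a) t (multComp h₁ i s x y) z
      = c • multComp h₄ (outer h₃ a i) s (multComp h₃ a t x z) y := by
  refine MultilinearMap.ext fun f => ?_
  rw [smul_apply]
  simp only [multComp_apply]
  have hia' : (i : ℕ) < a := hia
  have e1 : (outer h₁ i a : ℕ) = a + q := outer_val_of_not_lt h₁ hia.not_gt
  have e2 : (outer h₃ a i : ℕ) = i := outer_val_of_lt h₃ hia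
  have hc : compArgs h₁ i s y (compArgs h₂ (outer h₁ i a) t z f) = Function.update
      (compArgs h₃ a t z (compArgs h₄ (outer h₃ a i) s y f)) i
      (c • compArgs h₃ a t z (compArgs h₄ (outer h₃ a i) s y f) i) := by
    funext v
    have v1 := outer_val h₁ i v
    have v2 := outer_val h₂ (outer h₁ i a) (outer h₁ i v)
    have v3 := outer_val h₃ a v
    have v4 := outer_val h₄ (outer h₃ a i) (outer h₃ a v)
    rcases eq_or_ne v i with rfl | hv
    · rw [Function.update_self, compArgs_self, compArgs_of_lt _ hia, compArgs_self, ← hy]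
      congr 1
      funext b
      rw [compArgs_of_lt]
      · congr 2
        have w := outer_val h₂ (outer h₁ v a) (inner h₁ v b)
        refine Fin.ext ?_
        simp only [inner_val] at w ⊢
        omega
      · rw [Fin.lt_def, inner_val]; omega
    · rw [Function.update_of_ne hv]
      have hv' : (v : ℕ) ≠ i := fun h => hv (Fin.ext h)
      rcases lt_trichotomy v a with hva | rfl | hva
      · rw [compArgs_of_lt h₃ hva]
        rw [Fin.lt_def] at hva
        rcases lt_or_gt_of_ne hv with h | h
        · rw [compArgs_of_lt _ h, compArgs_of_lt, compArgs_of_lt]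
          · rw [← Module.End.mul_apply, ← Module.End.mul_apply, hst.eq]
            rw [Fin.lt_def] at h
            congr 2
            exact Fin.ext (by omega)
          · rw [Fin.lt_def] at h ⊢; omega
          · rw [Fin.lt_def] at h ⊢; omega
        · rw [compArgs_of_gt _ h, compArgs_of_lt, compArgs_of_gt]
          · rw [Fin.lt_def] at h
            congr 2
            exact Fin.ext (by omega)
          · rw [Fin.lt_def] at h ⊢; omega
          · rw [Fin.lt_def] at h ⊢; omega
      · rw [compArgs_self, compArgs_of_gt _ hia, compArgs_self]
        congr 1
        funext b
        rw [compArgs_of_gt]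
        · have w := outer_val h₄ (outer h₃ v i) (inner h₃ v b)
          congr 1
          refine Fin.ext ?_
          simp only [inner_val] at w ⊢
          omega
        · rw [Fin.lt_def, inner_val]; omega
      · rw [compArgs_of_gt _ hva, compArgs_of_gt _ (hia.trans hva), compArgs_of_gt, compArgs_of_gt]
        · rw [Fin.lt_def] at hva
          congr 1
          exact Fin.ext (by omega)
        · rw [Fin.lt_def] at hva ⊢; omega
        · rw [Fin.lt_def] at hva ⊢; omega
  rw [hc, MultilinearMap.map_update_smul, Function.update_eq_self]

/-- On homogeneous arguments both sides evaluate `x` on the same unsigned arguments, and only signs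
have to be compared. Replacing the block by the output of `y` shifts its degree by `e`, and
`kz_update` measures the effect on the sign of `σ`. -/
theorem multComp_equivariant (h : DirectSum.IsInternal 𝒜) {p q l : ℕ} {e : ℤ} (hl : p + q = l)
    (i : Fin (p + 1)) (σ : Equiv.Perm (Fin (p + 1))) (τ : Equiv.Perm (Fin (q + 1)))
    (υ : Equiv.Perm (Fin (l + 1))) (hυ : IsBlockPerm hl i σ τ υ)
    (x : MultilinearMap ℝ (fun _ : Fin (p + 1) => A) A)
    {y : MultilinearMap ℝ (fun _ : Fin (q + 1) => A) A} (hy : y ∈ homDeg 𝒜 q e) :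
    multComp hl i (parity h ^ e.natAbs) (multAct h σ x) (multAct h τ y)
      = multAct h υ (multComp hl (σ i) (parity h ^ e.natAbs) x y) := by
  refine multilinearMap_ext_homogeneous h fun k f hf => ?_
  have hK : ∀ a, a ≠ i → ∑ c ∈ spread hl i a, k c = k (outer hl i a) := by
    intro a ha; rw [spread_of_ne hl ha, Finset.sum_singleton]
  have hKi : ∑ c ∈ spread hl i i, k c = ∑ b, k (inner hl i b) := by
    rw [spread_self, Finset.sum_image fun b _ b' _ h => inner_injective hl i h]
  -- These are the arguments of `x` without signs. `K0` is the degree of each block before `y` acts;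
  -- `S1` and `S2` are the signs for `y` to pass the blocks preceding it before and after the
  -- permutation.
  let base : Fin (p + 1) → A := fun a =>
    if a = i then y fun b => f (inner hl i (τ⁻¹ b)) else f (outer hl i a)
  let K0 : Fin (p + 1) → ℤ := fun a => ∑ c ∈ spread hl i a, k c
  let S1 : ℝ := ∏ a, if a < i then sg (e * K0 a) else 1
  let S2 : ℝ := ∏ a, if σ a < σ i then sg (e * K0 a) else 1
  have hS1 : S1 * S1 = 1 := by
    simp only [S1, ← Finset.prod_mul_distrib]
    refine Finset.prod_eq_one fun a _ => ?_
    split_ifs <;> simp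
  have hpar : ∀ a, a ≠ i → (parity h ^ e.natAbs) (f (outer hl i a))
      = sg (e * K0 a) • f (outer hl i a) := by
    intro a ha
    rw [parity_pow_apply h _ (hf _), sg_natAbs_mul]
    simp only [K0]; rw [hK a ha]
  have hL : compArgs hl i (parity h ^ e.natAbs) (multAct h τ y) f = fun a =>
      (if a = i then kz τ (fun b => k (inner hl i b)) else
        if a < i then sg (e * K0 a) else 1) • base a := by
    funext a
    simp only [base]
    rcases lt_trichotomy a i with ha | rfl | ha
    · rw [compArgs_of_lt _ ha, hpar a ha.ne, if_neg ha.ne, if_pos ha, if_neg ha.ne]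
    · rw [compArgs_self, if_pos rfl, if_pos rfl, multAct_homogeneous h τ y fun b => hf (inner hl a b)]
    · rw [compArgs_of_gt _ ha, if_neg ha.ne', if_neg ha.not_gt, if_neg ha.ne', one_smul]
  have hR : compArgs hl (σ i) (parity h ^ e.natAbs) y (fun c => f (υ⁻¹ c)) = fun a =>
      (if a < σ i then sg (e * K0 (σ⁻¹ a)) else 1) • base (σ⁻¹ a) := by
    funext a
    obtain ⟨a, rfl⟩ := σ.surjective a
    simp only [base, Equiv.Perm.inv_def, Equiv.symm_apply_apply]
    have ho : ∀ a, a ≠ i → υ.symm (outer hl (σ i) (σ a)) = outer hl i a := by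
      intro a ha; rw [Equiv.symm_apply_eq, hυ.1 a ha]
    rcases lt_trichotomy (σ a) (σ i) with ha | ha | ha
    · have hai : a ≠ i := fun h => by simp [h] at ha
      rw [compArgs_of_lt _ ha, if_pos ha, if_neg hai, ho a hai, hpar a hai]
    · obtain rfl := σ.injective ha
      rw [compArgs_self, if_neg (lt_irrefl _), if_pos rfl, one_smul]
      congr 1
      funext b
      congr 1
      rw [Equiv.symm_apply_eq, hυ.2]
      simp
    · have hai : a ≠ i := fun h => by simp [h] at ha
      rw [compArgs_of_gt _ ha, if_neg ha.not_gt, if_neg hai, ho a hai, one_smul]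
  have hprodL : (∏ a, if a = i then kz τ (fun b => k (inner hl i b)) else
        if a < i then sg (e * K0 a) else 1) = kz τ (fun b => k (inner hl i b)) * S1 := by
    have h1 : ∀ a, (if a = i then kz τ (fun b => k (inner hl i b)) else
        if a < i then sg (e * K0 a) else 1) =
        (if a = i then kz τ (fun b => k (inner hl i b)) else 1) *
          (if a < i then sg (e * K0 a) else 1) := by
      intro a
      by_cases ha : a = i <;> simp [ha]
    simp only [h1, Finset.prod_mul_distrib, S1]
    simp
  have hK' : ∀ a, compArgs hl i (parity h ^ e.natAbs) (multAct h τ y) f a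
      ∈ 𝒜 (Function.update K0 i (K0 i + e) a) := by
    intro a
    rcases eq_or_ne a i with rfl | ha
    · rw [Function.update_self, compArgs_self]
      have h1 := multAct_mem h τ hy _ _ fun b => hf (inner hl a b)
      simp only [K0]
      rwa [hKi]
    · rw [Function.update_of_ne ha]
      simp only [K0]
      rw [hK a ha]
      rcases lt_or_gt_of_ne ha with h' | h'
      · rw [compArgs_of_lt _ h']
        exact parity_pow_mem h _ (hf _)
      · rw [compArgs_of_gt _ h']
        exact hf _
  rw [multComp_apply, multAct_homogeneous h σ x hK', multAct_homogeneous h υ _ hf, multComp_apply,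
    hR, hL, kz_block hυ k,
    kz_update σ K0 _ i e (by simp) (fun a ha => by simp [ha])]
  have hsum : ∀ c : Fin (p + 1) → ℝ, (x fun a => c (σ⁻¹ a) • base (σ⁻¹ a))
      = (∏ a, c a) • x fun a => base (σ⁻¹ a) := by
    intro c
    rw [x.map_smul_univ (fun a => c (σ⁻¹ a)), Equiv.prod_comp σ⁻¹ c]
  have h2 := hsum fun a => if σ a < σ i then sg (e * K0 a) else 1
  have h3 := hsum fun a => if a = i then kz τ (fun b => k (inner hl i b)) else
        if a < i then sg (e * K0 a) else 1
  simp only [Equiv.Perm.inv_def, Equiv.apply_symm_apply] at h2 h3 ⊢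
  rw [h2, h3, hprodL, smul_smul, smul_smul]
  congr 1
  -- The factor `S1` occurs once from the degree shift at `i` and once from the composition, so it
  -- cancels; `S2` is the sign in the permuted composition.
  change kz σ K0 * S1 * S2 * (_ * S1) = _ * kz σ K0 * S2
  linear_combination (kz σ K0 * S2 * kz τ fun b => k (inner hl i b)) * hS1

theorem End.isOperad (h : DirectSum.IsInternal 𝒜) : IsOperad (End h) where
  act_one x := Subtype.ext (multilinearMap_ext_homogeneous h fun k f hf => by
    refine (multAct_homogeneous h 1 x.1 hf).trans ?_
    rw [kz_one, one_smul]; rfl)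
  act_mul σ τ x := Subtype.ext (multilinearMap_ext_homogeneous h fun k f hf => by
    refine (multAct_homogeneous h (σ * τ) x.1 hf).trans
      (((multAct_homogeneous h τ (multAct h σ x.1) hf).trans ?_).symm)
    rw [multAct_homogeneous h σ x.1 fun a => hf (τ⁻¹ a), kz_mul, smul_smul, mul_inv_rev]
    rfl)
  one_comp {q k} x := Subtype.ext (MultilinearMap.ext fun f => by
    change x.1 (fun b => f (inner (zero_add q) 0 b)) = x.1 f
    congr 1
    funext b
    congr 1
    exact Fin.ext (by simp))
  comp_one {p k} i x := Subtype.ext (MultilinearMap.ext fun f => by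
    change x.1 (compArgs (add_zero p) i 1 idMap f) = x.1 f
    congr 1
    funext a
    have o := outer_val (add_zero p) i a
    rcases lt_trichotomy a i with ha | rfl | ha
    · rw [compArgs_of_lt _ ha, Module.End.one_apply]
      exact congrArg f (Fin.ext (by omega))
    · rw [compArgs_self]
      exact congrArg f (Fin.ext (by simp))
    · rw [compArgs_of_gt _ ha]
      exact congrArg f (Fin.ext (by omega)))
  seq h₁ h₂ h₃ h₄ g₁ g₂ g₃ g₄ i b x y z := Subtype.ext
    (multComp_seq h₁ h₂ h₃ h₄ i b (by rw [← g₃, parity_pow_natAbs_add]) x.1 y.1 z.1)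
  par {p q r pq pr pqr j k m jk jm jkm} h₁ h₂ h₃ h₄ g₁ g₂ g₃ g₄ i a hia x y z := Subtype.ext
    (multComp_par h₁ h₂ h₃ h₄ hia ((Commute.refl (parity h)).pow_pow _ _) x.1 y.1 z.1 fun f => by
      have h1 := parity_pow_multilinear h m.natAbs y.2 f
      rw [h1, sg_natAbs_mul, mul_comm m k, sg_smul_sg_smul])
  equivariant hl hk i σ τ υ hυ x y := Subtype.ext
    (multComp_equivariant h hl i σ τ υ hυ x.1 y.2)

end Graded

end NPOperad

end

/-! ### Calculus on `C^∞(V)`: derivatives, degrees and graded Leibniz rule -/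

noncomputable section

namespace NPOperad

/-! ## Partial derivatives of smooth functions -/

section Smooth

variable {ι : Type} [Fintype ι] [DecidableEq ι] {U : TopologicalSpace.Opens (ι → ℝ)}

theorem smoothPartial_mul (i : ι) (f g : SmoothFn U) :
    smoothPartial U i (f * g) = smoothPartial U i f * g + f * smoothPartial U i g :=
  Subtype.ext <| funext fun y => by
    have h : extendZero (f * g).1 =ᶠ[nhds (y : ι → ℝ)] extendZero f.1 * extendZero g.1 := by
      filter_upwards [U.2.mem_nhds y.2] with z hz
      have h1 := extendZero_apply f.1 ⟨z, hz⟩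
      have h2 := extendZero_apply g.1 ⟨z, hz⟩
      have h3 := extendZero_apply (f * g).1 ⟨z, hz⟩
      simp only [Pi.mul_apply, h1, h2, h3]
      rfl
    change fderiv ℝ (extendZero (f * g).1) y _ = fderiv ℝ (extendZero f.1) y _ * g.1 y
      + f.1 y * fderiv ℝ (extendZero g.1) y _
    rw [h.fderiv_eq, fderiv_mul (extendZero_differentiableAt f y)
      (extendZero_differentiableAt g y), extendZero_apply, extendZero_apply]
    simp only [add_apply, smul_apply, smul_eq_mul]
    ring

theorem smoothPartial_smoothPartial (i j : ι) (f : SmoothFn U) (y : U) :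
    (smoothPartial U i (smoothPartial U j f)).1 y
      = fderiv ℝ (fderiv ℝ (extendZero f.1)) y (Pi.single i 1) (Pi.single j 1) := by
  have h : extendZero (smoothPartial U j f).1 =ᶠ[nhds (y : ι → ℝ)]
      fun z => fderiv ℝ (extendZero f.1) z (Pi.single j 1) := by
    filter_upwards [U.2.mem_nhds y.2] with z hz
    exact extendZero_apply _ ⟨z, hz⟩
  change fderiv ℝ (extendZero (smoothPartial U j f).1) y _ = _
  have hd : DifferentiableAt ℝ (fderiv ℝ (extendZero f.1)) (y : ι → ℝ) :=
    (((extendZero_contDiffOn f).fderiv_of_isOpen (m := ∞) U.2 (by simp)).differentiableOn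
      (by simp)).differentiableAt (U.2.mem_nhds y.2)
  rw [h.fderiv_eq, fderiv_clm_apply hd (differentiableAt_const _)]
  simp

/-- This is the symmetry of the second derivative of a smooth function on an open set; the extension
by zero is smooth near every point of that set. -/
theorem smoothPartial_comm (i j : ι) (f : SmoothFn U) :
    smoothPartial U i (smoothPartial U j f) = smoothPartial U j (smoothPartial U i f) :=
  Subtype.ext <| funext fun y => by
    rw [smoothPartial_smoothPartial, smoothPartial_smoothPartial]
    have h : ContDiffAt ℝ ∞ (extendZero f.1) (y : ι → ℝ) :=
      (extendZero_contDiffOn f).contDiffAt (U.2.mem_nhds y.2)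
    refine h.isSymmSndFDerivAt ?_ _ _
    rw [minSmoothness_of_isRCLikeNormedField]
    exact WithTop.coe_le_coe.2 le_top

end Smooth

namespace NPChart

variable {n : ℕ} (V : NPChart n)

/-! ## Products of odd coordinates -/

/-- The product of a list of odd coordinates. -/
def oddProd (w : List V.CrdOdd) : ExteriorAlgebra ℝ (V.CrdOdd → ℝ) := (w.map V.oddGen).prod

theorem oddProd_nil : V.oddProd [] = 1 := rfl

theorem oddProd_cons (z : V.CrdOdd) (w : List V.CrdOdd) :
    V.oddProd (z :: w) = V.oddGen z * V.oddProd w := by simp [oddProd]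

theorem oddProd_append (w w' : List V.CrdOdd) :
    V.oddProd (w ++ w') = V.oddProd w * V.oddProd w' := by simp [oddProd]

theorem oddGen_mul_oddGen (y z : V.CrdOdd) :
    V.oddGen y * V.oddGen z = -(V.oddGen z * V.oddGen y) :=
  eq_neg_of_add_eq_zero_left (ExteriorAlgebra.ι_add_mul_swap _ _)

theorem oddGen_mul_oddProd (y : V.CrdOdd) (w : List V.CrdOdd) :
    V.oddGen y * V.oddProd w = sg w.length • (V.oddProd w * V.oddGen y) := by
  induction w with
  | nil => simp [oddProd_nil]
  | cons z w ih =>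
    rw [oddProd_cons, ← mul_assoc, oddGen_mul_oddGen, neg_mul, mul_assoc, ih, List.length_cons,
      Nat.cast_add, sg_add, Nat.cast_one, sg_one, mul_smul_comm, mul_assoc]
    simp

theorem oddProd_mul_oddProd (w w' : List V.CrdOdd) :
    V.oddProd w * V.oddProd w' = sg (w.length * w'.length) • (V.oddProd w' * V.oddProd w) := by
  induction w with
  | nil => simp [oddProd_nil]
  | cons z w ih =>
    rw [oddProd_cons, mul_assoc, ih, mul_smul_comm, ← mul_assoc, oddGen_mul_oddProd, smul_mul_assoc,
      smul_smul, ← sg_add, mul_assoc]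
    congr 2
    rw [List.length_cons]; push_cast; ring

/-- The derivative with respect to an odd coordinate, on the exterior algebra. -/
def oddPartial (z : V.CrdOdd) :
    ExteriorAlgebra ℝ (V.CrdOdd → ℝ) →ₗ[ℝ] ExteriorAlgebra ℝ (V.CrdOdd → ℝ) :=
  CliffordAlgebra.contractLeft (LinearMap.proj z)

theorem oddPartial_one (z : V.CrdOdd) : V.oddPartial z 1 = 0 :=
  CliffordAlgebra.contractLeft_one (Q := 0) _

theorem oddPartial_oddGen_mul (z y : V.CrdOdd) (x : ExteriorAlgebra ℝ (V.CrdOdd → ℝ)) :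
    V.oddPartial z (V.oddGen y * x)
      = (if z = y then (1 : ℝ) else 0) • x - V.oddGen y * V.oddPartial z x := by
  refine (CliffordAlgebra.contractLeft_ι_mul (Q := 0) _ _ _).trans ?_
  rw [LinearMap.proj_apply, Pi.single_apply]
  rfl

theorem oddPartial_oddProd_mul (z : V.CrdOdd) (w : List V.CrdOdd)
    (x : ExteriorAlgebra ℝ (V.CrdOdd → ℝ)) : V.oddPartial z (V.oddProd w * x)
      = V.oddPartial z (V.oddProd w) * x + sg w.length • (V.oddProd w * V.oddPartial z x) := by
  induction w with
  | nil => simp [oddProd_nil, oddPartial_one]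
  | cons y w ih =>
    rw [oddProd_cons, mul_assoc, oddPartial_oddGen_mul, ih, oddPartial_oddGen_mul, List.length_cons,
      Nat.cast_add, sg_add, Nat.cast_one, sg_one, mul_add, sub_mul, smul_mul_assoc, mul_smul_comm,
      mul_assoc, mul_assoc]
    simp only [mul_neg, mul_one, neg_smul]
    abel

theorem oddPartial_comm (y z : V.CrdOdd) (x : ExteriorAlgebra ℝ (V.CrdOdd → ℝ)) :
    V.oddPartial y (V.oddPartial z x) = -V.oddPartial z (V.oddPartial y x) :=
  CliffordAlgebra.contractLeft_comm _ _ _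

/-! ## Monomials -/

/-- The product of a smooth function and a monomial in the coordinates of positive degree. -/
def gen (g : SmoothFn V.base) (a : V.CrdEven →₀ ℕ) (w : List V.CrdOdd) : V.Fn :=
  V.fnMk g (MvPolynomial.monomial a 1) (V.oddProd w)

/-- The degree of a product of odd coordinates. -/
def oddDeg (w : List V.CrdOdd) : ℕ := (w.map fun z => z.1.deg).sum

/-- The degree of a monomial in the even coordinates. -/
def evenDeg (a : V.CrdEven →₀ ℕ) : ℕ := a.sum fun z r => r * z.1.deg

theorem oddDeg_cons (z : V.CrdOdd) (w : List V.CrdOdd) :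
    V.oddDeg (z :: w) = z.1.deg + V.oddDeg w := by simp [oddDeg]

theorem oddDeg_append (w w' : List V.CrdOdd) :
    V.oddDeg (w ++ w') = V.oddDeg w + V.oddDeg w' := by simp [oddDeg]

theorem evenDeg_add (a a' : V.CrdEven →₀ ℕ) :
    V.evenDeg (a + a') = V.evenDeg a + V.evenDeg a' :=
  Finsupp.sum_add_index' (fun _ => zero_mul _) fun _ _ _ => add_mul _ _ _

theorem evenDeg_single (z : V.CrdEven) : V.evenDeg (Finsupp.single z 1) = z.1.deg := by
  simp [evenDeg]

theorem even_evenDeg (a : V.CrdEven →₀ ℕ) : Even (V.evenDeg a) := by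
  rw [evenDeg, Finsupp.sum]
  exact Finset.even_sum _ fun z _ => z.2.2.mul_left _

/-- Even coordinates contribute even degrees and each odd coordinate an odd one, so the parity of a
monomial is that of the number of its odd letters. Signs can then be computed in the exterior
algebra by counting letters. -/
theorem sg_mul_genDeg (m : ℤ) (a : V.CrdEven →₀ ℕ) (w : List V.CrdOdd) :
    sg (m * ((V.evenDeg a + V.oddDeg w : ℕ) : ℤ)) = sg (m * w.length) := by
  refine sg_congr ?_
  rw [← mul_sub]
  refine Even.mul_left ?_ _
  have h : Even ((V.oddDeg w : ℤ) - w.length) := by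
    induction w with
    | nil => simp [oddDeg]
    | cons z w ih =>
      have hz : Odd (z.1.deg : ℤ) := by exact_mod_cast z.2
      have h1 : ((V.oddDeg (z :: w) : ℤ) - (z :: w).length)
          = (V.oddDeg w - w.length) + (z.1.deg - 1) := by
        rw [oddDeg_cons, List.length_cons]; push_cast; ring
      rw [h1]
      exact ih.add (hz.sub_odd odd_one)
  have h2 : Even (V.evenDeg a : ℤ) := by exact_mod_cast V.even_evenDeg a
  rw [Nat.cast_add, add_sub_assoc]
  exact h2.add h

theorem gen_mem (g : SmoothFn V.base) (a : V.CrdEven →₀ ℕ) (w : List V.CrdOdd) :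
    V.gen g a w ∈ V.fnDeg ((V.evenDeg a + V.oddDeg w : ℕ) : ℤ) :=
  Submodule.subset_span ⟨g, a, w, rfl, rfl⟩

theorem fnDeg_le {k : ℤ} {p : Submodule ℝ V.Fn}
    (h : ∀ g a w, ((V.evenDeg a + V.oddDeg w : ℕ) : ℤ) = k → V.gen g a w ∈ p) :
    V.fnDeg k ≤ p := by
  refine Submodule.span_le.2 ?_
  rintro _ ⟨g, a, w, hk, rfl⟩
  exact h g a w hk

theorem eq_top_of_gen_mem {p : Submodule ℝ V.Fn} (h : ∀ g a w, V.gen g a w ∈ p) : p = ⊤ :=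
  top_le_iff.1 (V.iSup_fnDeg ▸ iSup_le fun _ => V.fnDeg_le fun g a w _ => h g a w)

theorem linearMap_ext_gen {M : Type*} [AddCommGroup M] [Module ℝ M] {s t : V.Fn →ₗ[ℝ] M}
    (h : ∀ g a w, s (V.gen g a w) = t (V.gen g a w)) : s = t := by
  rw [← sub_eq_zero, ← LinearMap.ker_eq_top]
  exact V.eq_top_of_gen_mem fun g a w => by simp [h]

theorem fnMk_mul_fnMk (g g' : SmoothFn V.base) (P P' : MvPolynomial V.CrdEven ℝ)
    (w w' : ExteriorAlgebra ℝ (V.CrdOdd → ℝ)) :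
    V.fnMk g P w * V.fnMk g' P' w' = V.fnMk (g * g') (P * P') (w * w') := by
  refine (Algebra.TensorProduct.tmul_mul_tmul _ _ _ _).trans ?_
  rw [Algebra.TensorProduct.tmul_mul_tmul]
  rfl

theorem fnMk_smul_right (g : SmoothFn V.base) (P : MvPolynomial V.CrdEven ℝ)
    (w : ExteriorAlgebra ℝ (V.CrdOdd → ℝ)) (r : ℝ) : V.fnMk g P (r • w) = r • V.fnMk g P w := by
  simpa using V.fnMk_smul g P w 1 r

theorem fnMk_add_left (g g' : SmoothFn V.base) (P : MvPolynomial V.CrdEven ℝ)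
    (w : ExteriorAlgebra ℝ (V.CrdOdd → ℝ)) :
    V.fnMk (g + g') P w = V.fnMk g P w + V.fnMk g' P w := TensorProduct.add_tmul _ _ _

theorem fnMk_add_middle (g : SmoothFn V.base) (P P' : MvPolynomial V.CrdEven ℝ)
    (w : ExteriorAlgebra ℝ (V.CrdOdd → ℝ)) :
    V.fnMk g (P + P') w = V.fnMk g P w + V.fnMk g P' w := by
  unfold fnMk
  rw [TensorProduct.add_tmul]
  exact TensorProduct.tmul_add _ _ _

theorem fnMk_add_right (g : SmoothFn V.base) (P : MvPolynomial V.CrdEven ℝ)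
    (w w' : ExteriorAlgebra ℝ (V.CrdOdd → ℝ)) :
    V.fnMk g P (w + w') = V.fnMk g P w + V.fnMk g P w' := by
  unfold fnMk
  rw [TensorProduct.tmul_add]
  exact TensorProduct.tmul_add _ _ _

theorem gen_mul_gen (g g' : SmoothFn V.base) (a a' : V.CrdEven →₀ ℕ) (w w' : List V.CrdOdd) :
    V.gen g a w * V.gen g' a' w' = V.gen (g * g') (a + a') (w ++ w') := by
  rw [gen, gen, gen, fnMk_mul_fnMk, MvPolynomial.monomial_mul, mul_one, oddProd_append]

theorem fnDeg_mul {j k e : ℤ} (he : j + k = e) {f g : V.Fn} (hf : f ∈ V.fnDeg j)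
    (hg : g ∈ V.fnDeg k) : f * g ∈ V.fnDeg e := by
  have h := Submodule.mul_mem_mul hf hg
  rw [fnDeg, fnDeg, Submodule.span_mul_span] at h
  refine Submodule.span_le.2 ?_ h
  rintro _ ⟨_, ⟨g, a, w, rfl, rfl⟩, _, ⟨g', a', w', rfl, rfl⟩, rfl⟩
  have h1 := V.gen_mem (g * g') (a + a') (w ++ w')
  rw [← gen_mul_gen, evenDeg_add, oddDeg_append] at h1
  have h2 : ((V.evenDeg a + V.evenDeg a' + (V.oddDeg w + V.oddDeg w') : ℕ) : ℤ) = e := by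
    rw [← he, ← Nat.cast_add]
    congr 1
    change _ = V.evenDeg a + V.oddDeg w + (V.evenDeg a' + V.oddDeg w')
    ring
  rw [h2] at h1
  exact h1

theorem gen_mul_gen_comm (g g' : SmoothFn V.base) (a a' : V.CrdEven →₀ ℕ)
    (w w' : List V.CrdOdd) : V.gen g a w * V.gen g' a' w'
      = sg (w.length * w'.length) • (V.gen g' a' w' * V.gen g a w) := by
  rw [gen, gen, fnMk_mul_fnMk, fnMk_mul_fnMk, oddProd_mul_oddProd, fnMk_smul_right, mul_comm g,
    mul_comm (MvPolynomial.monomial a _)]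

/-- Graded commutativity. -/
theorem mul_comm_graded {j k : ℤ} {f g : V.Fn} (hf : f ∈ V.fnDeg j) (hg : g ∈ V.fnDeg k) :
    f * g = sg (j * k) • (g * f) := by
  have h : V.fnDeg j ≤ LinearMap.eqLocus ((LinearMap.mul ℝ V.Fn).flip g)
      (sg (j * k) • LinearMap.mul ℝ V.Fn g) := by
    refine V.fnDeg_le fun g₁ a w h₁ => ?_
    have h' : V.fnDeg k ≤ LinearMap.eqLocus (LinearMap.mul ℝ V.Fn (V.gen g₁ a w))
        (sg (j * k) • (LinearMap.mul ℝ V.Fn).flip (V.gen g₁ a w)) := by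
      refine V.fnDeg_le fun g₂ a' w' h₂ => ?_
      refine (V.gen_mul_gen_comm _ _ _ _ _ _).trans ?_
      have h₃ : sg (j * k) = sg (w.length * w'.length) := by
        rw [← h₁, ← h₂, sg_mul_genDeg, mul_comm, sg_mul_genDeg, mul_comm]
      rw [h₃]
      rfl
    exact h' hg
  exact h hf

/-! ## Partial derivatives -/

theorem pd_fnMk_of_zero {z : V.Crd} (h : z.deg = 0) (g : SmoothFn V.base)
    (P : MvPolynomial V.CrdEven ℝ) (w : ExteriorAlgebra ℝ (V.CrdOdd → ℝ)) :
    V.pd z (V.fnMk g P w) = V.fnMk (smoothPartial V.base ⟨z, h⟩ g) P w := by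
  exact LinearMap.congr_fun (dif_pos h : V.pd z = _) (V.fnMk g P w)

theorem pd_fnMk_of_even {z : V.Crd} (h : z.deg ≠ 0 ∧ Even z.deg) (g : SmoothFn V.base)
    (P : MvPolynomial V.CrdEven ℝ) (w : ExteriorAlgebra ℝ (V.CrdOdd → ℝ)) :
    V.pd z (V.fnMk g P w) = V.fnMk g (MvPolynomial.pderiv (⟨z, h⟩ : V.CrdEven) P) w := by
  exact LinearMap.congr_fun ((dif_neg h.1).trans (dif_pos h.2) : V.pd z = _) (V.fnMk g P w)

theorem pd_fnMk_of_odd {z : V.Crd} (h : Odd z.deg) (g : SmoothFn V.base)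
    (P : MvPolynomial V.CrdEven ℝ) (w : ExteriorAlgebra ℝ (V.CrdOdd → ℝ)) :
    V.pd z (V.fnMk g P w) = V.fnMk g P (V.oddPartial ⟨z, h⟩ w) := by
  exact LinearMap.congr_fun ((dif_neg h.pos.ne').trans (dif_neg (Nat.not_even_iff_odd.2 h)) :
    V.pd z = _) (V.fnMk g P w)

variable {V} in
theorem crd_cases (z : V.Crd) : z.deg = 0 ∨ (z.deg ≠ 0 ∧ Even z.deg) ∨ Odd z.deg := by
  rcases Nat.even_or_odd z.deg with h | h
  · tauto
  · exact .inr (.inr h)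

theorem oddPartial_oddProd_mem (z : V.CrdOdd) (w : List V.CrdOdd) : V.oddPartial z (V.oddProd w) ∈
    Submodule.span ℝ {x | ∃ w', V.oddDeg w' + z.1.deg = V.oddDeg w ∧ V.oddProd w' = x} := by
  induction w with
  | nil => rw [oddProd_nil, oddPartial_one]; exact Submodule.zero_mem _
  | cons y w ih =>
    rw [oddProd_cons, oddPartial_oddGen_mul]
    refine Submodule.sub_mem _ ?_ ?_
    · split_ifs with h
      · subst h
        exact Submodule.smul_mem _ _ (Submodule.subset_span
          ⟨w, by rw [oddDeg_cons, add_comm], rfl⟩)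
      · rw [zero_smul]; exact Submodule.zero_mem _
    · have h : Submodule.span ℝ {x | ∃ w', V.oddDeg w' + z.1.deg = V.oddDeg w ∧ V.oddProd w' = x} ≤
          (Submodule.span ℝ {x | ∃ w', V.oddDeg w' + z.1.deg = V.oddDeg (y :: w) ∧
            V.oddProd w' = x}).comap (LinearMap.mulLeft ℝ (V.oddGen y)) := by
        refine Submodule.span_le.2 ?_
        rintro _ ⟨w', h, rfl⟩
        exact Submodule.subset_span ⟨y :: w', by rw [oddDeg_cons, oddDeg_cons, ← h, add_assoc],
          V.oddProd_cons _ _⟩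
      exact h ih

theorem pd_mem (z : V.Crd) {k e : ℤ} (he : e + z.deg = k) {f : V.Fn} (hf : f ∈ V.fnDeg k) :
    V.pd z f ∈ V.fnDeg e := by
  refine (V.fnDeg_le (p := (V.fnDeg e).comap (V.pd z)) fun g a w h => ?_) hf
  rw [Submodule.mem_comap, gen]
  rcases crd_cases z with h0 | h0 | h0
  · rw [pd_fnMk_of_zero V h0]
    have h1 := V.gen_mem (smoothPartial V.base ⟨z, h0⟩ g) a w
    rw [h, ← he, h0, Nat.cast_zero, add_zero] at h1
    exact h1
  · rw [pd_fnMk_of_even V h0, MvPolynomial.pderiv_monomial, one_mul]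
    have h1 : V.fnMk g (MvPolynomial.monomial (a - Finsupp.single ⟨z, h0⟩ 1) (a ⟨z, h0⟩ : ℝ))
        (V.oddProd w) = (a ⟨z, h0⟩ : ℝ) • V.gen g (a - Finsupp.single ⟨z, h0⟩ 1) w := by
      have h2 := V.fnMk_smul g (MvPolynomial.monomial (a - Finsupp.single ⟨z, h0⟩ 1) 1)
        (V.oddProd w) (a ⟨z, h0⟩ : ℝ) 1
      rw [mul_one, one_smul, MvPolynomial.smul_monomial, smul_eq_mul, mul_one] at h2
      exact h2
    rw [h1]
    -- If the coordinate does not occur, subtraction of exponents is truncated and the degree would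
    -- be wrong, but the coefficient is then zero.
    by_cases hz : a ⟨z, h0⟩ = 0
    · rw [hz, Nat.cast_zero, zero_smul]; exact Submodule.zero_mem _
    refine Submodule.smul_mem _ _ ?_
    have h2 := V.gen_mem g (a - Finsupp.single ⟨z, h0⟩ 1) w
    have h3 : a - Finsupp.single ⟨z, h0⟩ 1 + Finsupp.single ⟨z, h0⟩ 1 = a := by
      refine tsub_add_cancel_of_le ?_
      rw [Finsupp.single_le_iff]
      omega
    have h4 : ((V.evenDeg (a - Finsupp.single ⟨z, h0⟩ 1) + V.oddDeg w : ℕ) : ℤ) = e := by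
      rw [← h3, evenDeg_add, evenDeg_single] at h
      push_cast at h ⊢
      linarith
    rw [h4] at h2
    exact h2
  · rw [pd_fnMk_of_odd V h0]
    let φ : ExteriorAlgebra ℝ (V.CrdOdd → ℝ) →ₗ[ℝ] V.Fn :=
      { toFun := V.fnMk g (MvPolynomial.monomial a 1)
        map_add' := V.fnMk_add_right _ _
        map_smul' := fun r x => V.fnMk_smul_right _ _ x r }
    refine (Submodule.span_le (p := (V.fnDeg e).comap φ)).2 ?_ (V.oddPartial_oddProd_mem ⟨z, h0⟩ w)
    rintro _ ⟨w', h', rfl⟩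
    have h2 := V.gen_mem g a w'
    have h4 : ((V.evenDeg a + V.oddDeg w' : ℕ) : ℤ) = e := by
      rw [← h'] at h
      push_cast at h ⊢
      linarith
    rw [h4] at h2
    exact h2

theorem par_pow_apply (m : ℕ) {k : ℤ} {f : V.Fn} (hf : f ∈ V.fnDeg k) :
    (V.par ^ m) f = sg (m * k) • f := parity_pow_apply V.fnDeg_internal m hf

/-- The graded Leibniz rule. -/
theorem pd_mul (z : V.Crd) (f g : V.Fn) :
    V.pd z (f * g) = V.pd z f * g + (V.par ^ z.deg) f * V.pd z g := by
  have h : (LinearMap.mul ℝ V.Fn).compr₂ (V.pd z)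
      = (LinearMap.mul ℝ V.Fn) ∘ₗ V.pd z
        + (LinearMap.mul ℝ V.Fn).compl₁₂ (V.par ^ z.deg) (V.pd z) := by
    refine V.linearMap_ext_gen fun g a w => V.linearMap_ext_gen fun g' a' w' => ?_
    change V.pd z (V.gen g a w * V.gen g' a' w') = V.pd z (V.gen g a w) * V.gen g' a' w'
      + (V.par ^ z.deg) (V.gen g a w) * V.pd z (V.gen g' a' w')
    rw [V.par_pow_apply z.deg (V.gen_mem g a w), sg_mul_genDeg, sg_mul]
    simp only [gen, fnMk_mul_fnMk]
    rcases crd_cases z with h | h | h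
    · simp only [pd_fnMk_of_zero V h, smoothPartial_mul, fnMk_add_left, fnMk_mul_fnMk]
      simp [h, fnMk_mul_fnMk]
    · simp only [pd_fnMk_of_even V h, MvPolynomial.pderiv_mul, fnMk_add_middle, fnMk_mul_fnMk]
      rw [if_pos (by exact_mod_cast h.2), one_smul, fnMk_mul_fnMk]
    · simp only [pd_fnMk_of_odd V h, oddPartial_oddProd_mul, fnMk_add_right, fnMk_mul_fnMk]
      rw [if_neg (by rw [Int.not_even_iff_odd]; exact_mod_cast h), smul_mul_assoc, fnMk_smul_right,
        fnMk_mul_fnMk]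
  exact LinearMap.congr_fun (LinearMap.congr_fun h f) g

/-- Derivatives acting on different tensor factors commute. On the same factor one uses symmetry of
second derivatives, commuting polynomial derivatives, or anticommuting contractions, so a sign
arises only for two odd coordinates. -/
theorem pd_pd (z y : V.Crd) (f : V.Fn) :
    V.pd z (V.pd y f) = sg (z.deg * y.deg) • V.pd y (V.pd z f) := by
  have h : V.pd z ∘ₗ V.pd y = sg (z.deg * y.deg) • V.pd y ∘ₗ V.pd z := by
    refine V.linearMap_ext_gen fun g a w => ?_
    change V.pd z (V.pd y (V.fnMk _ _ _)) = sg (z.deg * y.deg) • V.pd y (V.pd z (V.fnMk _ _ _))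
    rw [sg_mul]
    rcases crd_cases z with hz | hz | hz
    · rw [if_pos (by simp [hz]), one_smul]
      rcases crd_cases y with hy | hy | hy
      · simp only [pd_fnMk_of_zero V hz, pd_fnMk_of_zero V hy]
        rw [smoothPartial_comm]
      · simp only [pd_fnMk_of_zero V hz, pd_fnMk_of_even V hy]
      · simp only [pd_fnMk_of_zero V hz, pd_fnMk_of_odd V hy]
    · rw [if_pos (by exact_mod_cast hz.2), one_smul]
      rcases crd_cases y with hy | hy | hy
      · simp only [pd_fnMk_of_even V hz, pd_fnMk_of_zero V hy]
      · simp only [pd_fnMk_of_even V hz, pd_fnMk_of_even V hy]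
        congr 1
        rw [MvPolynomial.pderiv_monomial, MvPolynomial.pderiv_monomial, MvPolynomial.pderiv_monomial,
          MvPolynomial.pderiv_monomial, tsub_right_comm]
        congr 1
        simp only [Finsupp.tsub_apply, Finsupp.single_apply]
        by_cases h : (⟨z, hz⟩ : V.CrdEven) = ⟨y, hy⟩
        · simp [h]
        · simp [h, Ne.symm h, mul_comm]
      · simp only [pd_fnMk_of_even V hz, pd_fnMk_of_odd V hy]
    · rw [if_neg (by rw [Int.not_even_iff_odd]; exact_mod_cast hz)]
      rcases crd_cases y with hy | hy | hy
      · simp only [pd_fnMk_of_odd V hz, pd_fnMk_of_zero V hy]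
        simp [hy]
      · simp only [pd_fnMk_of_odd V hz, pd_fnMk_of_even V hy]
        rw [sg_of_even (by exact_mod_cast hy.2), one_smul]
      · simp only [pd_fnMk_of_odd V hz, pd_fnMk_of_odd V hy]
        rw [sg_of_odd (by exact_mod_cast hy), oddPartial_comm, ← fnMk_smul_right, neg_one_smul]
  exact LinearMap.congr_fun h f

theorem par_pow_pd (m : ℕ) (z : V.Crd) (f : V.Fn) :
    (V.par ^ m) (V.pd z f) = sg (m * z.deg) • V.pd z ((V.par ^ m) f) := by
  have h : (V.par ^ m) ∘ₗ V.pd z = sg (m * z.deg) • V.pd z ∘ₗ (V.par ^ m) := by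
    refine linearMap_ext_homogeneous V.fnDeg_internal fun k x hx => ?_
    change (V.par ^ m) (V.pd z x) = sg (m * z.deg) • V.pd z ((V.par ^ m) x)
    rw [V.par_pow_apply m (V.pd_mem z (sub_add_cancel k _) hx), V.par_pow_apply m hx, map_smul,
      smul_smul, mul_sub, sg_sub, mul_comm]
  exact LinearMap.congr_fun h f

end NPChart

end NPOperad

end

/-! ### The operators `Δ` and the action of graphs on tensor powers -/

noncomputable section

namespace NPOperad

namespace NPChart

variable {n : ℕ} (V : NPChart n)

/-! ## Contraction with the inverse of the symplectic form -/

/-- Evaluation of a family at a pair of coordinates. -/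
def evalPair (M : Type*) [AddCommGroup M] [Module ℝ M] (z w : V.Crd) :
    (V.Crd → V.Crd → M) →ₗ[ℝ] M := LinearMap.proj w ∘ₗ LinearMap.proj z

/-- The sum of a family indexed by pairs of coordinates, weighted by the coefficients of the
operator `Δ`. -/
def pairing (M : Type*) [AddCommGroup M] [Module ℝ M] : (V.Crd → V.Crd → M) →ₗ[ℝ] M :=
  if Odd n then
    ∑ μ, (V.evalPair M (.x μ) (.p μ) + V.evalPair M (.p μ) (.x μ))
    + ∑ k : Fin ((n - 1) / 2), ∑ α,
        (V.evalPair M (.psi k α) (.chi k α) + V.evalPair M (.chi k α) (.psi k α))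
  else
    ∑ μ, (V.evalPair M (.x μ) (.p μ) - V.evalPair M (.p μ) (.x μ))
    + ∑ k : Fin ((n - 1) / 2), ∑ α,
        (V.evalPair M (.psi k α) (.chi k α)
          - sg ((k : ℕ) + 1) • V.evalPair M (.chi k α) (.psi k α))
    + ∑ a, ∑ b, V.κ⁻¹ a b • V.evalPair M (.xi a) (.xi b)

section Pairing

variable {M M' : Type*} [AddCommGroup M] [Module ℝ M] [AddCommGroup M'] [Module ℝ M']

theorem pairing_of_odd (hn : Odd n) (F : V.Crd → V.Crd → M) : V.pairing M F =
    ∑ μ, (F (.x μ) (.p μ) + F (.p μ) (.x μ))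
    + ∑ k : Fin ((n - 1) / 2), ∑ α, (F (.psi k α) (.chi k α) + F (.chi k α) (.psi k α)) := by
  simp only [pairing, if_pos hn, LinearMap.add_apply, LinearMap.sum_apply]
  rfl

theorem pairing_of_not_odd (hn : ¬ Odd n) (F : V.Crd → V.Crd → M) : V.pairing M F =
    ∑ μ, (F (.x μ) (.p μ) - F (.p μ) (.x μ))
    + ∑ k : Fin ((n - 1) / 2), ∑ α,
        (F (.psi k α) (.chi k α) - sg ((k : ℕ) + 1) • F (.chi k α) (.psi k α))
    + ∑ a, ∑ b, V.κ⁻¹ a b • F (.xi a) (.xi b) := by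
  simp only [pairing, if_neg hn, LinearMap.add_apply, LinearMap.sum_apply, LinearMap.sub_apply,
    LinearMap.smul_apply]
  rfl

/-- Linear maps pass through the weighted sum. Statements about `Δ` or the bracket thereby reduce to
statements about two single derivatives, with no distinction between the parities of `n`. -/
theorem map_pairing (L : M →ₗ[ℝ] M') (F : V.Crd → V.Crd → M) :
    L (V.pairing M F) = V.pairing M' fun z w => L (F z w) := by
  by_cases hn : Odd n
  · simp only [pairing_of_odd V hn, map_add, map_sum]
  · simp only [pairing_of_not_odd V hn, map_add, map_sum, map_sub, map_smul]

variable {V} in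
theorem deg_psi_add_deg_chi (k : Fin ((n - 1) / 2)) (α : Fin (V.s k)) :
    Coord.deg (.psi k α : V.Crd) + Coord.deg (.chi k α : V.Crd) = n := by
  have := k.2
  simp only [Coord.deg]
  omega

/-- Only conjugate coordinates are paired, and their degrees add up to `n`; for the coordinates `ξ`
this uses that `n` is even. -/
theorem pairing_congr {F G : V.Crd → V.Crd → M} (h : ∀ z w, z.deg + w.deg = n → F z w = G z w) :
    V.pairing M F = V.pairing M G := by
  have h1 : ∀ μ, F (.x μ) (.p μ) = G (.x μ) (.p μ) := fun μ => h _ _ (zero_add n)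
  have h2 : ∀ μ, F (.p μ) (.x μ) = G (.p μ) (.x μ) := fun μ => h _ _ (add_zero n)
  have h3 : ∀ k α, F (.psi k α) (.chi k α) = G (.psi k α) (.chi k α) := fun k α =>
    h _ _ (deg_psi_add_deg_chi k α)
  have h4 : ∀ k α, F (.chi k α) (.psi k α) = G (.chi k α) (.psi k α) := fun k α =>
    h _ _ ((add_comm _ _).trans (deg_psi_add_deg_chi k α))
  by_cases hn : Odd n
  · simp only [pairing_of_odd V hn, h1, h2, h3, h4]
  · have h5 : ∀ a b, F (.xi a) (.xi b) = G (.xi a) (.xi b) := fun a b => h _ _ (by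
      simp only [Coord.deg]
      rw [Nat.not_odd_iff_even] at hn
      obtain ⟨m, rfl⟩ := hn
      omega)
    simp only [pairing_of_not_odd V hn, h1, h2, h3, h4, h5]

/-- Modulo the subspace `p` the family vanishes on all pairs that occur, and so does its weighted
sum. -/
theorem pairing_mem {p : Submodule ℝ M} {F : V.Crd → V.Crd → M}
    (h : ∀ z w, z.deg + w.deg = n → F z w ∈ p) : V.pairing M F ∈ p := by
  rw [← Submodule.Quotient.mk_eq_zero, ← Submodule.mkQ_apply, map_pairing,
    V.pairing_congr (G := 0) fun z w hzw =>
      show p.mkQ (F z w) = 0 from (Submodule.Quotient.mk_eq_zero p).2 (h z w hzw), map_zero]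

/-- The matrix equals its transpose up to a sign whose square is one, so the transposed inverse with
that sign is again a left inverse. -/
theorem inv_symm (a b : Fin V.c) : V.κ⁻¹ b a = -sg ((n / 2 : ℕ) : ℤ) * V.κ⁻¹ a b := by
  have h1 : V.κ = (-sg ((n / 2 : ℕ) : ℤ)) • V.κ.transpose := by
    ext a b
    exact V.κ_symm a b
  have h2 : V.κ⁻¹ = (-sg ((n / 2 : ℕ) : ℤ)) • V.κ⁻¹.transpose := by
    refine Matrix.inv_eq_left_inv ?_
    nth_rw 2 [h1]
    rw [Matrix.smul_mul, Matrix.mul_smul, smul_smul, neg_mul_neg, sg_mul_self, one_smul,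
      ← Matrix.transpose_mul, Matrix.mul_nonsing_inv _ V.κ_nondeg, Matrix.transpose_one]
  exact congrFun (congrFun h2 b) a

/-- The pairing is symmetric up to the sign `(-1)^(n + 1)`, in the graded sense. -/
theorem pairing_flip (F : V.Crd → V.Crd → M) : (V.pairing M fun z w => F w z)
    = sg (n + 1) • V.pairing M fun z w => sg (z.deg * w.deg) • F z w := by
  by_cases hn : Odd n
  -- For odd `n`, conjugate coordinates have opposite parities, so the graded sign is trivial and
  -- the sum is symmetric.
  · have h : (V.pairing M fun z w => sg (z.deg * w.deg) • F z w) = V.pairing M F :=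
      V.pairing_congr fun z w hzw => by
        have he : Even (z.deg * w.deg) := by
          rw [← hzw, Nat.odd_add] at hn
          rw [Nat.even_mul, ← Nat.not_odd_iff_even, hn]
          tauto
        rw [sg_of_even (by exact_mod_cast he), one_smul]
    have h' : Even ((n : ℤ) + 1) := by exact_mod_cast hn.add_one
    rw [h, sg_of_even h', one_smul, pairing_of_odd V hn, pairing_of_odd V hn]
    simp only [add_comm]
  · have he : Even n := Nat.not_odd_iff_even.1 hn
    have h' : Odd ((n : ℤ) + 1) := by exact_mod_cast he.add_one
    -- For even `n`, conjugate coordinates have equal parities, so the product of their degrees has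
    -- the parity of either one. This is the sign built into the weights of the pairs `ψ`, `χ` and
    -- into the symmetry of `κ`.
    have h1 : ∀ k α, sg (((Coord.deg (.psi k α : V.Crd) : ℕ) : ℤ)
        * ((Coord.deg (.chi k α : V.Crd) : ℕ) : ℤ)) = sg ((k : ℕ) + 1) := fun k α => by
      have hk := k.2
      refine sg_congr ?_
      have h2 : ((Coord.deg (.psi k α : V.Crd) : ℕ) : ℤ) = (k : ℕ) + 1 := by simp [Coord.deg]
      have h3 : ((Coord.deg (.chi k α : V.Crd) : ℕ) : ℤ) = n - ((k : ℕ) + 1) := by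
        simp only [Coord.deg]; omega
      rw [h2, h3]
      have he' : Even (n : ℤ) := by exact_mod_cast he
      simp only [Int.even_sub, Int.even_mul, he', true_iff]
      tauto
    have h2 : sg (((n / 2 : ℕ) : ℤ) * ((n / 2 : ℕ) : ℤ)) = sg ((n / 2 : ℕ) : ℤ) :=
      sg_congr (by simp only [Int.even_sub, Int.even_mul]; tauto)
    rw [sg_of_odd h', neg_one_smul, pairing_of_not_odd V hn, pairing_of_not_odd V hn, neg_add,
      neg_add, ← Finset.sum_neg_distrib, ← Finset.sum_neg_distrib, ← Finset.sum_neg_distrib]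
    congr 1
    · congr 1
      · refine Finset.sum_congr rfl fun μ _ => ?_
        simp [Coord.deg]
      · refine Finset.sum_congr rfl fun k _ => ?_
        rw [← Finset.sum_neg_distrib]
        refine Finset.sum_congr rfl fun α _ => ?_
        rw [h1, mul_comm, h1, smul_smul, sg_mul_self, one_smul]
        abel
    · rw [Finset.sum_comm]
      refine Finset.sum_congr rfl fun a _ => ?_
      rw [← Finset.sum_neg_distrib]
      refine Finset.sum_congr rfl fun b _ => ?_
      rw [inv_symm]
      simp only [Coord.deg]
      rw [h2, smul_smul, ← neg_smul]
      congr 1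
      ring

end Pairing

/-! ## Partial derivatives on tensor powers -/

/-- The effect of `∂/∂z_{(i)}` on the `a`-th factor of a tensor power. -/
def slot {N : ℕ} (z : V.Crd) (i a : Fin N) : V.Fn →ₗ[ℝ] V.Fn :=
  if a < i then V.par ^ z.deg else if a = i then V.pd z else LinearMap.id

theorem slot_of_lt {N : ℕ} (z : V.Crd) {i a : Fin N} (h : a < i) :
    V.slot z i a = V.par ^ z.deg := if_pos h

theorem slot_self {N : ℕ} (z : V.Crd) (i : Fin N) : V.slot z i i = V.pd z := by
  simp [slot]

theorem slot_of_gt {N : ℕ} (z : V.Crd) {i a : Fin N} (h : i < a) :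
    V.slot z i a = LinearMap.id := by
  simp [slot, h.ne', h.not_gt]

theorem pdAt_tprod {N : ℕ} (z : V.Crd) (i : Fin N) (f : Fin N → V.Fn) :
    V.pdAt z i (PiTensorProduct.tprod ℝ f) = PiTensorProduct.tprod ℝ fun a => V.slot z i a (f a) :=
  PiTensorProduct.map_tprod _ _

theorem pdAt_tprod_homogeneous {N : ℕ} (z : V.Crd) (i : Fin N) {k : Fin N → ℤ} {f : Fin N → V.Fn}
    (hf : ∀ a, f a ∈ V.fnDeg (k a)) : V.pdAt z i (PiTensorProduct.tprod ℝ f)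
      = (∏ a, if a < i then sg (z.deg * k a) else 1) •
        PiTensorProduct.tprod ℝ (Function.update f i (V.pd z (f i))) := by
  rw [pdAt_tprod, ← MultilinearMap.map_smul_univ]
  congr 1
  funext a
  rcases lt_trichotomy a i with h | rfl | h
  · rw [slot_of_lt V z h, if_pos h, Function.update_of_ne h.ne, V.par_pow_apply _ (hf a)]
  · rw [slot_self, if_neg (lt_irrefl _), Function.update_self, one_smul]
  · rw [slot_of_gt V z h, if_neg h.not_gt, Function.update_of_ne h.ne', one_smul, LinearMap.id_apply]

theorem tensor_ext {N : ℕ} {M : Type*} [AddCommGroup M] [Module ℝ M] {s t : V.Tensor N →ₗ[ℝ] M}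
    (h : ∀ f, s (PiTensorProduct.tprod ℝ f) = t (PiTensorProduct.tprod ℝ f)) : s = t :=
  PiTensorProduct.ext (MultilinearMap.ext h)

theorem tensor_ext_homogeneous {N : ℕ} {M : Type*} [AddCommGroup M] [Module ℝ M]
    {s t : V.Tensor N →ₗ[ℝ] M} (h : ∀ (k : Fin N → ℤ) (f : Fin N → V.Fn),
      (∀ a, f a ∈ V.fnDeg (k a)) → s (PiTensorProduct.tprod ℝ f) = t (PiTensorProduct.tprod ℝ f)) :
    s = t :=
  PiTensorProduct.ext (multilinearMap_ext_homogeneous V.fnDeg_internal h)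

/-- On the earlier of the two factors `i` and `j`, one operator differentiates and the other takes a
parity, or both differentiate when `i = j`; there the graded sign appears. On every other factor two
parities commute or one of the operators is the identity. -/
theorem slot_slot {N : ℕ} (z w : V.Crd) (i j a : Fin N) (f : V.Fn) :
    V.slot z i a (V.slot w j a f)
      = (if a = min i j then sg (z.deg * w.deg) else 1) • V.slot w j a (V.slot z i a f) := by
  have hpow : ∀ m m' : ℕ, (V.par ^ m) ((V.par ^ m') f) = (V.par ^ m') ((V.par ^ m) f) :=
    fun m m' => LinearMap.congr_fun (pow_mul_comm V.par m m') f
  rcases lt_trichotomy a i with hi | rfl | hi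
  · have h1 : a ≠ i := hi.ne
    rcases lt_trichotomy a j with hj | rfl | hj
    · rw [if_neg (lt_min hi hj).ne, one_smul, slot_of_lt V z hi, slot_of_lt V w hj, hpow]
    · rw [if_pos (min_eq_right hi.le).symm, slot_of_lt V z hi, slot_self, par_pow_pd]
    · rw [if_neg ((min_le_right _ _).trans_lt hj).ne', one_smul, slot_of_gt V w hj]; rfl
  · rcases lt_trichotomy a j with hj | rfl | hj
    · rw [if_pos (min_eq_left hj.le).symm, slot_self, slot_of_lt V w hj, par_pow_pd, smul_smul,
        mul_comm (w.deg : ℤ), sg_mul_self, one_smul]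
    · rw [if_pos (min_self _).symm, slot_self, slot_self, pd_pd]
    · rw [if_neg ((min_le_right _ _).trans_lt hj).ne', one_smul, slot_of_gt V w hj]; rfl
  · rw [if_neg ((min_le_left _ _).trans_lt hi).ne', one_smul, slot_of_gt V z hi]; rfl

theorem pdAt_mul_pdAt {N : ℕ} (z w : V.Crd) (i j : Fin N) :
    V.pdAt z i * V.pdAt w j = sg (z.deg * w.deg) • (V.pdAt w j * V.pdAt z i) := by
  refine V.tensor_ext fun f => ?_
  rw [LinearMap.smul_apply, Module.End.mul_apply, Module.End.mul_apply, pdAt_tprod, pdAt_tprod,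
    pdAt_tprod, pdAt_tprod]
  simp only [V.slot_slot z w i j]
  rw [MultilinearMap.map_smul_univ]
  congr 1
  rw [Finset.prod_ite_eq' Finset.univ (min i j) fun _ => sg (z.deg * w.deg),
    if_pos (Finset.mem_univ _)]

/-! ## The operators `Δ` -/

theorem Delta_eq_pairing {N : ℕ} (i j : Fin N) :
    V.Delta i j = V.pairing (Module.End ℝ (V.Tensor N)) fun z w => V.pdAt z i * V.pdAt w j := by
  by_cases hn : Odd n
  · rw [pairing_of_odd V hn, Delta, if_pos hn]
  · rw [pairing_of_not_odd V hn, Delta, if_neg hn]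

/-- Reversing an edge exchanges the two derivatives, which costs the graded sign of the pair. The
symmetry of the pairing contributes the same sign once more, so only `(-1)^(n+1) = (-1)^d` remains.
-/
theorem Delta_flip {N : ℕ} (i j : Fin N) : V.Delta j i = sg (n + 1) • V.Delta i j := by
  have h : ∀ z w : V.Crd, V.pdAt z j * V.pdAt w i
      = (fun w z : V.Crd => sg (z.deg * w.deg) • (V.pdAt w i * V.pdAt z j)) w z :=
    fun z w => V.pdAt_mul_pdAt z w j i
  rw [Delta_eq_pairing, Delta_eq_pairing]
  simp only [h]
  rw [pairing_flip V fun w z : V.Crd => sg (z.deg * w.deg) • (V.pdAt w i * V.pdAt z j)]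
  congr 1
  refine V.pairing_congr fun z w _ => ?_
  rw [mul_comm (w.deg : ℤ), smul_smul, sg_mul_self, one_smul]

theorem pdAt_mul_Delta {N : ℕ} (z : V.Crd) (i a b : Fin N) :
    V.pdAt z i * V.Delta a b = sg (z.deg * n) • (V.Delta a b * V.pdAt z i) := by
  rw [Delta_eq_pairing]
  have h1 := V.map_pairing (LinearMap.mulLeft ℝ (V.pdAt z i)) fun x y => V.pdAt x a * V.pdAt y b
  have h2 := V.map_pairing (sg (z.deg * n) • LinearMap.mulRight ℝ (V.pdAt z i))
    fun x y => V.pdAt x a * V.pdAt y b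
  refine h1.trans (Eq.trans ?_ h2.symm)
  refine V.pairing_congr fun x y hxy => ?_
  simp only [LinearMap.mulLeft_apply, LinearMap.smul_apply, LinearMap.mulRight_apply]
  rw [← mul_assoc, pdAt_mul_pdAt, smul_mul_assoc, mul_assoc, V.pdAt_mul_pdAt z y i b, mul_smul_comm,
    smul_smul, ← sg_add, ← mul_add, ← Nat.cast_add, hxy, mul_assoc]

/-- Two derivatives of total degree `n` pass an operator of the same kind, giving `(-1)^(n·n) =
(-1)^n`, which is the exchange sign `(-1)^(d+1)` of edges. -/
theorem Delta_mul_Delta {N : ℕ} (a b c e : Fin N) :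
    V.Delta a b * V.Delta c e = sg n • (V.Delta c e * V.Delta a b) := by
  rw [V.Delta_eq_pairing a b]
  have h1 := V.map_pairing (LinearMap.mulRight ℝ (V.Delta c e)) fun x y => V.pdAt x a * V.pdAt y b
  have h2 := V.map_pairing (sg n • LinearMap.mulLeft ℝ (V.Delta c e))
    fun x y => V.pdAt x a * V.pdAt y b
  refine h1.trans (Eq.trans ?_ h2.symm)
  refine V.pairing_congr fun x y hxy => ?_
  simp only [LinearMap.mulLeft_apply, LinearMap.smul_apply, LinearMap.mulRight_apply]
  rw [mul_assoc, V.pdAt_mul_Delta y b, mul_smul_comm, ← mul_assoc, V.pdAt_mul_Delta x a,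
    smul_mul_assoc, smul_smul, ← sg_add, ← add_mul, ← Nat.cast_add, add_comm y.deg, hxy, mul_assoc]
  congr 1
  exact sg_congr (by simp only [Int.even_sub, Int.even_mul]; tauto)

/-- The action of graphs on tensor powers. -/
def graphOp (N : ℕ) : GraAlg ((n : ℤ) + 1) N →ₐ[ℝ] Module.End ℝ (V.Tensor N) :=
  GraAlg.lift _ (fun e => V.Delta e.1 e.2) (fun a b => V.Delta_flip a b) fun e e' => by
    rw [V.Delta_mul_Delta e'.1]
    congr 1
    exact sg_congr ⟨-1, by ring⟩

theorem graphOp_edge {N : ℕ} (e : Fin N × Fin N) :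
    V.graphOp N (GraAlg.edge _ e) = V.Delta e.1 e.2 := GraAlg.lift_edge _ _ _ _ _

theorem graphOp_graph {N : ℕ} (E : List (Fin N × Fin N)) :
    V.graphOp N (GraAlg.graph _ E) = (E.map fun e => V.Delta e.1 e.2).prod := by
  rw [GraAlg.graph, map_list_prod, List.map_map]
  congr 1
  exact List.map_congr_left fun e _ => V.graphOp_edge e

/-! ## Multiplication of functions -/

theorem mulMap_tprod {N : ℕ} (f : Fin N → V.Fn) :
    V.mulMap N (PiTensorProduct.tprod ℝ f) = (List.ofFn f).prod := by
  rw [mulMap, PiTensorProduct.lift.tprod, MultilinearMap.mkPiAlgebraFin_apply]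

theorem one_mem_fnDeg : (1 : V.Fn) ∈ V.fnDeg 0 :=
  V.gen_mem 1 0 []

theorem prod_ofFn_mem {N : ℕ} {k : Fin N → ℤ} {f : Fin N → V.Fn}
    (hf : ∀ a, f a ∈ V.fnDeg (k a)) : (List.ofFn f).prod ∈ V.fnDeg (∑ a, k a) := by
  induction N with
  | zero => simpa using V.one_mem_fnDeg
  | succ N ih =>
    rw [List.ofFn_succ, List.prod_cons]
    exact V.fnDeg_mul (Fin.sum_univ_succ k).symm (hf 0) (ih fun a => hf a.succ)

theorem par_pow_prod {N : ℕ} (m : ℕ) (f : Fin N → V.Fn) :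
    (V.par ^ m) (List.ofFn f).prod = (List.ofFn fun a => (V.par ^ m) (f a)).prod := by
  have h : (V.par ^ m) ∘ₗ V.mulMap N = V.mulMap N ∘ₗ PiTensorProduct.map fun _ => V.par ^ m := by
    refine V.tensor_ext_homogeneous fun k f hf => ?_
    rw [LinearMap.comp_apply, LinearMap.comp_apply, PiTensorProduct.map_tprod]
    simp only [fun a => V.par_pow_apply m (hf a)]
    rw [MultilinearMap.map_smul_univ, map_smul, mulMap_tprod,
      V.par_pow_apply m (V.prod_ofFn_mem hf), ← sg_sum, Finset.mul_sum]
  have h1 := LinearMap.congr_fun h (PiTensorProduct.tprod ℝ f)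
  rwa [LinearMap.comp_apply, LinearMap.comp_apply, PiTensorProduct.map_tprod, mulMap_tprod,
    mulMap_tprod] at h1

theorem par_pow_one (m : ℕ) : (V.par ^ m) (1 : V.Fn) = 1 := by
  rw [V.par_pow_apply m V.one_mem_fnDeg, mul_zero, sg_zero, one_smul]

theorem pd_one (z : V.Crd) : V.pd z 1 = 0 := by
  have h := V.pd_mul z 1 1
  rw [par_pow_one, mul_one, mul_one, one_mul] at h
  exact left_eq_add.1 h

/-- The graded Leibniz rule for products of several functions. -/
theorem pd_prod {N : ℕ} (z : V.Crd) (f : Fin N → V.Fn) :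
    V.pd z (List.ofFn f).prod = ∑ b, (List.ofFn fun a => V.slot z b a (f a)).prod := by
  induction N with
  | zero => simpa using V.pd_one z
  | succ N ih =>
    rw [List.ofFn_succ, List.prod_cons, pd_mul, ih, Fin.sum_univ_succ, Finset.mul_sum]
    congr 1
    · rw [List.ofFn_succ, List.prod_cons, slot_self]
      congr 3
    · refine Finset.sum_congr rfl fun b _ => ?_
      rw [List.ofFn_succ, List.prod_cons, slot_of_lt V z b.succ_pos]
      congr 3
      funext a
      simp only [slot, Fin.succ_lt_succ_iff, Fin.succ_inj]

end NPChart

end NPOperad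

end

/-! ### Degrees, and equivariance of the action on functions -/

noncomputable section

namespace NPOperad

namespace NPChart

variable {n : ℕ} (V : NPChart n)

/-! ## Degrees of the operators on tensor powers -/

/-- The elements of degree `k` of a tensor power. -/
def tensorDeg (N : ℕ) (k : ℤ) : Submodule ℝ (V.Tensor N) :=
  Submodule.span ℝ {t | ∃ (j : Fin N → ℤ) (f : Fin N → V.Fn), (∀ a, f a ∈ V.fnDeg (j a)) ∧
    ∑ a, j a = k ∧ PiTensorProduct.tprod ℝ f = t}

theorem tprod_mem_tensorDeg {N : ℕ} {j : Fin N → ℤ} {f : Fin N → V.Fn}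
    (hf : ∀ a, f a ∈ V.fnDeg (j a)) :
    PiTensorProduct.tprod ℝ f ∈ V.tensorDeg N (∑ a, j a) :=
  Submodule.subset_span ⟨j, f, hf, rfl, rfl⟩

theorem mulMap_mem {N : ℕ} {k : ℤ} {t : V.Tensor N} (ht : t ∈ V.tensorDeg N k) :
    V.mulMap N t ∈ V.fnDeg k := by
  refine (Submodule.span_le (p := (V.fnDeg k).comap (V.mulMap N))).2 ?_ ht
  rintro _ ⟨j, f, hf, rfl, rfl⟩
  rw [SetLike.mem_coe, Submodule.mem_comap, mulMap_tprod]
  exact V.prod_ofFn_mem hf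

theorem pdAt_mem {N : ℕ} (z : V.Crd) (i : Fin N) {k e : ℤ} (he : e + z.deg = k) {t : V.Tensor N}
    (ht : t ∈ V.tensorDeg N k) : V.pdAt z i t ∈ V.tensorDeg N e := by
  refine (Submodule.span_le (p := (V.tensorDeg N e).comap (V.pdAt z i))).2 ?_ ht
  rintro _ ⟨j, f, hf, rfl, rfl⟩
  rw [SetLike.mem_coe, Submodule.mem_comap, V.pdAt_tprod_homogeneous z i hf]
  refine Submodule.smul_mem _ _ ?_
  have h := V.tprod_mem_tensorDeg (j := Function.update j i (j i - z.deg))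
    (f := Function.update f i (V.pd z (f i))) fun a => by
      by_cases ha : a = i
      · subst ha
        rw [Function.update_self, Function.update_self]
        exact V.pd_mem z (sub_add_cancel _ _) (hf a)
      · rw [Function.update_of_ne ha, Function.update_of_ne ha]
        exact hf a
  rw [Finset.sum_update_of_mem (Finset.mem_univ i)] at h
  rw [← Finset.add_sum_erase _ _ (Finset.mem_univ i)] at he
  rw [Finset.sdiff_singleton_eq_erase] at h
  convert h using 2
  linarith

theorem Delta_mem {N : ℕ} (i j : Fin N) {k e : ℤ} (he : e + n = k) {t : V.Tensor N}
    (ht : t ∈ V.tensorDeg N k) : V.Delta i j t ∈ V.tensorDeg N e := by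
  have h := V.map_pairing (LinearMap.applyₗ t : Module.End ℝ (V.Tensor N) →ₗ[ℝ] V.Tensor N)
    fun z w => V.pdAt z i * V.pdAt w j
  rw [← Delta_eq_pairing] at h
  refine (congrArg (· ∈ V.tensorDeg N e) h).mpr (V.pairing_mem fun z w hzw => ?_)
  have hw : (e + z.deg) + w.deg = k := by
    have h1 : (z.deg : ℤ) + w.deg = n := by exact_mod_cast hzw
    linarith
  exact V.pdAt_mem z i rfl (V.pdAt_mem w j hw ht)

theorem graphOp_graph_mem {N : ℕ} (E : List (Fin N × Fin N)) {k e : ℤ}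
    (he : e + E.length * n = k) {t : V.Tensor N} (ht : t ∈ V.tensorDeg N k) :
    V.graphOp N (GraAlg.graph _ E) t ∈ V.tensorDeg N e := by
  rw [graphOp_graph]
  induction E generalizing e with
  | nil =>
    have : e = k := by simpa using he
    rw [this]
    exact ht
  | cons x E ih =>
    rw [List.map_cons, List.prod_cons, Module.End.mul_apply]
    refine V.Delta_mem _ _ rfl (ih ?_)
    rw [← he, List.length_cons]
    push_cast; ring

/-- The action of graphs on functions. -/
def graphMult (r : ℕ) : GraAlg ((n : ℤ) + 1) (r + 1) →ₗ[ℝ]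
    MultilinearMap ℝ (fun _ : Fin (r + 1) => V.Fn) V.Fn where
  toFun X := (V.mulMap (r + 1) ∘ₗ V.graphOp (r + 1) X).compMultilinearMap (PiTensorProduct.tprod ℝ)
  map_add' X Y := MultilinearMap.ext fun f => by simp
  map_smul' c X := MultilinearMap.ext fun f => by simp

theorem graphMult_apply {r : ℕ} (X : GraAlg ((n : ℤ) + 1) (r + 1)) (f : Fin (r + 1) → V.Fn) :
    V.graphMult r X f = V.mulMap (r + 1) (V.graphOp (r + 1) X (PiTensorProduct.tprod ℝ f)) := rfl

theorem graphMult_mem {r : ℕ} {k : ℤ} {X : GraAlg ((n : ℤ) + 1) (r + 1)}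
    (hX : X ∈ graDeg ((n : ℤ) + 1) (r + 1) k) : V.graphMult r X ∈ homDeg V.fnDeg r k := by
  refine (Submodule.span_le (p := (homDeg V.fnDeg r k).comap (V.graphMult r))).2 ?_ hX
  rintro _ ⟨E, rfl, rfl⟩ j f hf
  exact V.mulMap_mem (V.graphOp_graph_mem E (by ring) (V.tprod_mem_tensorDeg hf))

/-! ## Permutations of the factors -/

/-- The permutation of the factors of a tensor power, with Koszul signs. -/
def permute {N : ℕ} (σ : Equiv.Perm (Fin N)) : V.Tensor N →ₗ[ℝ] V.Tensor N :=
  PiTensorProduct.lift (∑ b : Fin N → Bool, koszul σ b •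
    ((PiTensorProduct.tprod ℝ).compLinearMap
      fun a => parityProj V.fnDeg_internal (b (σ⁻¹ a))).domDomCongr σ⁻¹)

theorem permute_tprod_eq_sum {N : ℕ} (σ : Equiv.Perm (Fin N)) (f : Fin N → V.Fn) :
    V.permute σ (PiTensorProduct.tprod ℝ f) = ∑ b : Fin N → Bool, koszul σ b •
      PiTensorProduct.tprod ℝ fun a =>
        parityProj V.fnDeg_internal (b (σ⁻¹ a)) (f (σ⁻¹ a)) := by
  rw [permute, PiTensorProduct.lift.tprod]
  simp

theorem permute_tprod {N : ℕ} (σ : Equiv.Perm (Fin N)) {k : Fin N → ℤ} {f : Fin N → V.Fn}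
    (hf : ∀ a, f a ∈ V.fnDeg (k a)) : V.permute σ (PiTensorProduct.tprod ℝ f)
      = kz σ k • PiTensorProduct.tprod ℝ fun a => f (σ⁻¹ a) := by
  rw [permute_tprod_eq_sum, Finset.sum_eq_single fun a => decide (Odd (k a))]
  · rw [← koszul_eq_kz]
    congr 2
    funext a
    rw [parityProj_apply V.fnDeg_internal _ (hf _), if_pos rfl]
  · intro b _ hb
    obtain ⟨a, ha⟩ := Function.ne_iff.1 hb
    rw [MultilinearMap.map_coord_zero _ (σ a), smul_zero]
    rw [parityProj_apply V.fnDeg_internal _ (hf _), if_neg]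
    simpa only [Equiv.Perm.inv_def, Equiv.symm_apply_apply] using ha
  · intro h
    exact absurd (Finset.mem_univ _) h

/-- A derivative passes the factors to its left, which differ before and after the permutation. It
also lowers the degree of one factor, which changes the Koszul sign of the permutation by exactly
the quotient of these two signs. -/
theorem pdAt_mul_permute {N : ℕ} (σ : Equiv.Perm (Fin N)) (z : V.Crd) (i : Fin N) :
    V.pdAt z (σ i) ∘ₗ V.permute σ = V.permute σ ∘ₗ V.pdAt z i := by
  refine V.tensor_ext_homogeneous fun k f hf => ?_
  have hk' : ∀ a, Function.update f i (V.pd z (f i)) a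
      ∈ V.fnDeg (Function.update k i (k i - z.deg) a) := fun a => by
    by_cases ha : a = i
    · subst ha
      rw [Function.update_self, Function.update_self]
      exact V.pd_mem z (sub_add_cancel _ _) (hf a)
    · rw [Function.update_of_ne ha, Function.update_of_ne ha]
      exact hf a
  -- The degree of the differentiated factor drops, hence the negative shift, which has no effect on
  -- signs.
  have h1 := kz_update σ k (Function.update k i (k i - z.deg)) i (-z.deg)
    (by rw [Function.update_self]; ring) fun a ha => Function.update_of_ne ha _ _
  have h2 : (∏ a, if a < σ i then sg (z.deg * k (σ⁻¹ a)) else 1)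
      = ∏ a, if σ a < σ i then sg (-z.deg * k a) else 1 := by
    rw [← Equiv.prod_comp σ]
    refine Finset.prod_congr rfl fun a _ => ?_
    rw [Equiv.Perm.inv_def, Equiv.symm_apply_apply, neg_mul, sg_neg]
  have h3 : (∏ a, if a < i then sg (z.deg * k a) else 1)
      * (∏ a, if a < i then sg (-z.deg * k a) else 1) = 1 := by
    rw [← Finset.prod_mul_distrib]
    refine Finset.prod_eq_one fun a _ => ?_
    split_ifs
    · rw [neg_mul, sg_neg, sg_mul_self]
    · exact one_mul 1
  have h4 : (fun a => Function.update f i (V.pd z (f i)) (σ⁻¹ a))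
      = Function.update (fun a => f (σ⁻¹ a)) (σ i) (V.pd z (f (σ⁻¹ (σ i)))) := by
    funext a
    by_cases ha : a = σ i
    · subst ha
      rw [Function.update_self, Equiv.Perm.inv_def, Equiv.symm_apply_apply, Function.update_self]
    · rw [Function.update_of_ne ha, Function.update_of_ne]
      intro h
      exact ha (by rw [← h, Equiv.Perm.inv_def, Equiv.apply_symm_apply])
  rw [LinearMap.comp_apply, LinearMap.comp_apply, V.permute_tprod σ hf, map_smul,
    V.pdAt_tprod_homogeneous z (σ i) (k := fun a => k (σ⁻¹ a)) fun a => hf (σ⁻¹ a),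
    V.pdAt_tprod_homogeneous z i hf, map_smul, V.permute_tprod σ hk', smul_smul, smul_smul, h4, h1,
    h2]
  congr 1
  linear_combination (-kz σ k * ∏ a, if σ a < σ i then sg (-z.deg * k a) else 1) * h3

theorem Delta_comp_permute {N : ℕ} (σ : Equiv.Perm (Fin N)) (i j : Fin N) :
    V.Delta (σ i) (σ j) * V.permute σ = V.permute σ * V.Delta i j := by
  rw [Delta_eq_pairing, Delta_eq_pairing]
  have h1 := V.map_pairing (LinearMap.mulRight ℝ (V.permute σ : Module.End ℝ (V.Tensor N)))
    fun z w => V.pdAt z (σ i) * V.pdAt w (σ j)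
  have h2 := V.map_pairing (LinearMap.mulLeft ℝ (V.permute σ : Module.End ℝ (V.Tensor N)))
    fun z w => V.pdAt z i * V.pdAt w j
  refine h1.trans (Eq.trans ?_ h2.symm)
  refine V.pairing_congr fun z w _ => ?_
  have hz : V.pdAt z (σ i) * V.permute σ = V.permute σ * V.pdAt z i := V.pdAt_mul_permute σ z i
  have hw : V.pdAt w (σ j) * V.permute σ = V.permute σ * V.pdAt w j := V.pdAt_mul_permute σ w j
  rw [LinearMap.mulRight_apply, LinearMap.mulLeft_apply, mul_assoc, hw, ← mul_assoc, hz, mul_assoc]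

theorem graphOp_comp_permute {N : ℕ} (σ : Equiv.Perm (Fin N)) (X : GraAlg ((n : ℤ) + 1) N) :
    V.graphOp N X * V.permute σ = V.permute σ * V.graphOp N (GraAlg.relabel _ ⇑σ⁻¹ X) := by
  induction X using GraAlg.induction with
  | algebraMap r => rw [AlgHom.commutes, AlgHom.commutes, AlgHom.commutes, Algebra.commutes]
  | edge e =>
    rw [GraAlg.relabel_edge, graphOp_edge, graphOp_edge, ← Delta_comp_permute,
      Equiv.Perm.inv_def, Equiv.apply_symm_apply, Equiv.apply_symm_apply]
  | mul X Y hX hY => rw [map_mul, mul_assoc, hY, ← mul_assoc, hX, map_mul, map_mul, mul_assoc]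
  | add X Y hX hY => rw [map_add, add_mul, hX, hY, map_add, map_add, mul_add]

/-- An adjacent transposition inverts only the pair it exchanges. -/
theorem kz_swap {M : ℕ} (i : Fin M) (k : Fin (M + 1) → ℤ) :
    kz (Equiv.swap i.castSucc i.succ) k = sg (k i.castSucc * k i.succ) := by
  have h : ∀ u v : Fin (M + 1), u < v → (u ≠ i.castSucc ∨ v ≠ i.succ) →
      Equiv.swap i.castSucc i.succ u < Equiv.swap i.castSucc i.succ v := by
    intro u v huv h
    simp only [Equiv.swap_apply_def]
    split_ifs <;> simp only [Fin.ext_iff, Fin.lt_def, Fin.val_castSucc, Fin.val_succ, ne_eq] at * <;>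
      lia
  rw [kz, pairProd, Finset.prod_eq_single i.castSucc, Finset.prod_eq_single i.succ]
  · rw [if_pos i.castSucc_lt_succ, if_neg]
    rw [Equiv.swap_apply_left, Equiv.swap_apply_right]
    simp [i.castSucc_lt_succ, i.castSucc_lt_succ.not_gt]
  · intro v _ hv
    split_ifs with h1 h2
    · rfl
    · exact absurd (iff_of_true h1 (h _ _ h1 (.inr hv))) h2
    · rfl
  · simp
  · intro u _ hu
    refine Finset.prod_eq_one fun v _ => ?_
    split_ifs with h1 h2
    · rfl
    · exact absurd (iff_of_true h1 (h _ _ h1 (.inl hu))) h2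
    · rfl
  · simp

theorem prod_swap {M : ℕ} (i : Fin M) {k : Fin (M + 1) → ℤ} {f : Fin (M + 1) → V.Fn}
    (hf : ∀ a, f a ∈ V.fnDeg (k a)) : sg (k i.castSucc * k i.succ) •
      (List.ofFn fun a => f (Equiv.swap i.castSucc i.succ a)).prod = (List.ofFn f).prod := by
  induction M with
  | zero => exact i.elim0
  | succ M ih =>
    induction i using Fin.cases with
    | zero =>
      have h1 : ∀ a : Fin M, Equiv.swap (0 : Fin (M + 2)) 1 a.succ.succ = a.succ.succ := fun a =>
        Equiv.swap_apply_of_ne_of_ne (by simp [Fin.ext_iff]) (by simp [Fin.ext_iff])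
      simp only [List.ofFn_succ, List.prod_cons, Fin.castSucc_zero, Fin.succ_zero_eq_one, h1,
        Equiv.swap_apply_left, Equiv.swap_apply_right]
      rw [← mul_assoc, ← mul_assoc, V.mul_comm_graded (hf 0) (hf 1), smul_mul_assoc]
    | succ i =>
      have h0 : Equiv.swap i.succ.castSucc i.succ.succ (0 : Fin (M + 2)) = 0 :=
        Equiv.swap_apply_of_ne_of_ne (by simp [Fin.ext_iff]) (by simp [Fin.ext_iff])
      have h1 : ∀ a : Fin (M + 1), Equiv.swap i.succ.castSucc i.succ.succ a.succ
          = (Equiv.swap i.castSucc i.succ a).succ := fun a => by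
        simp only [Equiv.swap_apply_def, ← Fin.succ_castSucc, Fin.succ_inj]
        split_ifs <;> rfl
      rw [List.ofFn_succ, List.prod_cons, List.ofFn_succ (f := f), List.prod_cons]
      simp only [h0, h1]
      rw [← mul_smul_comm, ← ih i (f := fun a => f a.succ) (k := fun a => k a.succ)
        fun a => hf a.succ, ← Fin.succ_castSucc]

/-- Adjacent transpositions generate the symmetric group, and for them the claim is graded
commutativity of two neighbours; `kz_mul` assembles the signs. -/
theorem prod_perm {M : ℕ} (σ : Equiv.Perm (Fin (M + 1))) {k : Fin (M + 1) → ℤ}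
    {f : Fin (M + 1) → V.Fn} (hf : ∀ a, f a ∈ V.fnDeg (k a)) :
    kz σ k • (List.ofFn fun a => f (σ⁻¹ a)).prod = (List.ofFn f).prod := by
  have hσ : σ ∈ Submonoid.closure
      (Set.range fun i : Fin M => Equiv.swap i.castSucc i.succ) := by
    rw [Equiv.Perm.mclosure_swap_castSucc_succ]; trivial
  induction hσ using Submonoid.closure_induction_left generalizing k f with
  | one => simp [kz_one]
  | mul_left s hs σ _ ih =>
    obtain ⟨i, rfl⟩ := hs
    rw [kz_mul, mul_smul]
    refine Eq.trans ?_ (ih hf)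
    congr 1
    have h := V.prod_swap i (f := fun a => f (σ⁻¹ a)) (k := fun a => k (σ⁻¹ a)) fun a => hf _
    rw [kz_swap, ← h]
    simp only [mul_inv_rev, Equiv.Perm.mul_apply, Equiv.swap_inv]

theorem mulMap_permute {M : ℕ} (σ : Equiv.Perm (Fin (M + 1))) :
    V.mulMap (M + 1) ∘ₗ V.permute σ = V.mulMap (M + 1) := by
  refine V.tensor_ext_homogeneous fun k f hf => ?_
  rw [LinearMap.comp_apply, V.permute_tprod σ hf, map_smul, mulMap_tprod, mulMap_tprod,
    V.prod_perm σ hf]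

/-- On homogeneous functions the action on multilinear maps is precomposition with the signed
permutation of tensor factors. That permutation exchanges a graph with its relabelling and is
absorbed by the product of all factors. -/
theorem graphMult_relabel {r : ℕ} (σ : Equiv.Perm (Fin (r + 1)))
    (X : GraAlg ((n : ℤ) + 1) (r + 1)) :
    V.graphMult r (GraAlg.relabel _ ⇑σ⁻¹ X) = multAct V.fnDeg_internal σ (V.graphMult r X) := by
  refine multilinearMap_ext_homogeneous V.fnDeg_internal fun k f hf => ?_
  rw [multAct_homogeneous V.fnDeg_internal σ _ hf, graphMult_apply, graphMult_apply, ← map_smul,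
    ← map_smul, ← V.permute_tprod σ hf]
  have h1 := LinearMap.congr_fun (V.graphOp_comp_permute σ X) (PiTensorProduct.tprod ℝ f)
  rw [Module.End.mul_apply, Module.End.mul_apply] at h1
  rw [h1]
  exact (LinearMap.congr_fun (V.mulMap_permute σ) _).symm

end NPChart

end NPOperad

end

/-! ### Compatibility of the action on functions with insertion of graphs -/

noncomputable section

namespace NPOperad

theorem outer_lt_outer {p q l : ℕ} (hl : p + q = l) {i a a' : Fin (p + 1)} (ha : a ≠ i)
    (ha' : a' ≠ i) : outer hl i a' < outer hl i a ↔ a' < a := by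
  by_cases h : a' = a
  · subst h; simp
  · exact spread_lt_iff hl i (by simp [spread_of_ne hl ha']) (by simp [spread_of_ne hl ha]) h

theorem inner_lt_outer {p q l : ℕ} (hl : p + q = l) {i a : Fin (p + 1)} (ha : a ≠ i)
    (b : Fin (q + 1)) : inner hl i b < outer hl i a ↔ i < a :=
  spread_lt_iff hl i (by simp [spread_self hl]) (by simp [spread_of_ne hl ha]) ha.symm

theorem outer_lt_inner {p q l : ℕ} (hl : p + q = l) {i a : Fin (p + 1)} (ha : a ≠ i)
    (b : Fin (q + 1)) : outer hl i a < inner hl i b ↔ a < i :=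
  spread_lt_iff hl i (by simp [spread_of_ne hl ha]) (by simp [spread_self hl]) ha

namespace NPChart

variable {n : ℕ} (V : NPChart n)

/-! ## Multiplication of consecutive factors -/

/-- The arguments `f` with those of the block at `i` multiplied. -/
def blockProd {p q l : ℕ} (hl : p + q = l) (i : Fin (p + 1)) (f : Fin (l + 1) → V.Fn) :
    Fin (p + 1) → V.Fn :=
  compArgs hl i LinearMap.id (MultilinearMap.mkPiAlgebraFin ℝ (q + 1) V.Fn) f

theorem blockProd_self {p q l : ℕ} (hl : p + q = l) (i : Fin (p + 1)) (f : Fin (l + 1) → V.Fn) :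
    V.blockProd hl i f i = (List.ofFn fun b => f (inner hl i b)).prod := by
  rw [blockProd, compArgs_self, MultilinearMap.mkPiAlgebraFin_apply]

theorem blockProd_of_ne {p q l : ℕ} (hl : p + q = l) {i a : Fin (p + 1)} (h : a ≠ i)
    (f : Fin (l + 1) → V.Fn) : V.blockProd hl i f a = f (outer hl i a) := by
  rcases lt_or_gt_of_ne h with h | h
  · rw [blockProd, compArgs_of_lt hl h]; rfl
  · rw [blockProd, compArgs_of_gt hl h]

/-- This is associativity; the first factor is peeled off repeatedly until the block comes first. -/
theorem prod_blockProd {p q l : ℕ} (hl : p + q = l) (i : Fin (p + 1)) (f : Fin (l + 1) → V.Fn) :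
    (List.ofFn (V.blockProd hl i f)).prod = (List.ofFn f).prod := by
  induction p generalizing l with
  | zero =>
    obtain rfl : q = l := by omega
    obtain rfl : i = 0 := Fin.ext (Nat.lt_one_iff.1 i.2)
    rw [List.ofFn_succ, List.ofFn_zero, List.prod_singleton, blockProd_self]
    congr 3
    funext b
    congr 1
    ext
    simp [inner]
  | succ p ih =>
    obtain ⟨m, rfl⟩ : ∃ m, l = m + 1 := ⟨p + q, by omega⟩
    have hm : p + q = m := by omega
    induction i using Fin.cases with
    | zero =>
      have h1 : (List.ofFn f).prod = (List.ofFn fun b : Fin (q + 1) => f (inner hl 0 b)).prod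
          * (List.ofFn fun a : Fin (p + 1) => f (outer hl 0 a.succ)).prod := by
        have h2 : m + 1 + 1 = (q + 1) + (p + 1) := by omega
        rw [List.ofFn_congr h2, List.ofFn_add, List.prod_append]
        congr 3
        · funext b
          congr 1
          ext
          simp [inner]
        · funext a
          congr 1
          ext
          simp [outer]
          omega
      rw [List.ofFn_succ, List.prod_cons, blockProd_self, h1]
      congr 3
    | succ i =>
      have h0 : outer hl i.succ 0 = 0 := by
        ext; simp [outer]
      have ho : ∀ a : Fin (p + 1), outer hl i.succ a.succ = (outer hm i a).succ := fun a => by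
        ext
        simp only [outer, Fin.succ_lt_succ_iff]
        split_ifs <;> simp <;> omega
      have hi : ∀ b : Fin (q + 1), inner hl i.succ b = (inner hm i b).succ := fun b => by
        ext
        simp [inner]
        omega
      rw [List.ofFn_succ, List.prod_cons, List.ofFn_succ (f := f), List.prod_cons,
        ← ih hm i fun c => f c.succ, V.blockProd_of_ne hl (Fin.succ_ne_zero i).symm, h0]
      congr 3
      funext a
      by_cases ha : a = i
      · subst ha
        rw [blockProd_self, blockProd_self]
        simp only [hi]
      · rw [V.blockProd_of_ne hl (fun h => ha (Fin.succ_injective _ h)), V.blockProd_of_ne hm ha, ho]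

/-- Multiplication of the factors of the block at `i` of a tensor power. -/
def mulBlock {p q l : ℕ} (hl : p + q = l) (i : Fin (p + 1)) :
    V.Tensor (l + 1) →ₗ[ℝ] V.Tensor (p + 1) :=
  PiTensorProduct.lift (MultilinearMap.mk'
    (fun f => PiTensorProduct.tprod ℝ (V.blockProd hl i f))
    (fun f c x y => by
      unfold blockProd
      rcases inner_or_outer hl i c with ⟨b, rfl⟩ | ⟨a, ha, rfl⟩
      · simp only [compArgs_inner, MultilinearMap.map_update_add]
      · simp only [compArgs_outer hl i _ _ f a ha]
        split_ifs <;> simp only [map_add, MultilinearMap.map_update_add])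
    (fun f c t x => by
      unfold blockProd
      rcases inner_or_outer hl i c with ⟨b, rfl⟩ | ⟨a, ha, rfl⟩
      · simp only [compArgs_inner, MultilinearMap.map_update_smul]
      · simp only [compArgs_outer hl i _ _ f a ha]
        split_ifs <;> simp only [map_smul, MultilinearMap.map_update_smul]))

theorem mulBlock_tprod {p q l : ℕ} (hl : p + q = l) (i : Fin (p + 1)) (f : Fin (l + 1) → V.Fn) :
    V.mulBlock hl i (PiTensorProduct.tprod ℝ f) = PiTensorProduct.tprod ℝ (V.blockProd hl i f) := by
  rw [mulBlock, PiTensorProduct.lift.tprod]; rfl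

theorem mulMap_comp_mulBlock {p q l : ℕ} (hl : p + q = l) (i : Fin (p + 1)) :
    V.mulMap (p + 1) ∘ₗ V.mulBlock hl i = V.mulMap (l + 1) := by
  refine V.tensor_ext fun f => ?_
  rw [LinearMap.comp_apply, mulBlock_tprod, mulMap_tprod, mulMap_tprod, prod_blockProd]

/-- The Leibniz rule for the multiplication of a block of factors. -/
theorem pdAt_mulBlock {p q l : ℕ} (hl : p + q = l) (i a : Fin (p + 1)) (z : V.Crd)
    (t : V.Tensor (l + 1)) : V.pdAt z a (V.mulBlock hl i t)
      = ∑ c ∈ spread hl i a, V.mulBlock hl i (V.pdAt z c t) := by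
  have h : V.pdAt z a ∘ₗ V.mulBlock hl i
      = ∑ c ∈ spread hl i a, V.mulBlock hl i ∘ₗ V.pdAt z c := by
    refine V.tensor_ext fun f => ?_
    rw [LinearMap.sum_apply]
    simp only [LinearMap.comp_apply, pdAt_tprod, mulBlock_tprod]
    by_cases ha : a = i
    · subst ha
      have h1 : ∀ b, V.blockProd hl a (fun c => V.slot z (inner hl a b) c (f c))
          = Function.update (fun e => V.slot z a e (V.blockProd hl a f e)) a
            (List.ofFn fun b' => V.slot z b b' (f (inner hl a b'))).prod := fun b => by
        funext e
        by_cases he : e = a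
        · subst he
          rw [blockProd_self, Function.update_self]
          congr 3
          funext b'
          simp only [slot, inner_lt_inner, (inner_injective hl e).eq_iff]
        · rw [V.blockProd_of_ne hl he, Function.update_of_ne he, V.blockProd_of_ne hl he]
          simp only [slot, outer_lt_inner hl he, outer_ne_inner hl a e he b, he]
      rw [spread_self, Finset.sum_image fun b _ b' _ h => inner_injective hl a h]
      simp only [h1]
      -- The terms differ only in the entry of the block, so their sum is the Leibniz expansion of
      -- one derivative of the block product.
      rw [← MultilinearMap.map_update_sum, ← pd_prod]
      congr 1
      funext e
      by_cases he : e = a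
      · subst he
        rw [Function.update_self, slot_self, blockProd_self]
      · rw [Function.update_of_ne he]
    · rw [spread_of_ne hl ha, Finset.sum_singleton]
      congr 1
      funext e
      by_cases he : e = i
      · subst he
        rw [blockProd_self, blockProd_self]
        rcases lt_or_gt_of_ne ha with h | h
        · rw [slot_of_gt V z h, LinearMap.id_apply]
          congr 3
          funext b
          rw [slot_of_gt V z ((outer_lt_inner hl ha b).2 h), LinearMap.id_apply]
        -- A derivative acting after the block passes the block product with a parity, which is
        -- distributed over its factors because the degree involution is multiplicative.
        · rw [slot_of_lt V z h, par_pow_prod]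
          congr 3
          funext b
          rw [slot_of_lt V z ((inner_lt_outer hl ha b).2 h)]
      · rw [V.blockProd_of_ne hl he, V.blockProd_of_ne hl he]
        have h1 : outer hl i e = outer hl i a ↔ e = a :=
          ⟨outer_inj hl i e a he ha, fun h => by rw [h]⟩
        simp only [slot, outer_lt_outer hl ha he, h1]
  have h1 := LinearMap.congr_fun h t
  rwa [LinearMap.sum_apply] at h1

theorem Delta_mulBlock {p q l : ℕ} (hl : p + q = l) (i a b : Fin (p + 1)) (t : V.Tensor (l + 1)) :
    V.Delta a b (V.mulBlock hl i t)
      = ∑ c ∈ spread hl i a, ∑ e ∈ spread hl i b, V.mulBlock hl i (V.Delta c e t) := by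
  have h1 := V.map_pairing (LinearMap.applyₗ (V.mulBlock hl i t) :
    Module.End ℝ (V.Tensor (p + 1)) →ₗ[ℝ] V.Tensor (p + 1)) fun z w => V.pdAt z a * V.pdAt w b
  have h2 : ∀ c e, V.mulBlock hl i (V.Delta c e t)
      = V.pairing _ fun z w => V.mulBlock hl i (V.pdAt z c (V.pdAt w e t)) := fun c e => by
    have h3 := V.map_pairing (V.mulBlock hl i ∘ₗ (LinearMap.applyₗ t :
      Module.End ℝ (V.Tensor (l + 1)) →ₗ[ℝ] V.Tensor (l + 1))) fun z w => V.pdAt z c * V.pdAt w e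
    rw [← Delta_eq_pairing] at h3
    exact h3
  rw [← Delta_eq_pairing] at h1
  refine h1.trans ?_
  simp only [h2, ← map_sum]
  refine V.pairing_congr fun z w _ => ?_
  simp only [Finset.sum_apply]
  change V.pdAt z a (V.pdAt w b (V.mulBlock hl i t)) = _
  rw [pdAt_mulBlock, map_sum, Finset.sum_comm]
  exact Finset.sum_congr rfl fun e _ => V.pdAt_mulBlock hl i a z _

/-- Each end of an edge at `i` differentiates the product of a block and by the Leibniz rule may act
on any factor, independently of the other ends. This is the reconnection rule of the graph operad,
and it needs verification on one edge only. -/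
theorem graphOp_mulBlock {p q l : ℕ} (hl : p + q = l) (i : Fin (p + 1))
    (X : GraAlg ((n : ℤ) + 1) (p + 1)) (t : V.Tensor (l + 1)) :
    V.graphOp (p + 1) X (V.mulBlock hl i t)
      = V.mulBlock hl i (V.graphOp (l + 1) (GraAlg.reconnect _ (spread hl i) X) t) := by
  induction X using GraAlg.induction generalizing t with
  | algebraMap r =>
    rw [AlgHom.commutes, AlgHom.commutes, AlgHom.commutes, Module.algebraMap_end_apply,
      Module.algebraMap_end_apply, map_smul]
  | edge e =>
    rw [graphOp_edge, Delta_mulBlock, ← Prod.mk.eta (p := e), GraAlg.reconnect_edge]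
    simp only [map_sum, LinearMap.sum_apply, graphOp_edge]
  | mul X Y hX hY =>
    rw [map_mul, Module.End.mul_apply, hY, hX, map_mul, map_mul, Module.End.mul_apply]
  | add X Y hX hY =>
    rw [map_add, LinearMap.add_apply, hX, hY, map_add, map_add, LinearMap.add_apply, map_add]

/-! ## Insertion of factors -/

/-- The family `f` with the entries of the block at `i` replaced by those of `g`. -/
def replaceBlock {p q l : ℕ} (hl : p + q = l) (i : Fin (p + 1)) (f : Fin (l + 1) → V.Fn)
    (g : Fin (q + 1) → V.Fn) (c : Fin (l + 1)) : V.Fn :=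
  Sum.elim g (fun _ => f c) ((blockEquiv hl i).symm c)

theorem replaceBlock_inner {p q l : ℕ} (hl : p + q = l) (i : Fin (p + 1)) (f : Fin (l + 1) → V.Fn)
    (g : Fin (q + 1) → V.Fn) (b : Fin (q + 1)) : V.replaceBlock hl i f g (inner hl i b) = g b := by
  simp [replaceBlock]

theorem replaceBlock_outer {p q l : ℕ} (hl : p + q = l) {i a : Fin (p + 1)} (ha : a ≠ i)
    (f : Fin (l + 1) → V.Fn) (g : Fin (q + 1) → V.Fn) :
    V.replaceBlock hl i f g (outer hl i a) = f (outer hl i a) := by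
  simp [replaceBlock, blockEquiv_symm_outer hl i a ha]

theorem replaceBlock_update {p q l : ℕ} (hl : p + q = l) (i : Fin (p + 1)) (f : Fin (l + 1) → V.Fn)
    (g : Fin (q + 1) → V.Fn) (b : Fin (q + 1)) (x : V.Fn) :
    V.replaceBlock hl i f (Function.update g b x)
      = Function.update (V.replaceBlock hl i f g) (inner hl i b) x := by
  funext c
  rcases inner_or_outer hl i c with ⟨b', rfl⟩ | ⟨a, ha, rfl⟩
  · rw [replaceBlock_inner]
    by_cases hb : b' = b
    · subst hb; simp
    · rw [Function.update_of_ne hb, Function.update_of_ne fun h => hb (inner_injective hl i h),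
        replaceBlock_inner]
  · rw [V.replaceBlock_outer hl ha, Function.update_of_ne (outer_ne_inner hl i a ha b),
      V.replaceBlock_outer hl ha]

/-- The inclusion of a tensor power as a block of a larger one, the other factors being given by
`f`. -/
def insertBlock {p q l : ℕ} (hl : p + q = l) (i : Fin (p + 1)) (f : Fin (l + 1) → V.Fn) :
    V.Tensor (q + 1) →ₗ[ℝ] V.Tensor (l + 1) :=
  PiTensorProduct.lift (MultilinearMap.mk'
    (fun g => PiTensorProduct.tprod ℝ (V.replaceBlock hl i f g))
    (fun g b x y => by simp only [replaceBlock_update, MultilinearMap.map_update_add])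
    (fun g b t x => by simp only [replaceBlock_update, MultilinearMap.map_update_smul]))

theorem insertBlock_tprod {p q l : ℕ} (hl : p + q = l) (i : Fin (p + 1)) (f : Fin (l + 1) → V.Fn)
    (g : Fin (q + 1) → V.Fn) : V.insertBlock hl i f (PiTensorProduct.tprod ℝ g)
      = PiTensorProduct.tprod ℝ (V.replaceBlock hl i f g) := by
  rw [insertBlock, PiTensorProduct.lift.tprod]; rfl

theorem tprod_eq_insertBlock {p q l : ℕ} (hl : p + q = l) (i : Fin (p + 1))
    (f : Fin (l + 1) → V.Fn) : PiTensorProduct.tprod ℝ f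
      = V.insertBlock hl i f (PiTensorProduct.tprod ℝ fun b => f (inner hl i b)) := by
  rw [insertBlock_tprod]
  congr 1
  funext c
  rcases inner_or_outer hl i c with ⟨b, rfl⟩ | ⟨a, ha, rfl⟩
  · rw [replaceBlock_inner]
  · rw [V.replaceBlock_outer hl ha]

/-- The family `f` with the sign `(-1)^(m f)` on the entries before the block at `i`. -/
def signBefore {p l : ℕ} (i : Fin (p + 1)) (m : ℕ) (f : Fin (l + 1) → V.Fn) (c : Fin (l + 1)) :
    V.Fn := if (c : ℕ) < i then (V.par ^ m) (f c) else f c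

theorem signBefore_signBefore {p l : ℕ} (i : Fin (p + 1)) (m m' : ℕ) (f : Fin (l + 1) → V.Fn) :
    V.signBefore i m (V.signBefore i m' f) = V.signBefore i (m + m') f := by
  funext c
  simp only [signBefore]
  split_ifs
  · rw [pow_add, Module.End.mul_apply]
  · rfl

theorem signBefore_zero {p l : ℕ} (i : Fin (p + 1)) (f : Fin (l + 1) → V.Fn) :
    V.signBefore i 0 f = f := by
  funext c
  simp [signBefore]

theorem signBefore_outer {p q l : ℕ} (hl : p + q = l) {i a : Fin (p + 1)} (ha : a ≠ i) (m : ℕ)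
    (f : Fin (l + 1) → V.Fn) : V.signBefore i m f (outer hl i a)
      = if a < i then (V.par ^ m) (f (outer hl i a)) else f (outer hl i a) := by
  have h := outer_lt_inner hl ha (0 : Fin (q + 1))
  rw [Fin.lt_def, inner_val] at h
  simp only [Fin.val_zero, add_zero] at h
  simp only [signBefore, h]

/-- A derivative inside the block must also pass the functions standing before the block; their
parities are recorded by `signBefore` and accumulate edge by edge. -/
theorem pdAt_insertBlock {p q l : ℕ} (hl : p + q = l) (i : Fin (p + 1)) (f : Fin (l + 1) → V.Fn)
    (z : V.Crd) (b : Fin (q + 1)) (t : V.Tensor (q + 1)) :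
    V.pdAt z (inner hl i b) (V.insertBlock hl i f t)
      = V.insertBlock hl i (V.signBefore i z.deg f) (V.pdAt z b t) := by
  have h : V.pdAt z (inner hl i b) ∘ₗ V.insertBlock hl i f
      = V.insertBlock hl i (V.signBefore i z.deg f) ∘ₗ V.pdAt z b := by
    refine V.tensor_ext fun g => ?_
    simp only [LinearMap.comp_apply, insertBlock_tprod, pdAt_tprod]
    congr 1
    funext c
    rcases inner_or_outer hl i c with ⟨b', rfl⟩ | ⟨a, ha, rfl⟩
    · rw [replaceBlock_inner, replaceBlock_inner]
      simp only [slot, inner_lt_inner, (inner_injective hl i).eq_iff]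
    · rw [V.replaceBlock_outer hl ha, V.replaceBlock_outer hl ha, V.signBefore_outer hl ha]
      simp only [slot, outer_lt_inner hl ha, outer_ne_inner hl i a ha b, if_false]
      split_ifs <;> rfl
  exact LinearMap.congr_fun h t

theorem Delta_insertBlock {p q l : ℕ} (hl : p + q = l) (i : Fin (p + 1)) (f : Fin (l + 1) → V.Fn)
    (b b' : Fin (q + 1)) (t : V.Tensor (q + 1)) :
    V.Delta (inner hl i b) (inner hl i b') (V.insertBlock hl i f t)
      = V.insertBlock hl i (V.signBefore i n f) (V.Delta b b' t) := by
  have h1 := V.map_pairing (LinearMap.applyₗ (V.insertBlock hl i f t) :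
    Module.End ℝ (V.Tensor (l + 1)) →ₗ[ℝ] V.Tensor (l + 1))
    fun z w => V.pdAt z (inner hl i b) * V.pdAt w (inner hl i b')
  have h2 := V.map_pairing (V.insertBlock hl i (V.signBefore i n f) ∘ₗ (LinearMap.applyₗ t :
    Module.End ℝ (V.Tensor (q + 1)) →ₗ[ℝ] V.Tensor (q + 1))) fun z w => V.pdAt z b * V.pdAt w b'
  rw [← Delta_eq_pairing] at h1 h2
  refine h1.trans (Eq.trans ?_ h2.symm)
  refine V.pairing_congr fun z w hzw => ?_
  change V.pdAt z _ (V.pdAt w _ (V.insertBlock hl i f t)) = V.insertBlock hl i _ (V.pdAt z b _)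
  rw [pdAt_insertBlock, pdAt_insertBlock, signBefore_signBefore, hzw]

theorem graphOp_insertBlock {p q l : ℕ} (hl : p + q = l) (i : Fin (p + 1))
    (f : Fin (l + 1) → V.Fn) (E : List (Fin (q + 1) × Fin (q + 1))) (t : V.Tensor (q + 1)) :
    V.graphOp (l + 1) (GraAlg.relabel _ (inner hl i) (GraAlg.graph _ E)) (V.insertBlock hl i f t)
      = V.insertBlock hl i (V.signBefore i (E.length * n) f)
        (V.graphOp (q + 1) (GraAlg.graph _ E) t) := by
  induction E with
  | nil => simp [signBefore_zero]
  | cons e E ih =>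
    obtain ⟨b, b'⟩ := e
    rw [GraAlg.graph_cons, map_mul, map_mul, map_mul, Module.End.mul_apply, ih,
      GraAlg.relabel_edge, graphOp_edge, graphOp_edge, Delta_insertBlock, signBefore_signBefore,
      Module.End.mul_apply, List.length_cons]
    congr 3
    ring

theorem mulBlock_insertBlock {p q l : ℕ} (hl : p + q = l) (i : Fin (p + 1))
    (f : Fin (l + 1) → V.Fn) (t : V.Tensor (q + 1)) : V.mulBlock hl i (V.insertBlock hl i f t)
      = PiTensorProduct.tprod ℝ
        (Function.update (fun a => f (outer hl i a)) i (V.mulMap (q + 1) t)) := by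
  have h : V.mulBlock hl i ∘ₗ V.insertBlock hl i f
      = (PiTensorProduct.tprod ℝ).toLinearMap (fun a => f (outer hl i a)) i
        ∘ₗ V.mulMap (q + 1) := by
    refine V.tensor_ext fun g => ?_
    simp only [LinearMap.comp_apply, insertBlock_tprod, mulBlock_tprod, mulMap_tprod,
      MultilinearMap.toLinearMap_apply]
    congr 1
    funext a
    by_cases ha : a = i
    · subst ha
      rw [blockProd_self, Function.update_self]
      simp only [replaceBlock_inner]
    · rw [V.blockProd_of_ne hl ha, V.replaceBlock_outer hl ha, Function.update_of_ne ha]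
  exact LinearMap.congr_fun h t

/-- A graph with `m` edges puts the parity to the power `m n` on the functions before the block. Its
degree is `m (1 - d) = -m n`, so this is the sign with which the inserted map passes its
predecessors in the endomorphism operad. -/
theorem mulBlock_graphOp_relabel {p q l : ℕ} (hl : p + q = l) (i : Fin (p + 1)) {k : ℤ}
    {Y : GraAlg ((n : ℤ) + 1) (q + 1)} (hY : Y ∈ graDeg ((n : ℤ) + 1) (q + 1) k)
    (f : Fin (l + 1) → V.Fn) :
    V.mulBlock hl i (V.graphOp (l + 1) (GraAlg.relabel _ (inner hl i) Y)
        (PiTensorProduct.tprod ℝ f))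
      = PiTensorProduct.tprod ℝ (compArgs hl i (V.par ^ k.natAbs) (V.graphMult q Y) f) := by
  rw [compArgs_eq]
  induction hY using Submodule.span_induction with
  | mem Y h =>
    obtain ⟨E, hE, rfl⟩ := h
    rw [V.tprod_eq_insertBlock hl i f, graphOp_insertBlock, mulBlock_insertBlock]
    congr 1
    funext a
    by_cases ha : a = i
    · subst ha
      rw [Function.update_self, Function.update_self, graphMult_apply]
    · rw [Function.update_of_ne ha, Function.update_of_ne ha, V.signBefore_outer hl ha]
      have h1 : V.par ^ (E.length * n) = V.par ^ k.natAbs := by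
        refine parity_pow_congr V.fnDeg_internal ?_
        rw [Int.natCast_natAbs, Int.even_sub, even_abs, ← hE]
        have h2 : (E.length : ℤ) * (1 - (n + 1)) = -((E.length * n : ℕ) : ℤ) := by
          push_cast; ring
        rw [h2, even_neg]
      rw [h1]
  | zero => simp
  | add Y Y' _ _ h h' =>
    rw [map_add, map_add, LinearMap.add_apply, map_add, h, h', map_add, add_apply,
      MultilinearMap.map_update_add]
  | smul c Y _ h =>
    rw [map_smul, map_smul, LinearMap.smul_apply, map_smul, h, map_smul, smul_apply,
      MultilinearMap.map_update_smul]

/-- The edges of the inserted graph come last in the product, so they act first and only within the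
block. Multiplying the block then makes it one argument, on which the outer graph acts by its
unreconnected edges, and multiplying the rest gives the full product by associativity. -/
theorem graphMult_comp {p q l : ℕ} (hl : p + q = l) (i : Fin (p + 1)) {k : ℤ}
    (X : GraAlg ((n : ℤ) + 1) (p + 1)) {Y : GraAlg ((n : ℤ) + 1) (q + 1)}
    (hY : Y ∈ graDeg ((n : ℤ) + 1) (q + 1) k) :
    V.graphMult l (GraAlg.reconnect _ (spread hl i) X * GraAlg.relabel _ (inner hl i) Y)
      = multComp hl i (V.par ^ k.natAbs) (V.graphMult p X) (V.graphMult q Y) := by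
  refine MultilinearMap.ext fun f => ?_
  rw [multComp_apply, graphMult_apply, graphMult_apply, ← V.mulBlock_graphOp_relabel hl i hY f,
    graphOp_mulBlock, map_mul, Module.End.mul_apply]
  exact (LinearMap.congr_fun (V.mulMap_comp_mulBlock hl i) _).symm

end NPChart

end NPOperad

end

/-! ### The representation of graphs, and the bracket as the value of one edge -/

noncomputable section

namespace NPOperad

/-- Composition of morphisms of operads. -/
def OperadHom.trans {P Q R : OperadData} (F : OperadHom P Q) (G : OperadHom Q R) :
    OperadHom P R where
  map := G.map ∘ₗ F.map
  map_one := by rw [LinearMap.comp_apply, F.map_one, G.map_one]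
  map_act σ x := by
    rw [LinearMap.comp_apply, LinearMap.comp_apply, F.map_act, G.map_act]
  map_comp hl hk i x y := by
    rw [LinearMap.comp_apply, LinearMap.comp_apply, LinearMap.comp_apply, F.map_comp, G.map_comp]

namespace NPChart

variable {n : ℕ} (V : NPChart n)

theorem graphMult_one (r : ℕ) (f : Fin (r + 1) → V.Fn) :
    V.graphMult r 1 f = (List.ofFn f).prod := by
  rw [graphMult_apply, map_one, Module.End.one_apply, mulMap_tprod]

/-- The representation of the graph operad on functions. -/
def rep : OperadHom (Gra ((n : ℤ) + 1)) V.EndFn where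
  map {r k} := ((V.graphMult r).comp Gra.toAlg).codRestrict (homDeg V.fnDeg r k)
    fun x => V.graphMult_mem (Gra.toAlg_mem x)
  map_one := Subtype.ext (MultilinearMap.ext fun f => by
    refine (V.graphMult_apply _ f).trans ?_
    rw [Gra.toAlg_one, ← graphMult_apply, graphMult_one]
    simp [EndFn, End, idMap])
  map_act σ x := Subtype.ext (V.graphMult_relabel σ (Gra.toAlg x))
  map_comp hl hk i x y := Subtype.ext (V.graphMult_comp hl i (Gra.toAlg x) (Gra.toAlg_mem y))

theorem rep_map {r : ℕ} {k : ℤ} (x : (Gra ((n : ℤ) + 1)).sp r k) :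
    (V.rep.map x).1 = V.graphMult r (Gra.toAlg x) := rfl

theorem rep_graph (r : ℕ) (E : List (Fin (r + 1) × Fin (r + 1))) (f : Fin (r + 1) → V.Fn) :
    (V.rep.map (Gra.graph ((n : ℤ) + 1) r E)).1 f = V.graphValue E f := by
  rw [rep_map, graphMult_apply]
  change V.mulMap (r + 1) (V.graphOp (r + 1) (GraAlg.graph _ E) _) = _
  rw [graphOp_graph]; rfl

theorem rep_gammaMult (f : Fin 2 → V.Fn) :
    (V.rep.map (Gra.gammaMult ((n : ℤ) + 1))).1 f = f 0 * f 1 := by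
  rw [rep_map, Gra.toAlg_gammaMult]
  refine (V.graphMult_one 1 f).trans ?_
  simp

theorem prodOf_apply (D D' : V.Fn →ₗ[ℝ] V.Fn) (f g : V.Fn) :
    V.prodOf D D' f g = D f * D' g := rfl

theorem par_pow_congr {m m' : ℕ} (h : Even (m - m' : ℤ)) (f : V.Fn) :
    (V.par ^ m) f = (V.par ^ m') f :=
  LinearMap.congr_fun (parity_pow_congr V.fnDeg_internal h) f

/-- The signs in the bracket are those for the derivative acting on `g` to pass `f`, once the degree
of each coordinate is reduced modulo two. For odd `n` the degrees of `p` and of the partner of a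
coordinate of degree `i` are congruent to `1` and `i + 1`, for even `n` to `0` and `i`. -/
theorem bracket_eq_pairing (f g : V.Fn) : V.bracket f g
    = V.pairing V.Fn fun z w => V.pd z ((V.par ^ w.deg) f) * V.pd w g := by
  have hx : ∀ μ, (V.par ^ Coord.deg (.x μ : V.Crd)) f = f := fun μ => by
    rw [Coord.deg, pow_zero, Module.End.one_apply]
  have hpsi : ∀ i α, (V.par ^ Coord.deg (.psi i α : V.Crd)) f = (V.par ^ (i + 1 : ℕ)) f :=
    fun i α => by rw [Coord.deg]
  by_cases hn : Odd n
  · have hn' : Odd (n : ℤ) := by exact_mod_cast hn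
    have hp : ∀ μ, (V.par ^ Coord.deg (.p μ : V.Crd)) f = V.par f := fun μ => by
      rw [Coord.deg, V.par_pow_congr (m' := 1), pow_one]
      exact hn'.sub_odd odd_one
    have hchi : ∀ i α, (V.par ^ Coord.deg (.chi i α : V.Crd)) f
        = (V.par ^ (i + 1 + 1 : ℕ)) f := fun i α => by
      have hi := i.2
      refine V.par_pow_congr ?_ f
      rw [Coord.deg, Nat.cast_sub (by omega)]
      push_cast
      simp only [Int.even_sub, Int.even_add, Int.not_even_iff_odd.2 hn', Int.not_even_one]
      tauto
    rw [pairing_of_odd V hn, bracket, if_pos hn]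
    simp only [LinearMap.add_apply, LinearMap.sum_apply, prodOf_apply, LinearMap.comp_apply, hx, hp,
      hpsi, hchi]
  · have hn' : Even (n : ℤ) := by exact_mod_cast Nat.not_odd_iff_even.1 hn
    have hp : ∀ μ, (V.par ^ Coord.deg (.p μ : V.Crd)) f = f := fun μ => by
      rw [Coord.deg, V.par_pow_congr (m' := 0), pow_zero, Module.End.one_apply]
      simpa using hn'
    have hchi : ∀ i α, (V.par ^ Coord.deg (.chi i α : V.Crd)) f
        = (V.par ^ (i + 1 : ℕ)) f := fun i α => by
      have hi := i.2
      refine V.par_pow_congr ?_ f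
      rw [Coord.deg, Nat.cast_sub (by omega)]
      push_cast
      simp only [Int.even_sub, Int.even_add, hn', Int.not_even_one]
      tauto
    have hxi : ∀ a, (V.par ^ Coord.deg (.xi a : V.Crd)) f = (V.par ^ (n / 2)) f := fun a => by
      rw [Coord.deg]
    rw [pairing_of_not_odd V hn, bracket, if_neg hn]
    simp only [LinearMap.add_apply, LinearMap.sum_apply, LinearMap.sub_apply, LinearMap.smul_apply,
      prodOf_apply, LinearMap.comp_apply, hx, hp, hpsi, hchi, hxi]

/-- For a single edge, the derivative on the second factor leaves a parity on the first, where the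
other derivative then acts; this is the summand of the bracket. -/
theorem rep_gammaBr (f : Fin 2 → V.Fn) :
    (V.rep.map (Gra.gammaBr ((n : ℤ) + 1))).1 f = V.bracket (f 0) (f 1) := by
  rw [rep_map, Gra.toAlg_gammaBr, bracket_eq_pairing]
  refine (V.graphMult_apply _ f).trans ?_
  rw [graphOp_edge]
  have h := V.map_pairing (V.mulMap 2 ∘ₗ (LinearMap.applyₗ (PiTensorProduct.tprod ℝ f) :
    Module.End ℝ (V.Tensor 2) →ₗ[ℝ] V.Tensor 2)) fun z w => V.pdAt z 0 * V.pdAt w 1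
  rw [← Delta_eq_pairing] at h
  refine h.trans (V.pairing_congr fun z w _ => ?_)
  change V.mulMap 2 (V.pdAt z 0 (V.pdAt w 1 (PiTensorProduct.tprod ℝ f))) = _
  rw [pdAt_tprod, pdAt_tprod, mulMap_tprod]
  have h01 : (0 : Fin 2) < 1 := Fin.zero_lt_one
  simp [slot_self, slot_of_lt V w h01, slot_of_gt V z h01]

end NPChart

end NPOperad

end

theorem mainTheorem2 (n : ℕ) :
    NPOperad.IsOperad (NPOperad.Ger ((n : ℤ) + 1)) ∧
    NPOperad.IsOperad (NPOperad.Gra ((n : ℤ) + 1)) ∧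
    -- the embedding `i_d`, with `d = n + 1`
    ∃ i : NPOperad.OperadHom (NPOperad.Ger ((n : ℤ) + 1)) (NPOperad.Gra ((n : ℤ) + 1)),
      i.map (NPOperad.Ger.mul ((n : ℤ) + 1)) = NPOperad.Gra.gammaMult ((n : ℤ) + 1) ∧
      i.map (NPOperad.Ger.br ((n : ℤ) + 1)) = NPOperad.Gra.gammaBr ((n : ℤ) + 1) ∧
      (∀ i' : NPOperad.OperadHom (NPOperad.Ger ((n : ℤ) + 1)) (NPOperad.Gra ((n : ℤ) + 1)),
        i'.map (NPOperad.Ger.mul ((n : ℤ) + 1)) = NPOperad.Gra.gammaMult ((n : ℤ) + 1) →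
        i'.map (NPOperad.Ger.br ((n : ℤ) + 1)) = NPOperad.Gra.gammaBr ((n : ℤ) + 1) → i' = i) ∧
      (∀ (r : ℕ) (k : ℤ), Function.Injective (i.map (r := r) (k := k))) ∧
      ∀ V : NPOperad.NPChart n,
        NPOperad.IsOperad V.EndFn ∧
        -- the representation `Rep` of graphs, and the action `ρ` of `Ger_d`
        ∃ (Rep : NPOperad.OperadHom (NPOperad.Gra ((n : ℤ) + 1)) V.EndFn)
          (ρ : NPOperad.OperadHom (NPOperad.Ger ((n : ℤ) + 1)) V.EndFn),
          (∀ (r : ℕ) (E : List (Fin (r + 1) × Fin (r + 1))) (f : Fin (r + 1) → V.Fn),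
            (Rep.map (NPOperad.Gra.graph ((n : ℤ) + 1) r E)).1 f = V.graphValue E f) ∧
          (∀ f : Fin 2 → V.Fn,
            (ρ.map (NPOperad.Ger.mul ((n : ℤ) + 1))).1 f = f 0 * f 1) ∧
          (∀ f : Fin 2 → V.Fn,
            (ρ.map (NPOperad.Ger.br ((n : ℤ) + 1))).1 f = V.bracket (f 0) (f 1)) ∧
          (∀ ρ' : NPOperad.OperadHom (NPOperad.Ger ((n : ℤ) + 1)) V.EndFn,
            (∀ f : Fin 2 → V.Fn,
              (ρ'.map (NPOperad.Ger.mul ((n : ℤ) + 1))).1 f = f 0 * f 1) →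
            (∀ f : Fin 2 → V.Fn,
              (ρ'.map (NPOperad.Ger.br ((n : ℤ) + 1))).1 f = V.bracket (f 0) (f 1)) → ρ' = ρ) ∧
          (∀ f : Fin 2 → V.Fn,
            (Rep.map (NPOperad.Gra.gammaMult ((n : ℤ) + 1))).1 f = f 0 * f 1) ∧
          (∀ f : Fin 2 → V.Fn,
            (Rep.map (NPOperad.Gra.gammaBr ((n : ℤ) + 1))).1 f = V.bracket (f 0) (f 1)) ∧
          -- the factorisation
          ∀ (r : ℕ) (k : ℤ) (t : (NPOperad.Ger ((n : ℤ) + 1)).sp r k),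
            ρ.map t = Rep.map (i.map t) := by
  -- The action of `Ger_d` is taken to be the composite through graphs, so the factorisation holds
  -- by definition and its values on the generators are those computed for the two basic graphs.
  refine ⟨NPOperad.Ger.isOperad _, NPOperad.Gra.isOperad _, NPOperad.Gra.ofGer _,
    NPOperad.Gra.ofGer_mul _, NPOperad.Gra.ofGer_br _,
    fun i' hm hb => NPOperad.Ger.hom_ext (hm.trans (NPOperad.Gra.ofGer_mul _).symm)
      (hb.trans (NPOperad.Gra.ofGer_br _).symm),
    fun r k => NPOperad.Gra.ofGer_injective, fun V => ⟨NPOperad.End.isOperad _, V.rep,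
      (NPOperad.Gra.ofGer _).trans V.rep, V.rep_graph, ?_, ?_, ?_, V.rep_gammaMult, V.rep_gammaBr,
      fun r k t => rfl⟩⟩
  · intro f
    exact (congrArg (fun x => (V.rep.map x).1 f) (NPOperad.Gra.ofGer_mul _)).trans
      (V.rep_gammaMult f)
  · intro f
    exact (congrArg (fun x => (V.rep.map x).1 f) (NPOperad.Gra.ofGer_br _)).trans
      (V.rep_gammaBr f)
  -- A multilinear map is determined by its values, so the prescribed values on functions fix the
  -- images of the two generators.
  · intro ρ' hm hb
    refine NPOperad.Ger.hom_ext (Subtype.ext (MultilinearMap.ext fun f => (hm f).trans ?_))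
      (Subtype.ext (MultilinearMap.ext fun f => (hb f).trans ?_))
    · exact ((congrArg (fun x => (V.rep.map x).1 f) (NPOperad.Gra.ofGer_mul _)).trans
        (V.rep_gammaMult f)).symm
    · exact ((congrArg (fun x => (V.rep.map x).1 f) (NPOperad.Gra.ofGer_br _)).trans
        (V.rep_gammaBr f)).symm
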